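/- Let $k$ be a field, let $H$ be a Hopf algebra over $k$ that is semisimple (as a ring), cosemisimple (the sum of its simple subcoalgebras), and commutative or cocommutative, and let $R$ be a unital $k$-algebra. Let $H\otimes R\to R$, $h\otimes r\mapsto h\cdot r$, be a $k$-linear map with $1\cdot r=r$, $h\cdot(rs)=\sum(h_1\cdot r)(h_2\cdot s)$ and $h\cdot 1=\varepsilon(h)1$, and let $\sigma\in\operatorname{Hom}_k(H\otimes H,R)$ be convolution invertible, such that for all $h,g,l\in H$ and $r\in R$ $$h\cdot(g\cdot r)=\sum\sigma(h_1,g_1)\,(h_2g_2\cdot r)\,\sigma^{-1}(h_3,g_3),$$ $$\sum(h_1\cdot\sigma(g_1,l_1))\,\sigma(h_2,g_2l_2)=\sum\sigma(h_1,g_1)\,\sigma(h_2g_2,l),\qquad \sigma(1,h)=\sigma(h,1)=\varepsilon(h)1.$$ Let $R\#_\sigma H$ be the crossed product, i.e. the unital associative algebra with underlying space $R\otimes H$ (write $r\#h=r\otimes h$), multiplication $(r\#h)(s\#g)=\sum r\,(h_1\cdot s)\,\sigma(h_2,g_1)\#h_3g_2$ and identity $1\#1$. Let $r_j$ denote the Jacobson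 radical, and put $r_{jH}(R)=\{x\in R: h\cdot x\in r_j(R)\text{ for all }h\in H\}$. An $R$-$H$-module is a left $R$-module $M$ with a $k$-linear map $H\otimes M\to M$, $h\otimes m\mapsto hm$, such that $1m=m$, $h(am)=\sum(h_1\cdot a)(h_2m)$ and $h(gm)=\sum\sigma(h_1,g_1)\,((h_2g_2)m)$; it is irreducible if $RM\neq0$ and its only $R$-submodules stable under $H$ are $0$ and $M$. Let $r_{Hj}(R)$ be the intersection of the annihilators in $R$ of all irreducible $R$-$H$-modules. Suppose that there is an algebraic closure $F$ of $k$ with $$r_j(R\otimes_kF)=r_j(R)\otimes_kF\quad\text{and}\quad r_j((R\#_\sigma H)\otimes_kF)=r_j(R\#_\sigma H)\otimes_kF.$$ Then (1) $r_j(R)=r_{Hj}(R)=r_{jH}(R)$; (2) $r_j(R\#_\sigma H)=r_{Hj}(R)\#_\sigma H$. -/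

import Mathlib

open TensorProduct WithConv

universe u v w x

noncomputable section

/-! ### Cosemisimple coalgebras -/

section Cosemisimple

variable (k : Type u) {H : Type v} [Field k] [AddCommGroup H] [Module k H] [Coalgebra k H]

/-- `C` is a subcoalgebra: `Δ(C) ⊆ C ⊗ C` (the image of `C ⊗ C` in `H ⊗ H`). -/
def IsSubcoalgebra (C : Submodule k H) : Prop :=
  ∀ c ∈ C, Coalgebra.comul (R := k) c ∈ LinearMap.range (TensorProduct.map C.subtype C.subtype)

/-- A simple subcoalgebra: a nonzero subcoalgebra without nontrivial subcoalgebras. -/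
def IsSimpleSubcoalgebra (C : Submodule k H) : Prop :=
  IsSubcoalgebra k C ∧ C ≠ ⊥ ∧
    ∀ C' : Submodule k H, C' ≤ C → IsSubcoalgebra k C' → C' = ⊥ ∨ C' = C

variable (H) in
/-- A coalgebra is cosemisimple if it is the sum of its simple subcoalgebras. -/
def IsCosemisimple : Prop :=
  sSup {C : Submodule k H | IsSimpleSubcoalgebra k C} = ⊤

end Cosemisimple

/-! ### Twisted module algebras -/

section ActOn

variable {k : Type u} {H : Type v} {R : Type w} [Field k] [Ring H] [HopfAlgebra k H]
  [Ring R] [Algebra k R]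
variable {D : Type x} [AddCommGroup D] [Module k D]

/-- For `act : H → R → R` and `B : D → R`, the map `h ⊗ d ↦ h · B(d)` on `H ⊗ D`. -/
def actOn (act : H →ₗ[k] R →ₗ[k] R) (B : D →ₗ[k] R) : H ⊗[k] D →ₗ[k] R :=
  TensorProduct.lift (act.compl₂ B)

@[simp] lemma actOn_tmul (act : H →ₗ[k] R →ₗ[k] R) (B : D →ₗ[k] R) (h : H) (d : D) :
    actOn act B (h ⊗ₜ d) = act h (B d) := rfl

end ActOn

section DropLast

variable (k : Type u) (H : Type v) (C : Type w) [Field k] [Ring H] [HopfAlgebra k H]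
  [AddCommGroup C] [Module k C] [Coalgebra k C]

/-- The coalgebra map `c ⊗ h ↦ ε(h) c` from `C ⊗ H` to `C`. -/
def dropLast : C ⊗[k] H →ₗc[k] C :=
  (Coalgebra.TensorProduct.rid k k C).toCoalgHom.comp
    (Coalgebra.TensorProduct.map (CoalgHom.id k C) (Coalgebra.counitCoalgHom k H))

@[simp] lemma dropLast_tmul (c : C) (h : H) :
    dropLast k H C (c ⊗ₜ h) = Coalgebra.counit (R := k) h • c := rfl

end DropLast

/-- A twisted `H`-module algebra structure on the unital algebra `R`, with the cocycle and
normalization conditions which express that `R #_σ H` is an associative algebra with identity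
`1 # 1`.  Identities in several Hopf algebra variables are written as identities in the convolution
algebras `Hom(H, R)`, `Hom(H ⊗ H, R)` and `Hom(H ⊗ (H ⊗ H), R)`;
the docstrings give them in Sweedler notation. -/
structure CrossedSystem (k : Type u) (H : Type v) (R : Type w) [Field k] [Ring H]
    [HopfAlgebra k H] [Ring R] [Algebra k R] where
  /-- the weak action `h · r` -/
  act : H →ₗ[k] R →ₗ[k] R
  /-- the convolution-invertible map `σ : H ⊗ H → R` -/
  sigma : (WithConv (H ⊗[k] H →ₗ[k] R))ˣ
  /-- `h · (rs) = ∑ (h₁ · r)(h₂ · s)` -/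
  act_mul : ∀ r s : R,
    toConv (act.flip (r * s)) = toConv (act.flip r) * toConv (act.flip s)
  /-- `h · 1 = ε(h) 1` -/
  act_one : ∀ h : H, act h 1 = algebraMap k R (Coalgebra.counit (R := k) h)
  /-- `1 · r = r` -/
  one_act : ∀ r : R, act 1 r = r
  /-- `h · (g · r) = ∑ σ(h₁, g₁) (h₂g₂ · r) σ⁻¹(h₃, g₃)` -/
  twisted : ∀ r : R,
    toConv (actOn act (act.flip r)) =
      sigma.val * toConv (act.flip r ∘ₗ LinearMap.mul' k H) * (sigma⁻¹).val
  /-- `∑ (h₁ · σ(g₁, l₁)) σ(h₂, g₂l₂) = ∑ σ(h₁, g₁) σ(h₂g₂, l)`; both sides are written as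
  convolution products of functions of `h ⊗ (g ⊗ l)`, the first factor on the right being
  `σ(h, g) ε(l)`. -/
  cocycle :
    toConv (actOn act sigma.val.ofConv) *
        toConv (sigma.val.ofConv ∘ₗ (LinearMap.mul' k H).lTensor H) =
      toConv (sigma.val.ofConv ∘ₗ (dropLast k H (H ⊗[k] H)).toLinearMap ∘ₗ
          (TensorProduct.assoc k H H H).symm.toLinearMap) *
        toConv (sigma.val.ofConv ∘ₗ (LinearMap.mul' k H).rTensor H ∘ₗ
          (TensorProduct.assoc k H H H).symm.toLinearMap)
  /-- `σ(1, h) = ε(h) 1` -/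
  sigma_one_left : ∀ h : H,
    sigma.val.ofConv (1 ⊗ₜ h) = algebraMap k R (Coalgebra.counit (R := k) h)
  /-- `σ(h, 1) = ε(h) 1` -/
  sigma_one_right : ∀ h : H,
    sigma.val.ofConv (h ⊗ₜ 1) = algebraMap k R (Coalgebra.counit (R := k) h)

/-! ### The crossed product `R #_σ H` -/

namespace CrossedSystem

variable {k : Type u} {H : Type v} {R : Type w} [Field k] [Ring H] [HopfAlgebra k H]
  [Ring R] [Algebra k R] (D : CrossedSystem k H R)

/-- The map `h ⊗ g ↦ ∑ (h₁ · s) σ(h₂, g₁) ⊗ h₃g₂`, i.e. `(1 # h)(s # g)`, as a convolution product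
of the maps `(h · s) ε(g) ⊗ 1`, `σ(h, g) ⊗ 1` and `1 ⊗ hg` in `Hom(H ⊗ H, R ⊗ H)`. -/
def coreConv (s : R) : WithConv (H ⊗[k] H →ₗ[k] R ⊗[k] H) :=
  toConv (Algebra.TensorProduct.includeLeft.toLinearMap ∘ₗ D.act.flip s ∘ₗ
      (dropLast k H H).toLinearMap) *
    toConv (Algebra.TensorProduct.includeLeft.toLinearMap ∘ₗ D.sigma.val.ofConv) *
    toConv (Algebra.TensorProduct.includeRight.toLinearMap ∘ₗ LinearMap.mul' k H)

/-- `coreConv` as a linear map in `s`. -/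
def core : R →ₗ[k] H ⊗[k] H →ₗ[k] R ⊗[k] H where
  toFun s := (D.coreConv s).ofConv
  map_add' s t := by
    simp only [coreConv, map_add, LinearMap.add_comp, LinearMap.comp_add, toConv_add, add_mul,
      ofConv_add]
  map_smul' c s := by
    simp only [coreConv, map_smul, LinearMap.smul_comp, LinearMap.comp_smul, toConv_smul,
      smul_mul_assoc, ofConv_smul, RingHom.id_apply]

/-- The multiplication `(r # h)(s # g) = ∑ r (h₁ · s) σ(h₂, g₁) # h₃g₂` on `R ⊗ H`. -/
def mulMap : R ⊗[k] H →ₗ[k] R ⊗[k] H →ₗ[k] R ⊗[k] H :=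
  TensorProduct.lift <| LinearMap.mk₂ k
    (fun (r : R) (h : H) => LinearMap.mulLeft k (r ⊗ₜ[k] (1 : H)) ∘ₗ
      TensorProduct.lift (LinearMap.lcomp k (R ⊗[k] H) (TensorProduct.mk k H H h) ∘ₗ D.core))
    (fun r r' h => by ext; simp [add_tmul, add_mul])
    (fun c r h => by ext; simp [← smul_tmul'])
    (fun r h h' => by ext; simp [mul_add])
    (fun c r h => by ext; simp)

@[simp] lemma mulMap_tmul (r s : R) (h g : H) :
    D.mulMap (r ⊗ₜ h) (s ⊗ₜ g) = (r ⊗ₜ[k] (1 : H)) * D.core s (h ⊗ₜ g) := rfl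

/-! Associativity and unit laws. -/

lemma conv_comp {A : Type*} [Ring A] [Algebra k A] {B C : Type*} [AddCommGroup B] [Module k B]
    [Coalgebra k B] [AddCommGroup C] [Module k C] [Coalgebra k C]
    (f g : WithConv (C →ₗ[k] A)) (p : B →ₗc[k] C) :
    toConv ((f * g).ofConv ∘ₗ p.toLinearMap) =
      toConv (f.ofConv ∘ₗ p.toLinearMap) * toConv (g.ofConv ∘ₗ p.toLinearMap) := by
  apply WithConv.ext
  exact LinearMap.convMul_comp_coalgHom_distrib f g p

lemma conv_dropLast_apply {A : Type*} [Ring A] [Algebra k A] {C : Type*} [AddCommGroup C]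
    [Module k C] [Coalgebra k C] (f : C →ₗ[k] A) (G : WithConv (C ⊗[k] H →ₗ[k] A))
    {ι : Type*} {c : C} (P : Coalgebra.Repr k c ι) (h : H) :
    (toConv (f ∘ₗ (dropLast k H C).toLinearMap) * G) (c ⊗ₜ h) =
      ∑ i ∈ P.index, f (P.left i) * G (P.right i ⊗ₜ h) := by
  let Q := Coalgebra.Repr.arbitrary k h
  have hQ : ∑ j ∈ Q.index, Coalgebra.counit (R := k) (Q.left j) • Q.right j = h :=
    Coalgebra.sum_counit_smul Q
  rw [LinearMap.convMul_apply, TensorProduct.comul_tmul, ← P.eq, ← Q.eq]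
  simp only [sum_tmul, tmul_sum, map_sum, AlgebraTensorModule.tensorTensorTensorComm_tmul,
    TensorProduct.map_tmul, LinearMap.mul'_apply, LinearMap.comp_apply]
  rw [Finset.sum_comm]
  refine Finset.sum_congr rfl fun i _ => ?_
  conv_rhs => rw [← hQ]
  simp only [tmul_sum, map_sum, Finset.mul_sum]
  refine Finset.sum_congr rfl fun j _ => ?_
  simp


/-- The map `h ⊗ g ↦ ∑ σ(h₁, g₁) ⊗ h₂g₂`, i.e. `(1 # h)(1 # g)`. -/
def sigmaMul : WithConv (H ⊗[k] H →ₗ[k] R ⊗[k] H) :=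
  toConv (Algebra.TensorProduct.includeLeft.toLinearMap ∘ₗ D.sigma.val.ofConv) *
    toConv (Algebra.TensorProduct.includeRight.toLinearMap ∘ₗ LinearMap.mul' k H)

lemma coreConv_eq (s : R) : D.coreConv s =
    toConv ((Algebra.TensorProduct.includeLeft.toLinearMap ∘ₗ D.act.flip s) ∘ₗ
      (dropLast k H H).toLinearMap) * D.sigmaMul :=
  mul_assoc _ _ _

lemma core_apply (s : R) {ι : Type*} {h : H} (P : Coalgebra.Repr k h ι) (g : H) :
    D.core s (h ⊗ₜ g) =
      ∑ i ∈ P.index, (D.act (P.left i) s ⊗ₜ[k] (1 : H)) * D.sigmaMul (P.right i ⊗ₜ g) := by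
  change D.coreConv s (h ⊗ₜ g) = _
  rw [coreConv_eq, conv_dropLast_apply _ _ P]
  rfl

lemma act_mul_apply {ι : Type*} {h : H} (P : Coalgebra.Repr k h ι) (r s : R) :
    D.act h (r * s) = ∑ i ∈ P.index, D.act (P.left i) r * D.act (P.right i) s := by
  have := congrArg (fun f : WithConv (H →ₗ[k] R) => f h) (D.act_mul r s)
  simp only [P.convMul_apply] at this
  exact this

lemma actOn_conv {C : Type*} [AddCommGroup C] [Module k C] [Coalgebra k C]
    (B B' : WithConv (C →ₗ[k] R)) :
    toConv (actOn D.act (B * B').ofConv) =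
      toConv (actOn D.act B.ofConv) * toConv (actOn D.act B'.ofConv) := by
  apply WithConv.ext
  ext h c
  let P := Coalgebra.Repr.arbitrary k h
  let Q := Coalgebra.Repr.arbitrary k c
  change D.act h ((B * B') c) = (toConv (actOn D.act B.ofConv) * toConv (actOn D.act B'.ofConv))
    (h ⊗ₜ[k] c)
  rw [Q.convMul_apply, LinearMap.convMul_apply, TensorProduct.comul_tmul, ← P.eq, ← Q.eq]
  simp only [sum_tmul, tmul_sum, map_sum, AlgebraTensorModule.tensorTensorTensorComm_tmul,
    TensorProduct.map_tmul, LinearMap.mul'_apply, actOn_tmul, D.act_mul_apply P]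

/-- The coalgebra map `h ⊗ g ⊗ l ↦ hg ⊗ l`. -/
def mulFirst (k : Type u) (H : Type v) [Field k] [Ring H] [HopfAlgebra k H] :
    (H ⊗[k] H) ⊗[k] H →ₗc[k] H ⊗[k] H :=
  Coalgebra.TensorProduct.map (Bialgebra.mulCoalgHom k H) (CoalgHom.id k H)

/-- The coalgebra map `h ⊗ g ⊗ l ↦ h ⊗ gl`. -/
def mulLast (k : Type u) (H : Type v) [Field k] [Ring H] [HopfAlgebra k H] :
    (H ⊗[k] H) ⊗[k] H →ₗc[k] H ⊗[k] H :=
  (Coalgebra.TensorProduct.map (CoalgHom.id k H) (Bialgebra.mulCoalgHom k H)).comp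
    (Coalgebra.TensorProduct.assoc k k H H H).toCoalgHom

@[simp] lemma mulFirst_tmul (h g l : H) : mulFirst k H ((h ⊗ₜ g) ⊗ₜ l) = (h * g) ⊗ₜ l := rfl

@[simp] lemma mulLast_tmul (h g l : H) : mulLast k H ((h ⊗ₜ g) ⊗ₜ l) = h ⊗ₜ (g * l) := rfl

lemma twisted' (t : R) :
    toConv (actOn D.act (D.act.flip t)) * D.sigma.val =
      D.sigma.val * toConv (D.act.flip t ∘ₗ LinearMap.mul' k H) := by
  rw [D.twisted, mul_assoc, Units.inv_mul, mul_one]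

lemma cocycle' :
    toConv (actOn D.act D.sigma.val.ofConv ∘ₗ
        (Coalgebra.TensorProduct.assoc k k H H H).toCoalgHom.toLinearMap) *
      toConv (D.sigma.val.ofConv ∘ₗ (mulLast k H).toLinearMap) =
    toConv (D.sigma.val.ofConv ∘ₗ (dropLast k H (H ⊗[k] H)).toLinearMap) *
      toConv (D.sigma.val.ofConv ∘ₗ (mulFirst k H).toLinearMap) := by
  have h := congrArg (fun f : WithConv (H ⊗[k] (H ⊗[k] H) →ₗ[k] R) =>
    toConv (f.ofConv ∘ₗ (Coalgebra.TensorProduct.assoc k k H H H).toCoalgHom.toLinearMap)) D.cocycle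
  simp only [conv_comp] at h
  convert h using 2
  all_goals
    apply WithConv.ext
    ext
    rfl

/-- The map `h ⊗ g ↦ ∑ (h₁ · s) σ(h₂, g)`. -/
def coeff (s : R) : WithConv (H ⊗[k] H →ₗ[k] R) :=
  toConv (D.act.flip s ∘ₗ (dropLast k H H).toLinearMap) * D.sigma.val

lemma include_conv {C : Type*} [AddCommGroup C] [Module k C] [Coalgebra k C]
    (B B' : WithConv (C →ₗ[k] R)) :
    toConv ((Algebra.TensorProduct.includeLeft (R := k) (S := k) (A := R) (B := H)).toLinearMap ∘ₗ
        (B * B').ofConv) =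
      toConv (Algebra.TensorProduct.includeLeft.toLinearMap ∘ₗ B.ofConv) *
        toConv (Algebra.TensorProduct.includeLeft.toLinearMap ∘ₗ B'.ofConv) := by
  apply WithConv.ext
  exact LinearMap.algHom_comp_convMul_distrib _ B B'

lemma coreConv_eq' (s : R) : D.coreConv s =
    toConv (Algebra.TensorProduct.includeLeft.toLinearMap ∘ₗ (D.coeff s).ofConv) *
      toConv (Algebra.TensorProduct.includeRight.toLinearMap ∘ₗ LinearMap.mul' k H) := by
  rw [coeff, include_conv]
  rfl

lemma core_apply' (s : R) {ι : Type*} {x : H ⊗[k] H} (P : Coalgebra.Repr k x ι) :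
    D.core s x =
      ∑ i ∈ P.index, (D.coeff s (P.left i)) ⊗ₜ[k] (LinearMap.mul' k H (P.right i)) := by
  change D.coreConv s x = _
  rw [coreConv_eq', P.convMul_apply]
  simp

lemma mulMap_left (s t : R) (h g l : H) :
    D.mulMap (D.core s (h ⊗ₜ g)) (t ⊗ₜ l) =
      (toConv ((Algebra.TensorProduct.includeLeft.toLinearMap ∘ₗ (D.coeff s).ofConv) ∘ₗ
          (dropLast k H (H ⊗[k] H)).toLinearMap) *
        toConv ((D.coreConv t).ofConv ∘ₗ (mulFirst k H).toLinearMap) :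
        WithConv ((H ⊗[k] H) ⊗[k] H →ₗ[k] R ⊗[k] H)) ((h ⊗ₜ g) ⊗ₜ l) := by
  let P := Coalgebra.Repr.arbitrary k (h ⊗ₜ[k] g)
  rw [conv_dropLast_apply _ _ P, D.core_apply' s P]
  simp only [map_sum, LinearMap.sum_apply, mulMap_tmul]
  rfl

lemma mulMap_right (s t : R) (h g l : H) :
    D.mulMap (1 ⊗ₜ h) (D.mulMap (s ⊗ₜ g) (t ⊗ₜ l)) =
      (toConv ((Algebra.TensorProduct.includeLeft.toLinearMap ∘ₗ
            actOn D.act (LinearMap.mulLeft k s ∘ₗ (D.coeff t).ofConv)) ∘ₗ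
          (Coalgebra.TensorProduct.assoc k k H H H).toCoalgHom.toLinearMap) *
        toConv (D.sigmaMul.ofConv ∘ₗ (mulLast k H).toLinearMap) :
        WithConv ((H ⊗[k] H) ⊗[k] H →ₗ[k] R ⊗[k] H)) ((h ⊗ₜ g) ⊗ₜ l) := by
  let P := Coalgebra.Repr.arbitrary k h
  let Q := Coalgebra.Repr.arbitrary k (g ⊗ₜ[k] l)
  have key := conv_comp
    (toConv (Algebra.TensorProduct.includeLeft.toLinearMap ∘ₗ
            actOn D.act (LinearMap.mulLeft k s ∘ₗ (D.coeff t).ofConv)))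
    (toConv (D.sigmaMul.ofConv ∘ₗ (Coalgebra.TensorProduct.map (CoalgHom.id k H)
      (Bialgebra.mulCoalgHom k H)).toLinearMap))
    (Coalgebra.TensorProduct.assoc k k H H H).toCoalgHom
  refine Eq.trans ?_ (congrArg (fun f : WithConv ((H ⊗[k] H) ⊗[k] H →ₗ[k] R ⊗[k] H) =>
    f ((h ⊗ₜ g) ⊗ₜ l)) key)
  change _ = (toConv (Algebra.TensorProduct.includeLeft.toLinearMap ∘ₗ
            actOn D.act (LinearMap.mulLeft k s ∘ₗ (D.coeff t).ofConv)) *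
    (toConv (D.sigmaMul.ofConv ∘ₗ (Coalgebra.TensorProduct.map (CoalgHom.id k H)
      (Bialgebra.mulCoalgHom k H)).toLinearMap)) : WithConv (H ⊗[k] (H ⊗[k] H) →ₗ[k] R ⊗[k] H))
    (h ⊗ₜ[k] (g ⊗ₜ[k] l))
  rw [(P.tmul Q).convMul_apply, mulMap_tmul, D.core_apply' t Q]
  simp only [Finset.mul_sum, map_sum, Algebra.TensorProduct.tmul_mul_tmul, one_mul, mulMap_tmul]
  simp only [← Algebra.TensorProduct.one_def, one_mul, D.core_apply _ P]
  simp only [Coalgebra.Repr.tmul, Finset.sum_product]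
  rw [Finset.sum_comm]
  rfl

lemma monoid_aux {M : Type*} [Monoid M] {a b c d e f g : M} (h : e * b = b * c)
    (h' : f * g = b * d) : a * b * (c * d) = a * (e * f) * g := by
  rw [mul_assoc a, ← mul_assoc b, ← h, mul_assoc a, mul_assoc e, mul_assoc e, h']

lemma mulMap_assoc_aux (s t : R) (h g l : H) :
    D.mulMap (D.core s (h ⊗ₜ g)) (t ⊗ₜ l) =
      D.mulMap (1 ⊗ₜ h) (D.mulMap (s ⊗ₜ g) (t ⊗ₜ l)) := by
  rw [mulMap_left, mulMap_right]
  congr 1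
  let α := (Coalgebra.TensorProduct.assoc k k H H H).toCoalgHom
  let p := dropLast k H (H ⊗[k] H)
  let S' : WithConv (H ⊗[k] H →ₗ[k] R) :=
    toConv (LinearMap.toSpanSingleton k R s ∘ₗ Coalgebra.counit)
  let E : R → WithConv (H ⊗[k] H →ₗ[k] R) := fun t =>
    toConv (D.act.flip t ∘ₗ (dropLast k H H).toLinearMap)
  have hS : LinearMap.mulLeft k s ∘ₗ (D.coeff t).ofConv = (S' * D.coeff t).ofConv := by
    ext x y
    let P := Coalgebra.Repr.arbitrary k (x ⊗ₜ[k] y)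
    change s * D.coeff t (x ⊗ₜ y) = (S' * D.coeff t) (x ⊗ₜ y)
    rw [P.convMul_apply]
    conv_lhs => rw [← Coalgebra.sum_counit_smul P]
    simp only [map_sum, Finset.mul_sum]
    refine Finset.sum_congr rfl fun i _ => ?_
    simp [S']
  have hXY : toConv ((D.coeff s).ofConv ∘ₗ p.toLinearMap) *
        toConv ((D.coeff t).ofConv ∘ₗ (mulFirst k H).toLinearMap) =
      toConv (actOn D.act (LinearMap.mulLeft k s ∘ₗ (D.coeff t).ofConv) ∘ₗ α.toLinearMap) *
        toConv (D.sigma.val.ofConv ∘ₗ (mulLast k H).toLinearMap) := by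
    have h1 : toConv (actOn D.act (LinearMap.mulLeft k s ∘ₗ (D.coeff t).ofConv) ∘ₗ α.toLinearMap)
        = toConv (actOn D.act S'.ofConv ∘ₗ α.toLinearMap) *
          (toConv (actOn D.act (E t).ofConv ∘ₗ α.toLinearMap) *
            toConv (actOn D.act D.sigma.val.ofConv ∘ₗ α.toLinearMap)) := by
      rw [← conv_comp (toConv _) (toConv _), ← D.actOn_conv, ← conv_comp (toConv _) (toConv _),
        ← D.actOn_conv, hS]
      rfl
    have h2 : toConv (actOn D.act S'.ofConv ∘ₗ α.toLinearMap) =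
        toConv ((E s).ofConv ∘ₗ p.toLinearMap) := by
      apply WithConv.ext
      ext x y z
      change D.act x (Coalgebra.counit (R := k) (y ⊗ₜ[k] z) • s) =
        D.act (Coalgebra.counit (R := k) y • Coalgebra.counit (R := k) z • x) s
      simp only [map_smul, LinearMap.smul_apply]
      simp only [TensorProduct.counit_tmul, smul_eq_mul, mul_smul]
      rw [smul_comm]
    have h3 : toConv (actOn D.act (E t).ofConv ∘ₗ α.toLinearMap) =
        toConv (actOn D.act (D.act.flip t) ∘ₗ p.toLinearMap) := by
      apply WithConv.ext
      ext x y z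
      change D.act x (D.act (Coalgebra.counit (R := k) z • y) t) =
        actOn D.act (D.act.flip t) (Coalgebra.counit (R := k) z • (x ⊗ₜ[k] y))
      simp
    have h4 : toConv ((E t).ofConv ∘ₗ (mulFirst k H).toLinearMap) =
        toConv ((D.act.flip t ∘ₗ LinearMap.mul' k H) ∘ₗ p.toLinearMap) := by
      apply WithConv.ext
      ext x y z
      change D.act (Coalgebra.counit (R := k) z • (x * y)) t =
        D.act (LinearMap.mul' k H (Coalgebra.counit (R := k) z • (x ⊗ₜ[k] y))) t
      simp
    have h5 : ∀ s, D.coeff s = E s * D.sigma.val := fun _ => rfl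
    have tw := congrArg (fun f : WithConv (H ⊗[k] H →ₗ[k] R) =>
      toConv (f.ofConv ∘ₗ p.toLinearMap)) (D.twisted' t)
    simp only [conv_comp] at tw
    rw [h1, h2, h3, h5, h5, conv_comp, conv_comp, h4]
    exact monoid_aux tw D.cocycle'
  have h6 := congrArg (fun f : WithConv ((H ⊗[k] H) ⊗[k] H →ₗ[k] R) =>
      toConv ((Algebra.TensorProduct.includeLeft (R := k) (S := k) (A := R)
        (B := H)).toLinearMap ∘ₗ f.ofConv)) hXY
  simp only [include_conv] at h6
  rw [coreConv_eq', sigmaMul, conv_comp, conv_comp, ← mul_assoc, ← mul_assoc]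
  simp only [LinearMap.comp_assoc]
  have h7 : toConv (Algebra.TensorProduct.includeRight.toLinearMap ∘ₗ LinearMap.mul' k H ∘ₗ
        (mulFirst k H).toLinearMap) =
      toConv ((Algebra.TensorProduct.includeRight (R := k) (A := R) (B := H)).toLinearMap ∘ₗ
        LinearMap.mul' k H ∘ₗ (mulLast k H).toLinearMap) := by
    apply WithConv.ext
    ext x y z
    change (1 : R) ⊗ₜ[k] (x * y * z) = 1 ⊗ₜ[k] (x * (y * z))
    rw [mul_assoc]
  exact congrArg WithConv.ofConv (congrArg₂ (· * ·) h6 h7)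

lemma mulMap_mul_left (r : R) (x y : R ⊗[k] H) :
    D.mulMap ((r ⊗ₜ[k] (1 : H)) * x) y = (r ⊗ₜ[k] (1 : H)) * D.mulMap x y := by
  induction x with
  | zero => simp
  | add x₁ x₂ h₁ h₂ => simp only [mul_add, map_add, LinearMap.add_apply, h₁, h₂]
  | tmul s h =>
    induction y with
    | zero => simp
    | add y₁ y₂ h₁ h₂ => simp only [mul_add, map_add, h₁, h₂]
    | tmul t g => simp [← mul_assoc]

lemma mulMap_assoc (x y z : R ⊗[k] H) :
    D.mulMap (D.mulMap x y) z = D.mulMap x (D.mulMap y z) := by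
  induction x with
  | zero => simp
  | add x₁ x₂ h₁ h₂ => simp only [map_add, LinearMap.add_apply, h₁, h₂]
  | tmul r h =>
    induction y with
    | zero => simp
    | add y₁ y₂ h₁ h₂ => simp only [map_add, LinearMap.add_apply, h₁, h₂]
    | tmul s g =>
      induction z with
      | zero => simp
      | add z₁ z₂ h₁ h₂ => simp only [map_add, h₁, h₂]
      | tmul t l =>
        rw [mulMap_tmul, mulMap_mul_left, mulMap_assoc_aux, ← mulMap_mul_left]
        simp

/-- `Δ(1) = 1 ⊗ 1`. -/
def reprOne (k : Type u) (H : Type v) [Field k] [Ring H] [HopfAlgebra k H] :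
    Coalgebra.Repr k (1 : H) Unit where
  index := {()}
  left _ := 1
  right _ := 1
  eq := by simp [Algebra.TensorProduct.one_def]

lemma one_mulMap (x : R ⊗[k] H) : D.mulMap (1 ⊗ₜ 1) x = x := by
  induction x with
  | zero => simp
  | add x₁ x₂ h₁ h₂ => simp only [map_add, h₁, h₂]
  | tmul s g =>
    have e1 : D.sigmaMul (1 ⊗ₜ g) = 1 ⊗ₜ g := by
      let Q := Coalgebra.Repr.arbitrary k g
      rw [sigmaMul, ((reprOne k H).tmul Q).convMul_apply]
      conv_rhs => rw [← Coalgebra.sum_counit_smul Q]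
      simp [reprOne, D.sigma_one_left, tmul_sum, Algebra.algebraMap_eq_smul_one]
    rw [mulMap_tmul, D.core_apply s (reprOne k H)]
    simp [reprOne, e1, D.one_act]

lemma mulMap_one (x : R ⊗[k] H) : D.mulMap x (1 ⊗ₜ 1) = x := by
  induction x with
  | zero => simp
  | add x₁ x₂ h₁ h₂ => simp only [map_add, LinearMap.add_apply, h₁, h₂]
  | tmul r h =>
    let P := Coalgebra.Repr.arbitrary k h
    have e1 : D.sigmaMul (h ⊗ₜ 1) = 1 ⊗ₜ h := by
      rw [sigmaMul, (P.tmul (reprOne k H)).convMul_apply]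
      conv_rhs => rw [← Coalgebra.sum_counit_smul P]
      simp [reprOne, D.sigma_one_right, tmul_sum, Algebra.algebraMap_eq_smul_one]
    have e2 : D.core 1 (h ⊗ₜ 1) = 1 ⊗ₜ h := by
      rw [D.core_apply 1 P, ← e1]
      conv_rhs => rw [← Coalgebra.sum_counit_smul P]
      simp [D.act_one, Algebra.algebraMap_eq_smul_one, sum_tmul, ← smul_tmul',
        ← Algebra.TensorProduct.one_def]
    rw [mulMap_tmul, e2]
    simp

/-- The crossed product `R #_σ H`: the vector space `R ⊗ H`, with `r # h = r ⊗ h`, with the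
multiplication `(r # h)(s # g) = ∑ r (h₁ · s) σ(h₂, g₁) # h₃g₂`. -/
def CrossedProduct (_D : CrossedSystem k H R) : Type (max w v) := R ⊗[k] H

instance : AddCommGroup D.CrossedProduct := inferInstanceAs (AddCommGroup (R ⊗[k] H))

instance : Module k D.CrossedProduct := inferInstanceAs (Module k (R ⊗[k] H))

instance : Ring D.CrossedProduct where
  __ := (inferInstance : AddCommGroup D.CrossedProduct)
  mul x y := D.mulMap x y
  one := ((1 : R) ⊗ₜ[k] (1 : H) : R ⊗[k] H)
  left_distrib x y z := map_add (D.mulMap x) y z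
  right_distrib x y z := LinearMap.map_add₂ D.mulMap x y z
  zero_mul x := LinearMap.map_zero₂ D.mulMap x
  mul_zero x := map_zero (D.mulMap x)
  mul_assoc := D.mulMap_assoc
  one_mul := D.one_mulMap
  mul_one := D.mulMap_one

instance : Algebra k D.CrossedProduct :=
  Algebra.ofModule (fun c x y => LinearMap.map_smul₂ D.mulMap c x y)
    (fun c x y => map_smul (D.mulMap x) c y)

lemma mul_def (x y : D.CrossedProduct) : x * y = D.mulMap x y := rfl

lemma one_def : (1 : D.CrossedProduct) = ((1 : R) ⊗ₜ[k] (1 : H) : R ⊗[k] H) := rfl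

/-! ### Radicals -/

/-- `(I : H) = {x ∈ R | h · x ∈ I for all h ∈ H}`. -/
def colon (I : Submodule k R) : Submodule k R :=
  ⨅ h : H, I.comap (D.act h)

/-- An `R`-`H`-module structure on the `R`-module `M`, for the twisted `H`-module algebra `(R, σ)`:
a linear map `H ⊗ M → M` with `1 m = m`, `h (a m) = ∑ (h₁ · a) (h₂ m)` and
`h (g m) = ∑ σ(h₁, g₁) ((h₂g₂) m)`. For trivial `σ` the last condition says that `M` is
an `H`-module. -/
structure TwistedModule (M : Type x) [AddCommGroup M] [Module k M] [Module R M]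
    [IsScalarTower k R M] where
  /-- the map `(h, m) ↦ h m` -/
  hact : H →ₗ[k] M →ₗ[k] M
  one_hact : ∀ m : M, hact 1 m = m
  hact_smul : ∀ (h : H) (a : R) (m : M),
    hact h (a • m) =
      ∑ i ∈ (Coalgebra.Repr.arbitrary k h).index,
        D.act ((Coalgebra.Repr.arbitrary k h).left i) a •
          hact ((Coalgebra.Repr.arbitrary k h).right i) m
  hact_hact : ∀ (h g : H) (m : M),
    hact h (hact g m) =
      ∑ i ∈ (Coalgebra.Repr.arbitrary k h).index, ∑ j ∈ (Coalgebra.Repr.arbitrary k g).index,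
        D.sigma.val.ofConv
            ((Coalgebra.Repr.arbitrary k h).left i ⊗ₜ (Coalgebra.Repr.arbitrary k g).left j) •
          hact ((Coalgebra.Repr.arbitrary k h).right i * (Coalgebra.Repr.arbitrary k g).right j) m

/-- `M` is `R`-`H`-irreducible: `R M ≠ 0` and `M` has no nontrivial `R`-`H`-submodules. -/
def TwistedModule.IsIrreducible {D : CrossedSystem k H R} {M : Type x} [AddCommGroup M]
    [Module k M] [Module R M] [IsScalarTower k R M] (T : D.TwistedModule M) : Prop :=
  (∃ (a : R) (m : M), a • m ≠ 0) ∧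
    ∀ N : Submodule R M, (∀ (h : H), ∀ n ∈ N, T.hact h n ∈ N) → N = ⊥ ∨ N = ⊤

/-- The `H`-Jacobson radical `r_{Hj}(R)`: the intersection of the annihilators in `R` of all
irreducible `R`-`H`-modules. Such modules are cyclic quotients of `R ⊗ H`, so
those in the universe of `R ⊗ H` suffice. -/
def hJacobson : Submodule k R where
  carrier := {a : R | ∀ (M : Type (max w v)) [AddCommGroup M] [Module k M] [Module R M]
    [IsScalarTower k R M] (T : D.TwistedModule M), T.IsIrreducible → ∀ m : M, a • m = 0}
  zero_mem' := fun M _ _ _ _ _ _ m => zero_smul R m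
  add_mem' := fun {a b} ha hb M _ _ _ _ T hT m => by
    rw [add_smul, ha M T hT m, hb M T hT m, add_zero]
  smul_mem' := fun c a ha M _ _ _ _ T hT m => by
    rw [smul_assoc, ha M T hT m, smul_zero]

end CrossedSystem

/-- The Jacobson radical `r_j(A)` of a unital `k`-algebra `A`, as a `k`-subspace. -/
def jacobsonRadical (k : Type u) (A : Type v) [Field k] [Ring A] [Algebra k A] : Submodule k A :=
  (Ring.jacobson A).restrictScalars k

/-- For a subspace `I ⊆ A`, the subspace `I ⊗ V` of `A ⊗ V`. -/
def subspaceTensor {k : Type u} {A : Type v} [Field k] [AddCommGroup A] [Module k A]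
    (I : Submodule k A) (V : Type w) [AddCommGroup V] [Module k V] : Submodule k (A ⊗[k] V) :=
  LinearMap.range (I.subtype.rTensor V)

/-- For a subspace `I ⊆ R`, the subspace `I #_σ H` of `R #_σ H`. -/
def CrossedSystem.subspaceCrossed {k : Type u} {H : Type v} {R : Type w} [Field k] [Ring H]
    [HopfAlgebra k H] [Ring R] [Algebra k R] (D : CrossedSystem k H R) (I : Submodule k R) :
    Submodule k D.CrossedProduct :=
  (subspaceTensor I H : Submodule k (R ⊗[k] H))

end

/-! Write `A` for the crossed product `R #_σ H` and `J` for the Jacobson radical. Irreducible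
`R`-`H`-modules are the same as simple `A`-modules, so `r_{Hj}(R) = R ∩ J(A)` (`mem_hJacobson`). The
theorem reduces to two inclusions, `J(R) ⊆ R ∩ J(A)` and `J(A) ⊆ (R ∩ J(A)) # H`
(`radicals_eq_of_le`). The rest is formal: `R ∩ J(A) ⊆ J(R)` because an integral `τ` on `H` gives a
right `R`-linear retraction `A → R`, and `R ∩ J(A)` is stable under `H` because `(1 # h)(r # 1) = ∑
(h₁ · r) # h₂` stays in `J(A)`.

Semisimplicity of `H` gives integrals of augmentation `1` in `H`, hence a separability idempotent `∑
t₁ ⊗ S(t₂)`, hence finite dimension. Cosemisimplicity then gives `τ` with `τ(1) = 1`, and `τ(h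
S(g))` is a separability idempotent of `H*`.

The engine for both cases is `TensorModule.isSemisimpleModule_range`. Let `S` be commutative,
separable and finite dimensional, and let `ρ : B → B ⊗ S` be an algebra map with `ρ(B)(1 ⊗ S) = B ⊗
S`. If `V` is semisimple over `B`, then `V ⊗ S` is semisimple over `B ⊗ S` by averaging with the
idempotent, and then over `ρ(B)`, because `B ⊗ S` is generated over `ρ(B)` by finitely many central
elements.

If `H` is commutative, take `B = A`, `S = H` and `ρ` the coaction. It follows that `ρ(J(A)) ⊆ J(A) ⊗
H`, and the convolution inverse of `h ↦ 1 # h` turns this into `J(A) = (R ∩ J(A)) # H`. Applying `τ`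
shows moreover that simple `A`-modules are semisimple over `R`, so `J(R)` kills them.

If `H` is cocommutative, take `B = R`, `S = H*` and for `ρ` the weak action `R → Hom(H, R) = R ⊗
H*`. Then the coinduced module `Hom_R(A, Q)`, a quotient of `Q ⊗ H*`, is semisimple over `R` for
every semisimple `Q`, and by Maschke's theorem for crossed products it is semisimple over `A`. A
simple `A`-module `V` embeds in `Hom_R(A, V/N)` for a maximal `R`-submodule `N`, so `J(R)` kills
`V`. Conversely `J(A)` kills `Hom_R(A, R/m)` for every maximal left ideal `m`, so all coefficients
in `R` of an element of `J(A)` lie in `J(R)`. -/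

noncomputable section

/-! ### Integrals, Maschke's theorem and centralizing extensions -/

/-- A semisimple augmented algebra has a left integral of augmentation `1`. -/
theorem exists_integral_of_isSemisimpleRing {k B : Type*} [Field k] [Ring B] [Algebra k B]
    [IsSemisimpleRing B] (ε : B →ₐ[k] k) : ∃ t : B, ε t = 1 ∧ ∀ b, b * t = ε b • t := by
  -- The integral `t` is the component of `1` in a left ideal complementary to the augmentation
  -- ideal. Then `(b - ε(b)) t` lies in both ideals, so it vanishes.
  obtain ⟨C, hC⟩ := exists_isCompl (RingHom.ker ε : Submodule B B)
  obtain ⟨a, ha, t, ht, hat⟩ := Submodule.mem_sup.1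
    (show (1 : B) ∈ (RingHom.ker ε : Submodule B B) ⊔ C by rw [hC.sup_eq_top]; trivial)
  have ha' : ε a = 0 := ha
  have hεt : ε t = 1 := by
    have := congrArg ε hat
    simpa [ha'] using this
  refine ⟨t, hεt, fun b => ?_⟩
  have h1 : (b - algebraMap k B (ε b)) * t ∈ C := C.smul_mem _ ht
  have h2 : (b - algebraMap k B (ε b)) * t ∈ (RingHom.ker ε : Submodule B B) := by
    change ε _ = 0
    simp
  have h3 := hC.disjoint.le_bot ⟨h2, h1⟩
  rw [Submodule.mem_bot, sub_mul, sub_eq_zero, ← Algebra.smul_def] at h3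
  exact h3

/-- Maschke's theorem: if operators `x i`, `y i` of `T` average every `B`-linear endomorphism of
`X` to a `T`-linear one, then semisimplicity over `B` implies semisimplicity over `T`. -/
theorem IsSemisimpleModule.of_average {B T X ι : Type*} [Ring B] [Ring T] [AddCommGroup X]
    [Module B X] [Module T X] (hBT : ∀ b : B, ∃ t : T, ∀ v : X, b • v = t • v)
    (σ : Finset ι) (x y : ι → T) (hxy : ∀ v : X, ∑ i ∈ σ, x i • y i • v = v)
    (hlin : ∀ (f : X →ₗ[B] X) (t : T) (v : X),
      ∑ i ∈ σ, x i • f (y i • t • v) = t • ∑ i ∈ σ, x i • f (y i • v))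
    [IsSemisimpleModule B X] : IsSemisimpleModule T X := by
  refine (isSemisimpleModule_iff T X).2 ⟨fun W => ?_⟩
  let W' : Submodule B X :=
    { W.toAddSubmonoid with
      smul_mem' := fun b v hv => by
        obtain ⟨t, ht⟩ := hBT b
        change b • v ∈ W
        rw [ht]
        exact W.smul_mem t hv }
  obtain ⟨C, hC⟩ := exists_isCompl W'
  let f : X →ₗ[B] X := W'.subtype ∘ₗ W'.projectionOnto C hC
  have hfW : ∀ v, f v ∈ W := fun v => (W'.projectionOnto C hC v).2
  have hf : ∀ w ∈ W, f w = w := fun w hw =>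
    congrArg Subtype.val (Submodule.projectionOnto_apply_left hC (⟨w, hw⟩ : W'))
  -- The average of the `B`-linear projection `f` is `T`-linear by `hlin`. It still fixes `W`, since
  -- each `y i` maps `W` into itself, where `f` is the identity.
  let g : X →ₗ[T] W :=
    { toFun := fun v => ⟨∑ i ∈ σ, x i • f (y i • v),
        W.sum_mem fun i _ => W.smul_mem _ (hfW _)⟩
      map_add' := fun v w => Subtype.ext <| by
        simp [smul_add, Finset.sum_add_distrib]
      map_smul' := fun t v => Subtype.ext <| hlin f t v }
  refine ⟨_, LinearMap.isCompl_of_proj (f := g) fun w => Subtype.ext ?_⟩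
  change ∑ i ∈ σ, x i • f (y i • (w : X)) = w
  rw [← hxy w]
  refine Finset.sum_congr rfl fun i _ => ?_
  rw [hxy, hf _ (W.smul_mem _ w.2)]

section Centralizing

variable {B T X ι : Type*} [Ring B] [Ring T] [Module B T] [AddCommGroup X]
  [Module B X] [Module T X] [IsScalarTower B T X] [Finite ι] {s : ι → T}

/-- A simple module over a ring generated as a `B`-module by finitely many elements
centralizing `B` is semisimple over `B`. -/
theorem IsSimpleModule.isSemisimpleModule_of_centralizing
    (hs : ∀ i (b : B), s i * b • (1 : T) = b • s i) (hspan : Submodule.span B (Set.range s) = ⊤)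
    [IsSimpleModule T X] : IsSemisimpleModule B X := by
  have := Fintype.ofFinite ι
  have hT : ∀ t : T, ∃ c : ι → B, ∑ i, c i • s i = t := fun t =>
    (Submodule.mem_span_range_iff_exists_fun B).1 (hspan ▸ Submodule.mem_top)
  have hcomm : ∀ i (b : B) (x : X), s i • b • x = b • s i • x := fun i b x => by
    rw [← one_smul T x, ← smul_assoc b (1 : T) x, smul_smul, hs, smul_assoc, one_smul]
  have := IsSimpleModule.nontrivial T X
  obtain ⟨x₀, hx₀⟩ := exists_ne (0 : X)
  have hgen : ∀ x : X, ∃ c : ι → B, ∑ i, c i • s i • x₀ = x := fun x => by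
    obtain ⟨t, rfl⟩ := IsSimpleModule.toSpanSingleton_surjective T hx₀ x
    obtain ⟨c, rfl⟩ := hT t
    exact ⟨c, by simp⟩
  have : Module.Finite B X := Module.Finite.of_fg_top <| by
    refine Submodule.fg_def.2 ⟨Set.range fun i => s i • x₀, Set.finite_range _, ?_⟩
    refine eq_top_iff.2 fun x _ => ?_
    exact (Submodule.mem_span_range_iff_exists_fun B).2 (hgen x)
  obtain ⟨K, hK, -⟩ := (eq_top_or_exists_le_coatom (⊥ : Submodule B X)).resolve_left bot_ne_top
  have : IsSimpleModule B (X ⧸ K) := isSimpleModule_iff_isCoatom.2 hK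
  -- `K` is a maximal `B`-submodule, available because the `s i • x₀` generate `X` over `B`. The map
  -- `φ` is `B`-linear precisely because the `s i` centralize `B`, and its target is a finite power
  -- of a simple module.
  let φ : X →ₗ[B] (ι → X ⧸ K) := LinearMap.pi fun i =>
    { toFun := fun x => K.mkQ (s i • x)
      map_add' := fun x y => by simp
      map_smul' := fun b x => by rw [hcomm, map_smul]; rfl }
  have hφ : ∀ x, φ x = 0 ↔ ∀ i, s i • x ∈ K := fun x => by
    simp [φ, funext_iff]
  -- The kernel of `φ` is `T`-stable because each `s i * t` is a `B`-combination of the `s j`. By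
  -- simplicity it is `0`, so that `X` embeds in a semisimple module, or it is `X`; the latter would
  -- give `X ⊆ K` on writing `1` in terms of the `s i`.
  let N : Submodule T X :=
    { (LinearMap.ker φ).toAddSubmonoid with
      smul_mem' := fun t x hx => by
        have hx' := (hφ x).1 hx
        refine (hφ _).2 fun i => ?_
        obtain ⟨c, hc⟩ := hT (s i * t)
        rw [smul_smul, ← hc, Finset.sum_smul]
        exact K.sum_mem fun j _ => by
          rw [smul_assoc]
          exact K.smul_mem _ (hx' j) }
  rcases eq_bot_or_eq_top N with hN | hN
  · refine IsSemisimpleModule.of_injective φ ((injective_iff_map_eq_zero φ).2 fun x hx => ?_)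
    have : x ∈ N := hx
    rwa [hN] at this
  · refine absurd (eq_top_iff.2 fun x _ => ?_) hK.1
    obtain ⟨c, hc⟩ := hT 1
    rw [← one_smul T x, ← hc, Finset.sum_smul]
    have hx : x ∈ N := hN ▸ Submodule.mem_top
    exact K.sum_mem fun j _ => by
      rw [smul_assoc]
      exact K.smul_mem _ ((hφ x).1 hx j)

/-- A semisimple module over a ring generated as a `B`-module by finitely many elements
centralizing `B` is semisimple over `B`. -/
theorem IsSemisimpleModule.of_centralizing
    (hs : ∀ i (b : B), s i * b • (1 : T) = b • s i) (hspan : Submodule.span B (Set.range s) = ⊤)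
    [IsSemisimpleModule T X] : IsSemisimpleModule B X := by
  have htop := IsSemisimpleModule.sSup_simples_eq_top T X
  refine isSemisimpleModule_of_isSemisimpleModule_submodule'
    (p := fun Y : {Y : Submodule T X // IsSimpleModule T Y} => Y.1.restrictScalars B)
    (fun Y => ?_) ?_
  · let : Module T (Y.1.restrictScalars B) := inferInstanceAs (Module T Y.1)
    have : IsSimpleModule T (Y.1.restrictScalars B) := Y.2
    have : IsScalarTower B T (Y.1.restrictScalars B) :=
      ⟨fun b t y => Subtype.ext (smul_assoc b t (y : X))⟩
    exact IsSimpleModule.isSemisimpleModule_of_centralizing (T := T) hs hspan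
  · rw [sSup_eq_iSup'] at htop
    refine eq_top_iff.2 fun x _ => ?_
    have hx : x ∈ ⨆ Y : {Y : Submodule T X // IsSimpleModule T Y}, Y.1 := by
      have : x ∈ (⊤ : Submodule T X) := trivial
      rwa [← htop] at this
    induction hx using Submodule.iSup_induction' with
    | mem Y x hx => exact Submodule.mem_iSup_of_mem Y hx
    | zero => exact zero_mem _
    | add x y _ _ h1 h2 => exact add_mem (h1 trivial) (h2 trivial)

end Centralizing

/-! ### Modules over tensor products -/

/-- The vector space `V ⊗ S` as a module over `A ⊗ S`, for an `A`-module `V`. -/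
def TensorModule (k S V : Type*) [Field k] [Ring S] [Algebra k S] [AddCommGroup V] [Module k V] :=
  V ⊗[k] S

namespace TensorModule

variable {k A S V : Type*} [Field k] [Ring A] [Algebra k A] [Ring S] [Algebra k S]
  [AddCommGroup V] [Module k V] [Module A V] [IsScalarTower k A V]

instance : AddCommGroup (TensorModule k S V) := inferInstanceAs (AddCommGroup (V ⊗[k] S))

instance : Module k (TensorModule k S V) := inferInstanceAs (Module k (V ⊗[k] S))

/-- The element `v ⊗ s`. -/
def tmul (k : Type*) {S V : Type*} [Field k] [Ring S] [Algebra k S] [AddCommGroup V] [Module k V]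
    (v : V) (s : S) : TensorModule k S V := v ⊗ₜ[k] s

variable (k A S V) in
/-- The action of `A ⊗ S` on `V ⊗ S`. -/
def toEnd : A ⊗[k] S →ₐ[k] Module.End k (V ⊗[k] S) :=
  (Module.endTensorEndAlgHom (R := k) (S := k) (A := k) (M := V) (N := S)).comp
    (Algebra.TensorProduct.map (Algebra.lsmul k k V) (Algebra.lmul k S))

instance : Module (A ⊗[k] S) (TensorModule k S V) :=
  Module.compHom (V ⊗[k] S) (toEnd k A S V).toRingHom

theorem smul_tmul (a : A) (s s' : S) (v : V) :
    (a ⊗ₜ[k] s) • tmul k v s' = tmul k (a • v) (s * s') := rfl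

theorem tmul_add (v : V) (s s' : S) : tmul k v (s + s') = tmul k v s + tmul k v s' :=
  TensorProduct.tmul_add v s s'

theorem add_tmul (v v' : V) (s : S) : tmul k (v + v') s = tmul k v s + tmul k v' s :=
  TensorProduct.add_tmul v v' s

/-- Used to read off the coefficients of `z`: if `z` kills `v ⊗ 1`, then its components along a
basis of `S` each kill `v`. -/
theorem smul_tmul_one (z : A ⊗[k] S) (v : V) :
    z • tmul k v (1 : S) =
      LinearMap.rTensor S ((LinearMap.toSpanSingleton A V v).restrictScalars k) z := by
  induction z with
  | zero =>
    rw [zero_smul, map_zero]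
    rfl
  | add z w hz hw =>
    rw [add_smul, map_add, hz, hw]
    rfl
  | tmul a s =>
    rw [smul_tmul, mul_one]
    rfl

@[elab_as_elim]
theorem induction_on {P : TensorModule k S V → Prop} (x : TensorModule k S V) (zero : P 0)
    (tmul : ∀ v s, P (tmul k v s)) (add : ∀ x y, P x → P y → P (x + y)) : P x :=
  TensorProduct.induction_on x zero tmul add

instance : IsScalarTower k (A ⊗[k] S) (TensorModule k S V) where
  smul_assoc c z x := LinearMap.congr_fun (map_smul (toEnd k A S V) c z) x

instance : SMulCommClass k (A ⊗[k] S) (TensorModule k S V) where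
  smul_comm c z x := (map_smul (toEnd k A S V z) c x).symm

variable (k A S V) in
/-- Scalars restricted along `a ↦ a ⊗ 1`. -/
@[reducible] def leftModule : Module A (TensorModule k S V) :=
  Module.compHom _ (Algebra.TensorProduct.includeLeft (R := k) (S := k) (A := A) (B := S)).toRingHom

variable (k S V) in
/-- `V ⊗ S` is semisimple over `A` if `V` is. -/
theorem isSemisimpleModule_left [IsSemisimpleModule A V] :
    let := leftModule k A S V
    IsSemisimpleModule A (TensorModule k S V) := by
  let := leftModule k A S V
  -- As an `A`-module, `V ⊗ S` is the sum of the images `V ⊗ s` of `V`.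
  let f : S → V →ₗ[A] TensorModule k S V := fun s =>
    { toFun := fun v => tmul k v s
      map_add' := fun v w => add_tmul v w s
      map_smul' := fun a v => ((smul_tmul a 1 s v).trans (by rw [one_mul])).symm }
  refine isSemisimpleModule_of_isSemisimpleModule_submodule' (p := fun s => LinearMap.range (f s))
    (fun s => IsSemisimpleModule.range _) (eq_top_iff.2 fun x _ => ?_)
  induction x using induction_on with
  | zero => exact zero_mem _
  | tmul v s => exact Submodule.mem_iSup_of_mem s ⟨v, rfl⟩
  | add x y hx hy => exact add_mem (hx trivial) (hy trivial)

variable (k V) in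
/-- If `S` has a separability idempotent, then `V ⊗ S` is semisimple over `A ⊗ S` for every
semisimple `A`-module `V`. -/
theorem isSemisimpleModule_of_separable (e : S ⊗[k] S) (he : LinearMap.mul' k S e = 1)
    (hes : ∀ s : S, (s ⊗ₜ[k] (1 : S)) * e =
      (LinearMap.mulRight k s).lTensor S e) [IsSemisimpleModule A V] :
    IsSemisimpleModule (A ⊗[k] S) (TensorModule k S V) := by
  let := leftModule k A S V
  have := isSemisimpleModule_left (A := A) k S V
  have smul_def (a : A) (x : TensorModule k S V) : a • x = (a ⊗ₜ[k] (1 : S)) • x := rfl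
  obtain ⟨σ, rfl⟩ := TensorProduct.exists_finset e
  have hL : ∀ (f : TensorModule k S V →ₗ[A] TensorModule k S V),
      ∃ g : TensorModule k S V →ₗ[k] TensorModule k S V, ∀ x, g x = f x := fun f =>
    ⟨{ toFun := f
       map_add' := map_add f
       map_smul' := fun c x => by
        have h : ∀ x : TensorModule k S V, c • x = algebraMap k A c • x := fun x => by
          rw [smul_def, ← Algebra.TensorProduct.algebraMap_apply, algebraMap_smul]
        change f (c • x) = c • f x
        rw [h, map_smul, ← h] }, fun _ => rfl⟩
  refine IsSemisimpleModule.of_average (B := A) (fun a => ⟨a ⊗ₜ 1, fun _ => rfl⟩) σ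
    (fun i => (1 : A) ⊗ₜ i.1) (fun i => (1 : A) ⊗ₜ i.2) (fun v => ?_) fun f t v => ?_
  · simp only [smul_smul, Algebra.TensorProduct.tmul_mul_tmul, mul_one, ← Finset.sum_smul,
      ← TensorProduct.tmul_sum]
    simp only [map_sum, LinearMap.mul'_apply] at he
    rw [he, ← Algebra.TensorProduct.one_def, one_smul]
  · induction t with
    | zero => simp
    | add t t' ht ht' => simp only [add_smul, smul_add, map_add, Finset.sum_add_distrib, ht, ht']
    | tmul a s =>
      obtain ⟨g, hg⟩ := hL f
      have key : ∀ w : TensorModule k S V,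
          ∑ i ∈ σ, ((1 : A) ⊗ₜ[k] i.1) • f (((1 : A) ⊗ₜ[k] i.2) • ((1 : A) ⊗ₜ[k] s) • w) =
          ((1 : A) ⊗ₜ[k] s) • ∑ i ∈ σ, ((1 : A) ⊗ₜ[k] i.1) • f (((1 : A) ⊗ₜ[k] i.2) • w) := by
        intro w
        -- Evaluating `Θ` on `(s ⊗ 1) e = e (1 ⊗ s)` moves `s` across the average, which is the
        -- missing `S`-linearity.
        let Θ : S ⊗[k] S →ₗ[k] TensorModule k S V := TensorProduct.lift
          (LinearMap.mk₂ k (fun p q => ((1 : A) ⊗ₜ[k] p) • g (((1 : A) ⊗ₜ[k] q) • w))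
            (fun p p' q => by simp [TensorProduct.tmul_add, add_smul])
            (fun c p q => by rw [TensorProduct.tmul_smul, smul_assoc])
            (fun p q q' => by simp [TensorProduct.tmul_add, add_smul])
            (fun c p q => by
              rw [TensorProduct.tmul_smul, smul_assoc, map_smul, smul_comm]))
        have := congrArg Θ (hes s)
        simpa [Θ, hg, Finset.mul_sum, smul_smul, Finset.smul_sum] using this.symm
      have hsp : ∀ w : TensorModule k S V, (a ⊗ₜ[k] s) • w = a • ((1 : A) ⊗ₜ[k] s) • w :=
        fun w => by simp [smul_def, smul_smul]
      have hcm : ∀ (q : S) (w : TensorModule k S V),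
          ((1 : A) ⊗ₜ[k] q) • a • w = a • ((1 : A) ⊗ₜ[k] q) • w :=
        fun q w => by simp [smul_def, smul_smul]
      simp only [hsp, hcm, map_smul, ← Finset.smul_sum, key]

/-- Let `S` be a finite dimensional commutative separable algebra and `ρ : A → A ⊗ S` an algebra
homomorphism whose image generates `A ⊗ S` over `S`. Then for every semisimple `A`-module `V` the
module `V ⊗ S` is semisimple over `ρ(A)`. -/
theorem isSemisimpleModule_range [FiniteDimensional k S] (hS : ∀ a b : S, a * b = b * a)
    (e : S ⊗[k] S) (he : LinearMap.mul' k S e = 1)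
    (hes : ∀ s : S, (s ⊗ₜ[k] (1 : S)) * e = (LinearMap.mulRight k s).lTensor S e)
    (ρ : A →ₐ[k] A ⊗[k] S)
    (hρ : Subalgebra.toSubmodule ρ.range * Subalgebra.toSubmodule
      (Algebra.TensorProduct.includeRight : S →ₐ[k] A ⊗[k] S).range = ⊤)
    [IsSemisimpleModule A V] : IsSemisimpleModule ρ.range (TensorModule k S V) := by
  have := isSemisimpleModule_of_separable (A := A) k V e he hes
  let b := Module.finBasis k S
  -- Commutativity of `S` makes the `1 ⊗ b i` central in `A ⊗ S`, and `hρ` says that they span it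
  -- over `ρ(A)`.
  refine IsSemisimpleModule.of_centralizing (T := A ⊗[k] S) (s := fun i => (1 : A) ⊗ₜ[k] b i) ?_ ?_
  · rintro i ⟨_, z, rfl⟩
    change ((1 : A) ⊗ₜ[k] b i) * (ρ z * 1) = ρ z * _
    rw [mul_one]
    generalize ρ z = z
    induction z with
    | zero => simp
    | add z w hz hw => rw [mul_add, add_mul, hz, hw]
    | tmul a s => simp [hS s]
  · refine eq_top_iff.2 fun z _ => ?_
    have hz : z ∈ Subalgebra.toSubmodule ρ.range * Subalgebra.toSubmodule
      (Algebra.TensorProduct.includeRight : S →ₐ[k] A ⊗[k] S).range := hρ ▸ trivial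
    induction hz using Submodule.mul_induction_on' with
    | add z _ w _ hz hw => exact add_mem (hz trivial) (hw trivial)
    | mem_mul_mem r hr s hs =>
      obtain ⟨s, rfl⟩ := hs
      refine Submodule.smul_mem _ (⟨r, hr⟩ : ρ.range) (?_ : (1 : A) ⊗ₜ[k] s ∈ _)
      rw [← b.sum_repr s, TensorProduct.tmul_sum]
      refine sum_mem fun i _ => ?_
      rw [TensorProduct.tmul_smul, ← algebraMap_smul ρ.range]
      exact Submodule.smul_mem _ _ (Submodule.subset_span ⟨i, rfl⟩)

end TensorModule

/-! ### Jacobson radicals under coactions of separable commutative algebras -/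

/-- The Jacobson radical annihilates semisimple modules. -/
theorem smul_eq_zero_of_mem_jacobson {A V : Type*} [Ring A] [AddCommGroup V] [Module A V]
    [IsSemisimpleModule A V] {a : A} (ha : a ∈ Ring.jacobson A) (v : V) : a • v = 0 :=
  Module.mem_annihilator.1 (IsSemisimpleModule.jacobson_le_annihilator A V ha) v

/-- An element belongs to the Jacobson radical if it annihilates all quotients by maximal left
ideals. -/
theorem mem_jacobson_of_forall_smul_eq_zero {A : Type*} [Ring A] {a : A}
    (ha : ∀ m : Ideal A, m.IsMaximal → ∀ x : A ⧸ m, a • x = 0) : a ∈ Ring.jacobson A := by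
  rw [Ring.jacobson_eq_sInf_isMaximal]
  refine Submodule.mem_sInf.2 fun m hm => ?_
  have := ha m hm (Submodule.Quotient.mk 1)
  rwa [← Submodule.Quotient.mk_smul, Submodule.Quotient.mk_eq_zero, smul_eq_mul, mul_one] at this

/-- Let `S` be a finite dimensional commutative separable algebra and `ρ : A → A ⊗ S` an algebra
homomorphism whose image generates `A ⊗ S` over `S`. Then `ρ(r_j(A)) ⊆ r_j(A) ⊗ S`. -/
theorem map_jacobsonRadical_mem {k A S : Type*} [Field k] [Ring A] [Algebra k A] [Ring S]
    [Algebra k S] [FiniteDimensional k S] (hS : ∀ a b : S, a * b = b * a)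
    (e : S ⊗[k] S) (he : LinearMap.mul' k S e = 1)
    (hes : ∀ s : S, (s ⊗ₜ[k] (1 : S)) * e = (LinearMap.mulRight k s).lTensor S e)
    (ρ : A →ₐ[k] A ⊗[k] S)
    (hρ : Subalgebra.toSubmodule ρ.range * Subalgebra.toSubmodule
      (Algebra.TensorProduct.includeRight : S →ₐ[k] A ⊗[k] S).range = ⊤)
    {x : A} (hx : x ∈ jacobsonRadical k A) :
    ρ x ∈ subspaceTensor (jacobsonRadical k A) S := by
  let b := Module.finBasis k S
  obtain ⟨c, hc⟩ := TensorProduct.eq_repr_basis_right b (ρ x)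
  -- Each coordinate is tested on the generator of a simple module `A ⧸ m`: `ρ(x)` lies in the
  -- radical of `ρ(A)`, so it kills the semisimple `ρ(A)`-module `(A ⧸ m) ⊗ S`, and the `b i` are
  -- linearly independent.
  have hcJ : ∀ i, c i ∈ Ring.jacobson A := fun i => by
    rw [Ring.jacobson_eq_sInf_isMaximal]
    refine Submodule.mem_sInf.2 fun m hm => ?_
    replace hm : Ideal.IsMaximal m := hm
    have : IsSimpleModule A (A ⧸ m) := isSimpleModule_iff_isCoatom.2 (Ideal.isMaximal_def.1 hm)
    have := TensorModule.isSemisimpleModule_range (V := A ⧸ m) hS e he hes ρ hρ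
    have hx' : (⟨ρ x, x, rfl⟩ : ρ.range) ∈ Ring.jacobson ρ.range := by
      have : RingHomSurjective ρ.rangeRestrict.toRingHom := ⟨ρ.rangeRestrict_surjective⟩
      exact Ring.le_comap_jacobson ρ.rangeRestrict.toRingHom hx
    have h0 : ρ x • TensorModule.tmul k (Submodule.Quotient.mk 1 : A ⧸ m) (1 : S) = 0 :=
      smul_eq_zero_of_mem_jacobson hx' _
    rw [TensorModule.smul_tmul_one, ← hc] at h0
    let q : A →ₗ[k] A ⧸ m :=
      (LinearMap.toSpanSingleton A (A ⧸ m) (Submodule.Quotient.mk 1)).restrictScalars k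
    have h1 : (c.mapRange q (map_zero q)).sum (fun i v => v ⊗ₜ[k] b i) = 0 := by
      rw [Finsupp.sum_mapRange_index fun i => TensorProduct.zero_tmul _ (b i)]
      rw [Finsupp.sum, map_sum] at h0
      exact h0
    have h2 := DFunLike.congr_fun (TensorProduct.sum_tmul_basis_right_eq_zero b _ h1) i
    have h3 : c i • (Submodule.Quotient.mk 1 : A ⧸ m) = 0 := h2
    rwa [← Submodule.Quotient.mk_smul, Submodule.Quotient.mk_eq_zero, smul_eq_mul, mul_one] at h3
  rw [← hc]
  exact sum_mem fun i _ => ⟨(⟨c i, hcJ i⟩ : jacobsonRadical k A) ⊗ₜ b i, rfl⟩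

/-! ### Finite dimensional semisimple and cosemisimple Hopf algebras -/

section Antipode

open Coalgebra HopfAlgebra

variable {k H : Type*} [Field k] [Ring H] [HopfAlgebra k H]

/-- `Δ(S(h)) = ∑ S(h₂) ⊗ S(h₁)`. -/
theorem comul_antipode (h : H) {ι : Type*} (P : Coalgebra.Repr k h ι) :
    comul (R := k) (antipode k h) =
      ∑ i ∈ P.index, antipode k (P.right i) ⊗ₜ[k] antipode k (P.left i) := by
  let i₁ : H →ₐ[k] H ⊗[k] H := Algebra.TensorProduct.includeLeft
  let i₂ : H →ₐ[k] H ⊗[k] H := Algebra.TensorProduct.includeRight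
  have hinv : ∀ i : H →ₐ[k] H ⊗[k] H,
      toConv (i.toLinearMap ∘ₗ antipode k) * toConv i.toLinearMap = 1 := fun i => by
    have h1 := congrArg (fun f : WithConv (H →ₗ[k] H) => toConv (i.toLinearMap ∘ₗ f.ofConv))
      (LinearMap.antipode_mul_id (R := k) (C := H))
    have h2 := LinearMap.algHom_comp_convMul_distrib i (toConv (antipode k (A := H)))
      (toConv LinearMap.id)
    refine ((WithConv.ext h2).symm.trans h1).trans ?_
    ext h
    simp
  have hδ : toConv i₁.toLinearMap * toConv i₂.toLinearMap = toConv (comul (R := k) (A := H)) := by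
    ext h
    rw [(ℛ k h).convMul_apply]
    simp [i₁, i₂, (ℛ k h).eq]
  -- Since `Δ = i₁ * i₂`, the product of the inverses in reverse order is a left convolution inverse
  -- of `Δ`. The right inverse `Δ ∘ S` must agree with it.
  have hG : (toConv (i₂.toLinearMap ∘ₗ antipode k) * toConv (i₁.toLinearMap ∘ₗ antipode k)) *
      toConv (comul (R := k) (A := H)) = 1 := by
    rw [← hδ, mul_assoc, ← mul_assoc _ (toConv i₁.toLinearMap), hinv, one_mul, hinv]
  have := left_inv_eq_right_inv hG LinearMap.comul_right_inv
  have := congrArg (fun f : WithConv (H →ₗ[k] H ⊗[k] H) => f h) this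
  simp only [P.convMul_apply] at this
  refine this.symm.trans (Finset.sum_congr rfl fun i _ => ?_)
  simp [i₁, i₂]

/-- Coassociativity evaluated on a linear map out of the triple tensor product. -/
theorem Coalgebra.Repr.sum_coassoc {C M ι : Type*} [AddCommGroup C] [Module k C] [Coalgebra k C]
    [AddCommGroup M] [Module k M] {c : C} (P : Coalgebra.Repr k c ι)
    (f : C →ₗ[k] C →ₗ[k] C →ₗ[k] M) :
    ∑ i ∈ P.index, ∑ j ∈ (ℛ k (P.left i)).index,
        f ((ℛ k (P.left i)).left j) ((ℛ k (P.left i)).right j) (P.right i) =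
      ∑ i ∈ P.index, ∑ j ∈ (ℛ k (P.right i)).index,
        f (P.left i) ((ℛ k (P.right i)).left j) ((ℛ k (P.right i)).right j) := by
  have := congrArg (TensorProduct.lift ((TensorProduct.lift.equiv (.id k) C C M).toLinearMap ∘ₗ f))
    (Coalgebra.sum_tmul_tmul_eq P (fun i => ℛ k (P.left i)) (fun i => ℛ k (P.right i)))
  simp only [map_sum] at this
  exact this

theorem Coalgebra.Repr.sum_counit_right_smul {C ι : Type*} [AddCommGroup C] [Module k C]
    [Coalgebra k C] {c : C} (P : Coalgebra.Repr k c ι) :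
    ∑ i ∈ P.index, counit (R := k) (P.right i) • P.left i = c := by
  have := congrArg (_root_.TensorProduct.rid k C) (Coalgebra.sum_tmul_counit_eq P)
  simpa only [map_sum, _root_.TensorProduct.rid_tmul, one_smul] using this

/-- A left integral `t` with `ε(t) = 1` gives the separability idempotent `∑ t₁ ⊗ S(t₂)`. -/
theorem exists_separability_of_integral {t : H} (ht : counit (R := k) t = 1)
    (hl : ∀ h : H, h * t = counit (R := k) h • t) :
    ∃ e : H ⊗[k] H, LinearMap.mul' k H e = 1 ∧
      ∀ s : H, (s ⊗ₜ[k] (1 : H)) * e = (LinearMap.mulRight k s).lTensor H e := by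
  refine ⟨(antipode k).lTensor H (comul t), ?_, fun s => ?_⟩
  · rw [mul_antipode_lTensor_comul_apply, ht, map_one]
  · let Q := ℛ k t
    let P := ℛ k s
    -- The identity comes from evaluating `∑ s₁t₁ ⊗ S(s₂t₂)s₃` in two ways. Grouping `s₁, s₂` gives
    -- `Δ(s₁t) = ε(s₁)Δ(t)`; grouping `s₂, s₃` gives `S(t₂)S(s₂)s₃ = ε(s₂)S(t₂)`.
    let f : H →ₗ[k] H →ₗ[k] H →ₗ[k] H ⊗[k] H := ∑ j ∈ Q.index,
      LinearMap.mk₂ k (fun a b =>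
        (TensorProduct.mk k H H (a * Q.left j)) ∘ₗ LinearMap.mulLeft k (antipode k (b * Q.right j)))
        (fun a a' b => by ext; simp [add_mul])
        (fun c a b => by ext; simp [TensorProduct.smul_tmul'])
        (fun a b b' => by ext; simp [add_mul, TensorProduct.tmul_add])
        (fun c a b => by ext; simp)
    have hf : ∀ a b c : H, f a b c =
        ∑ j ∈ Q.index, (a * Q.left j) ⊗ₜ[k] (antipode k (b * Q.right j) * c) := fun a b c => by
      simp [f, LinearMap.sum_apply]
    have key := P.sum_coassoc f
    simp only [hf] at key
    have hL : ∀ i, ∑ j ∈ (ℛ k (P.left i)).index, ∑ j' ∈ Q.index,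
        ((ℛ k (P.left i)).left j * Q.left j') ⊗ₜ[k]
          (antipode k ((ℛ k (P.left i)).right j * Q.right j') * P.right i) =
        counit (R := k) (P.left i) • (LinearMap.mulRight k (P.right i)).lTensor H
          ((antipode k).lTensor H (comul t)) := fun i => by
      have h1 := congrArg (fun x => (LinearMap.mulRight k (P.right i)).lTensor H
        ((antipode k).lTensor H (comul (R := k) x))) (hl (P.left i))
      simp only [Bialgebra.comul_mul, map_smul] at h1
      rw [← h1, ← (ℛ k (P.left i)).eq, ← Q.eq]
      simp [Finset.sum_mul_sum]
    have hR : ∀ i, ∑ j ∈ (ℛ k (P.right i)).index, ∑ j' ∈ Q.index,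
        (P.left i * Q.left j') ⊗ₜ[k]
          (antipode k ((ℛ k (P.right i)).left j * Q.right j') * (ℛ k (P.right i)).right j) =
        counit (R := k) (P.right i) • ((P.left i ⊗ₜ[k] (1 : H)) *
          (antipode k).lTensor H (comul t)) := fun i => by
      rw [Finset.sum_comm, ← Q.eq]
      simp only [antipode_mul_antidistrib, mul_assoc, ← TensorProduct.tmul_sum]
      simp only [← Finset.mul_sum, sum_antipode_mul_eq_smul]
      simp [Finset.mul_sum, Finset.smul_sum]
    simp only [hL, hR] at key
    have h1 : ∑ i ∈ P.index, counit (R := k) (P.left i) •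
        (LinearMap.mulRight k (P.right i)).lTensor H ((antipode k).lTensor H (comul t)) =
        (LinearMap.mulRight k s).lTensor H ((antipode k).lTensor H (comul t)) := by
      conv_rhs => rw [← Coalgebra.sum_counit_smul P]
      rw [← Q.eq]
      simp [TensorProduct.tmul_sum, Finset.mul_sum, Finset.smul_sum]
      rw [Finset.sum_comm]
    have h2 : ∑ i ∈ P.index, counit (R := k) (P.right i) • ((P.left i ⊗ₜ[k] (1 : H)) *
          (antipode k).lTensor H (comul t)) =
        (s ⊗ₜ[k] (1 : H)) * (antipode k).lTensor H (comul t) := by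
      have h3 : ∑ i ∈ P.index, counit (R := k) (P.right i) • P.left i = s := by
        have := congrArg (TensorProduct.rid k H) (Coalgebra.sum_tmul_counit_eq P)
        simpa only [map_sum, TensorProduct.rid_tmul, one_smul] using this
      conv_rhs => rw [← h3]
      simp only [TensorProduct.sum_tmul, Finset.sum_mul, ← TensorProduct.smul_tmul',
        smul_mul_assoc]
    rw [← h1, ← h2, key]

end Antipode

/-- A separable algebra over a field is finite dimensional. -/
theorem finiteDimensional_of_separability {k B : Type*} [Field k] [Ring B] [Algebra k B]
    (e : B ⊗[k] B) (he : LinearMap.mul' k B e = 1)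
    (hes : ∀ s : B, (s ⊗ₜ[k] (1 : B)) * e = (LinearMap.mulRight k s).lTensor B e) :
    FiniteDimensional k B := by
  classical
  obtain ⟨σ, rfl⟩ := TensorProduct.exists_finset e
  let b := Module.Basis.ofVectorSpace k B
  -- `J` collects the finitely many basis vectors occurring in the left factors of `e`. The aim is
  -- to show that their products with the right factors of `e` span `B`.
  let J := σ.biUnion fun i => (b.repr i.1).support
  let W : Submodule k B := Submodule.span k
    (((J ×ˢ σ).image fun p => b p.1 * p.2.2 : Finset B) : Set B)
  have hW : ∀ h : B, h ∈ W := fun h => by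
    -- Contract `(h ⊗ 1) e = e (1 ⊗ h)` with the `j`-th coordinate. The right side vanishes for `j ∉
    -- J`, so in the expansion of `h = ∑ (h xᵢ) yᵢ` only the basis vectors indexed by `J` survive.
    have hcoord : ∀ j, ∑ i ∈ σ, b.coord j (h * i.1) • i.2 =
        ∑ i ∈ σ, b.coord j i.1 • (i.2 * h) := fun j => by
      have := congrArg (TensorProduct.lid k B ∘ (b.coord j).rTensor B) (hes h)
      simpa [Finset.mul_sum] using this
    let N := J ∪ σ.biUnion fun i => (b.repr (h * i.1)).support
    have hN : ∀ i ∈ σ, h * i.1 = ∑ j ∈ N, b.coord j (h * i.1) • b j := fun i hi => by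
      conv_lhs => rw [← b.linearCombination_repr (h * i.1), Finsupp.linearCombination_apply]
      refine Finsupp.sum_of_support_subset _ (fun j hj => ?_) _ (by simp)
      exact Finset.mem_union_right _ (Finset.mem_biUnion.2 ⟨i, hi, hj⟩)
    have h1 : h = ∑ j ∈ N, b j * ∑ i ∈ σ, b.coord j (h * i.1) • i.2 := by
      simp only [map_sum, LinearMap.mul'_apply] at he
      calc h = ∑ i ∈ σ, (h * i.1) * i.2 := by
            simp only [mul_assoc, ← Finset.mul_sum, he, mul_one]
        _ = ∑ i ∈ σ, (∑ j ∈ N, b.coord j (h * i.1) • b j) * i.2 :=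
            Finset.sum_congr rfl fun i hi => by rw [← hN i hi]
        _ = _ := by
            simp only [Finset.sum_mul, Finset.mul_sum, smul_mul_assoc, mul_smul_comm]
            exact Finset.sum_comm
    rw [h1]
    refine sum_mem fun j _ => ?_
    by_cases hj : j ∈ J
    · rw [Finset.mul_sum]
      refine sum_mem fun i hi => ?_
      rw [mul_smul_comm]
      refine W.smul_mem _ (Submodule.subset_span ?_)
      exact Finset.mem_coe.2 (Finset.mem_image.2 ⟨(j, i), Finset.mem_product.2 ⟨hj, hi⟩, rfl⟩)
    · rw [hcoord, Finset.sum_eq_zero, mul_zero]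
      · exact zero_mem _
      · intro i hi
        have : b.coord j i.1 = 0 := by
          by_contra h0
          exact hj (Finset.mem_biUnion.2 ⟨i, hi, Finsupp.mem_support_iff.2 h0⟩)
        rw [this, zero_smul]
  exact Module.Finite.of_fg_top (by
    rw [← eq_top_iff.2 fun h _ => hW h]
    exact Submodule.fg_span (Finset.finite_toSet _))

/-! ### Integrals on cosemisimple coalgebras -/

section Subcoalgebra

open Coalgebra

variable {k V : Type*} [Field k] [AddCommGroup V] [Module k V]

/-- Functionals on the second factor separate the elements of `V ⊗ W`. -/
theorem TensorProduct.eq_zero_of_forall_lTensor {W : Type*} [AddCommGroup W] [Module k W]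
    (z : V ⊗[k] W)
    (hz : ∀ f : W →ₗ[k] k, TensorProduct.rid k V (f.lTensor V z) = 0) : z = 0 := by
  classical
  let b := Module.Basis.ofVectorSpace k W
  obtain ⟨c, rfl⟩ := TensorProduct.eq_repr_basis_right b z
  have : c = 0 := Finsupp.ext fun i => by
    have := hz (b.coord i)
    simpa [Finsupp.sum, Finsupp.single_apply, ite_smul] using this
  simp [this]

/-- Functionals on the first factor separate the elements of `V ⊗ W`. -/
theorem TensorProduct.eq_zero_of_forall_rTensor {W : Type*} [AddCommGroup W] [Module k W]
    (z : V ⊗[k] W)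
    (hz : ∀ f : V →ₗ[k] k, TensorProduct.lid k W (f.rTensor W z) = 0) : z = 0 := by
  apply (TensorProduct.comm k V W).injective
  rw [map_zero]
  refine TensorProduct.eq_zero_of_forall_lTensor _ fun f => ?_
  rw [← hz f]
  generalize z = z
  induction z with
  | zero => simp
  | add x y hx hy => simp only [map_add, hx, hy]
  | tmul x y => simp

/-- An element of `V ⊗ V` lies in `C ⊗ C` if all its contractions with functionals lie in `C`. -/
theorem TensorProduct.mem_range_map_subtype (C : Submodule k V) (z : V ⊗[k] V)
    (h₁ : ∀ f : V →ₗ[k] k, TensorProduct.lid k V (f.rTensor V z) ∈ C)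
    (h₂ : ∀ f : V →ₗ[k] k, TensorProduct.rid k V (f.lTensor V z) ∈ C) :
    z ∈ LinearMap.range (TensorProduct.map C.subtype C.subtype) := by
  obtain ⟨p, hp⟩ := C.exists_isCompl
  -- The contractions show that `z` is fixed by a projection onto `C` applied to either factor,
  -- hence by applying it to both.
  let π : V →ₗ[k] C := C.projectionOnto p hp
  have hπ : ∀ x ∈ C, (C.subtype ∘ₗ π) x = x := fun x hx =>
    congrArg Subtype.val (Submodule.projectionOnto_apply_left hp (⟨x, hx⟩ : C))
  have e1 : (C.subtype ∘ₗ π).rTensor V z = z := by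
    rw [← sub_eq_zero]
    refine TensorProduct.eq_zero_of_forall_lTensor _ fun f => ?_
    rw [map_sub, map_sub, sub_eq_zero, ← hπ _ (h₂ f)]
    generalize z = z
    induction z with
    | zero => simp
    | add x y hx hy => simp only [map_add, hx, hy]
    | tmul x y => simp
  have e2 : (C.subtype ∘ₗ π).lTensor V z = z := by
    rw [← sub_eq_zero]
    refine TensorProduct.eq_zero_of_forall_rTensor _ fun f => ?_
    rw [map_sub, map_sub, sub_eq_zero, ← hπ _ (h₁ f)]
    generalize z = z
    induction z with
    | zero => simp
    | add x y hx hy => simp only [map_add, hx, hy]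
    | tmul x y => simp
  refine ⟨TensorProduct.map π π z, ?_⟩
  conv_rhs => rw [← e1, ← e2]
  generalize z = z
  induction z with
  | zero => simp
  | add x y hx hy => simp only [map_add, hx, hy]
  | tmul x y => simp

variable {C : Type*} [AddCommGroup C] [Module k C] [Coalgebra k C]

/-- In terms of contractions with functionals, being a subcoalgebra is a membership condition in `D`
itself, which makes stability under sums and intersections immediate. -/
theorem isSubcoalgebra_iff {D : Submodule k C} : IsSubcoalgebra k D ↔
    ∀ c ∈ D, ∀ f : C →ₗ[k] k, TensorProduct.lid k C (f.rTensor C (comul c)) ∈ D ∧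
      TensorProduct.rid k C (f.lTensor C (comul c)) ∈ D := by
  refine ⟨fun h c hc f => ?_, fun h c hc => TensorProduct.mem_range_map_subtype D _
    (fun f => (h c hc f).1) fun f => (h c hc f).2⟩
  obtain ⟨z, hz⟩ := h c hc
  rw [← hz]
  clear hz
  induction z with
  | zero => simp
  | add x y hx hy =>
    simp only [map_add]
    exact ⟨add_mem hx.1 hy.1, add_mem hx.2 hy.2⟩
  | tmul x y => exact ⟨by simpa using D.smul_mem _ y.2, by simpa using D.smul_mem _ x.2⟩

theorem IsSubcoalgebra.sup {D E : Submodule k C} (hD : IsSubcoalgebra k D)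
    (hE : IsSubcoalgebra k E) : IsSubcoalgebra k (D ⊔ E) := by
  rw [isSubcoalgebra_iff] at *
  intro c hc f
  obtain ⟨d, hd, e, he, rfl⟩ := Submodule.mem_sup.1 hc
  simp only [map_add]
  exact ⟨add_mem (Submodule.mem_sup_left (hD d hd f).1) (Submodule.mem_sup_right (hE e he f).1),
    add_mem (Submodule.mem_sup_left (hD d hd f).2) (Submodule.mem_sup_right (hE e he f).2)⟩

theorem IsSubcoalgebra.inf {D E : Submodule k C} (hD : IsSubcoalgebra k D)
    (hE : IsSubcoalgebra k E) : IsSubcoalgebra k (D ⊓ E) := by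
  rw [isSubcoalgebra_iff] at *
  exact fun c hc f => ⟨⟨(hD c hc.1 f).1, (hE c hc.2 f).1⟩, ⟨(hD c hc.1 f).2, (hE c hc.2 f).2⟩⟩

/-- In a finite dimensional cosemisimple coalgebra a group-like element spans a direct summand. -/
theorem IsCosemisimple.exists_isCompl_span [FiniteDimensional k C] (h : IsCosemisimple k C)
    {g : C} (hg : comul (R := k) g = g ⊗ₜ g) (hg0 : g ≠ 0) :
    ∃ D : Submodule k C, IsSubcoalgebra k D ∧ IsCompl D (Submodule.span k {g}) := by
  have hG : IsSubcoalgebra k (Submodule.span k {g}) := fun c hc => by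
    obtain ⟨a, rfl⟩ := Submodule.mem_span_singleton.1 hc
    let g' : Submodule.span k {g} := ⟨g, Submodule.mem_span_singleton_self g⟩
    exact ⟨a • (g' ⊗ₜ g'), by simp [hg, g']⟩
  have hdisj : ∀ {D : Submodule k C}, g ∉ D → Disjoint D (Submodule.span k {g}) := fun {D} hD =>
    ((Submodule.disjoint_span_singleton' hg0).2 hD)
  -- `D` is a maximal subcoalgebra avoiding `g`. A simple `E` meeting `D + kg` trivially would, by
  -- maximality, give `g = d + e` with `d ∈ D` and `e ∈ E`; but then `e = g - d` lies in that
  -- intersection, so `e = 0` and `g ∈ D`.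
  obtain ⟨D, ⟨hD, hgD⟩, hmax⟩ := WellFounded.has_min
    (wellFounded_gt (α := Submodule k C)) {D | IsSubcoalgebra k D ∧ g ∉ D}
    ⟨⊥, fun c hc => ⟨0, by simp [(Submodule.mem_bot k).1 hc]⟩, by simpa using hg0⟩
  refine ⟨D, hD, hdisj hgD, codisjoint_iff.2 (eq_top_iff.2 ?_)⟩
  rw [← h, sSup_le_iff]
  rintro E ⟨hE, hE0, hEs⟩
  rcases hEs (E ⊓ (D ⊔ Submodule.span k {g})) inf_le_left (hE.inf (hD.sup hG)) with h0 | h0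
  · exfalso
    have hgDE : g ∈ D ⊔ E := by
      by_contra hn
      refine hmax (D ⊔ E) ⟨hD.sup hE, hn⟩ (lt_of_le_of_ne le_sup_left fun heq => ?_)
      have hED : E ≤ D := heq ▸ le_sup_right
      exact hE0 (by rw [← h0, inf_eq_left.2 (hED.trans le_sup_left)])
    obtain ⟨d, hd, e, he, hde⟩ := Submodule.mem_sup.1 hgDE
    have : e ∈ E ⊓ (D ⊔ Submodule.span k {g}) := by
      refine ⟨he, ?_⟩
      rw [eq_sub_of_add_eq' hde]
      exact sub_mem (Submodule.mem_sup_right (Submodule.mem_span_singleton_self g))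
        (Submodule.mem_sup_left hd)
    rw [h0, Submodule.mem_bot] at this
    rw [this, add_zero] at hde
    exact hgD (hde ▸ hd)
  · exact inf_eq_left.1 h0

end Subcoalgebra

section Integral

open Coalgebra HopfAlgebra

variable {k H : Type*} [Field k] [Ring H] [HopfAlgebra k H]

/-- A finite dimensional cosemisimple Hopf algebra has an integral `τ` in its dual with
`τ(1) = 1`. -/
theorem IsCosemisimple.exists_integral [FiniteDimensional k H] (h : IsCosemisimple k H) :
    ∃ τ : H →ₗ[k] k, τ 1 = 1 ∧
      ∀ x : H, TensorProduct.rid k H (τ.lTensor H (comul x)) = algebraMap k H (τ x) := by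
  have h1 : (1 : H) ≠ 0 := fun h0 => by
    have := congrArg (counit (R := k)) h0
    simp at this
  obtain ⟨D, hD, hc⟩ := h.exists_isCompl_span (g := (1 : H))
    (by simp [Algebra.TensorProduct.one_def]) h1
  -- `τ` is the coordinate along `1` in `H = D ⊕ k1`. Since `Δ(D) ⊆ D ⊗ D`, it kills the second
  -- factor of `Δ(d)` for `d ∈ D`.
  let τ : H →ₗ[k] k :=
    counit ∘ₗ (Submodule.span k {(1 : H)}).subtype ∘ₗ Submodule.projectionOnto _ D hc.symm
  have hτD : ∀ d ∈ D, τ d = 0 := fun d hd => by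
    have := (Submodule.projectionOnto_apply_eq_zero_iff hc.symm).2 hd
    simp [τ, this]
  have hτ1 : τ 1 = 1 := by
    have := congrArg Subtype.val (Submodule.projectionOnto_apply_left hc.symm
      (⟨1, Submodule.mem_span_singleton_self 1⟩ : Submodule.span k {(1 : H)}))
    change counit (R := k) _ = (1 : k)
    exact (congrArg _ this).trans (by simp)
  refine ⟨τ, hτ1, fun x => ?_⟩
  obtain ⟨d, hd, y, hy, rfl⟩ := Submodule.mem_sup.1
    (show x ∈ D ⊔ Submodule.span k {(1 : H)} by rw [hc.sup_eq_top]; trivial)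
  obtain ⟨a, rfl⟩ := Submodule.mem_span_singleton.1 hy
  have hd0 : τ.lTensor H (comul d) = 0 := by
    obtain ⟨z, hz⟩ := hD d hd
    rw [← hz]
    clear hz
    induction z with
    | zero => simp
    | add x y hx hy => simp only [map_add, hx, hy, add_zero]
    | tmul x y => simp [hτD _ y.2]
  simp [hd0, hτD d hd, hτ1, Algebra.TensorProduct.one_def, Algebra.algebraMap_eq_smul_one]

/-! ### Separability of the dual algebra -/

/-- The value of an element of `C* ⊗ C*` at a pair of elements of `C`. -/
def convEval {C : Type*} [AddCommGroup C] [Module k C] (x y : C) :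
    WithConv (C →ₗ[k] k) ⊗[k] WithConv (C →ₗ[k] k) →ₗ[k] k :=
  TensorProduct.lift (LinearMap.mk₂ k
    (fun φ ψ : WithConv (C →ₗ[k] k) => φ x * ψ y) (fun _ _ _ => add_mul _ _ _)
    (fun _ _ _ => mul_assoc _ _ _) (fun _ _ _ => mul_add _ _ _)
    (fun _ _ _ => mul_left_comm _ _ _))

@[simp] theorem convEval_tmul {C : Type*} [AddCommGroup C] [Module k C] (x y : C)
    (φ ψ : WithConv (C →ₗ[k] k)) : convEval x y (φ ⊗ₜ ψ) = φ x * ψ y := rfl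

/-- Elements of `C* ⊗ C*` are determined by their values on pairs of elements of `C`. -/
theorem convEval_ext {C : Type*} [AddCommGroup C] [Module k C] [FiniteDimensional k C]
    {z w : WithConv (C →ₗ[k] k) ⊗[k] WithConv (C →ₗ[k] k)}
    (hzw : ∀ x y : C, convEval x y z = convEval x y w) : z = w := by
  rw [← sub_eq_zero]
  refine TensorProduct.eq_zero_of_forall_lTensor _ fun f => ?_
  -- In finite dimension every functional on `C*` is evaluation at some `y`.
  obtain ⟨y, hy⟩ := (Module.evalEquiv k C).surjective
    (f ∘ₗ (WithConv.linearEquiv k (C →ₗ[k] k)).symm.toLinearMap)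
  have hf : ∀ ψ : WithConv (C →ₗ[k] k), f ψ = ψ y := fun ψ =>
    (LinearMap.congr_fun hy ψ.ofConv).symm
  have hev : ∀ (x : C) z, (TensorProduct.rid k _ (f.lTensor (WithConv (C →ₗ[k] k)) z)) x =
      convEval x y z := fun x z => by
    induction z with
    | zero => simp
    | add a b ha hb => simp only [map_add, WithConv.ofConv_add, LinearMap.add_apply, ha, hb]
    | tmul φ ψ => simp [hf, mul_comm]
  apply WithConv.ext
  ext x
  rw [hev, map_sub, hzw, sub_self]
  rfl

/-- `∑ h₁ τ(h₂ S(g)) = ∑ τ(h S(g₁)) g₂` for an integral `τ`. -/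
theorem sum_integral_mul_antipode {τ : H →ₗ[k] k}
    (hτ : ∀ x : H, TensorProduct.rid k H (τ.lTensor H (comul x)) = algebraMap k H (τ x))
    {ι κ : Type*} {h g : H} (P : Coalgebra.Repr k h ι) (Q : Coalgebra.Repr k g κ) :
    ∑ a ∈ P.index, τ (P.right a * antipode k g) • P.left a =
      ∑ b ∈ Q.index, τ (h * antipode k (Q.left b)) • Q.right b := by
  -- Evaluate `∑ τ(h₂S(g₁)) h₁S(g₂)g₃` in two ways. Since `ΔS(g) = ∑ S(g₂) ⊗ S(g₁)`, grouping `g₁,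
  -- g₂` gives the integral property of `τ` at `h S(g₁)`; grouping `g₂, g₃` gives `S(g₂)g₃ = ε(g₂)`.
  let f : H →ₗ[k] H →ₗ[k] H →ₗ[k] H := ∑ a ∈ P.index,
    LinearMap.mk₂ k (fun x y => τ (P.right a * antipode k x) •
        LinearMap.mulLeft k (P.left a * antipode k y))
      (fun x x' y => by ext; simp [mul_add, add_smul])
      (fun c x y => by ext; simp [mul_smul])
      (fun x y y' => by ext; simp [mul_add, add_mul, mul_assoc])
      (fun c x y => by
        ext
        simp only [map_smul, mul_smul_comm, LinearMap.smul_apply, LinearMap.mulLeft_apply,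
          smul_mul_assoc]
        rw [smul_comm])
  have hf : ∀ x y z, f x y z = ∑ a ∈ P.index,
      τ (P.right a * antipode k x) • (P.left a * antipode k y * z) := fun x y z => by
    simp [f, LinearMap.sum_apply, mul_assoc]
  have key := Q.sum_coassoc f
  simp only [hf] at key
  have hL : ∀ b, ∑ j ∈ (ℛ k (Q.left b)).index, ∑ a ∈ P.index,
      τ (P.right a * antipode k ((ℛ k (Q.left b)).left j)) •
        (P.left a * antipode k ((ℛ k (Q.left b)).right j) * Q.right b) =
      τ (h * antipode k (Q.left b)) • Q.right b := fun b => by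
    have := hτ (h * antipode k (Q.left b))
    rw [Bialgebra.comul_mul, comul_antipode _ (ℛ k (Q.left b)), ← P.eq] at this
    simp only [Finset.sum_mul_sum, Algebra.TensorProduct.tmul_mul_tmul, map_sum,
      LinearMap.lTensor_tmul, TensorProduct.rid_tmul] at this
    have := congrArg (· * Q.right b) this
    simp only [Finset.sum_mul, smul_mul_assoc, ← Algebra.smul_def] at this
    rw [Finset.sum_comm, this]
  have hR : ∀ b, ∑ j ∈ (ℛ k (Q.right b)).index, ∑ a ∈ P.index,
      τ (P.right a * antipode k (Q.left b)) •
        (P.left a * antipode k ((ℛ k (Q.right b)).left j) * (ℛ k (Q.right b)).right j) =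
      ∑ a ∈ P.index, τ (P.right a * antipode k (counit (R := k) (Q.right b) • Q.left b)) •
        P.left a := fun b => by
    rw [Finset.sum_comm]
    refine Finset.sum_congr rfl fun a _ => ?_
    simp only [mul_assoc, ← Finset.smul_sum, ← Finset.mul_sum, sum_antipode_mul_eq_smul]
    simp only [map_smul, mul_smul_comm, smul_eq_mul, mul_smul, mul_one]
    rw [smul_comm]
  simp only [hL, hR] at key
  rw [key, Finset.sum_comm]
  refine Finset.sum_congr rfl fun a _ => ?_
  rw [← Finset.sum_smul, ← map_sum, ← Finset.mul_sum, ← map_sum, Q.sum_counit_right_smul]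

/-- An integral on `H` gives a separability idempotent of the dual algebra `H*`. -/
theorem exists_separability_dual [FiniteDimensional k H] {τ : H →ₗ[k] k} (hτ1 : τ 1 = 1)
    (hτ : ∀ x : H, TensorProduct.rid k H (τ.lTensor H (comul x)) = algebraMap k H (τ x)) :
    ∃ e : WithConv (H →ₗ[k] k) ⊗[k] WithConv (H →ₗ[k] k), LinearMap.mul' k _ e = 1 ∧
      ∀ s : WithConv (H →ₗ[k] k),
        (s ⊗ₜ[k] (1 : WithConv (H →ₗ[k] k))) * e = (LinearMap.mulRight k s).lTensor _ e := by
  let b := Module.finBasis k H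
  -- The idempotent is the bilinear form `(h, g) ↦ τ(h S(g))`, written in `H* ⊗ H*` through a dual
  -- basis. Multiplying it out gives `τ(h₁S(h₂)) = ε(h)τ(1)`, and the centrality condition is `s`
  -- applied to `sum_integral_mul_antipode`.
  let θ : H → WithConv (H →ₗ[k] k) := fun x => toConv (τ ∘ₗ LinearMap.mulLeft k x ∘ₗ antipode k)
  have hθ : ∀ x g, θ x g = τ (x * antipode k g) := fun _ _ => rfl
  have hb : ∀ x g, ∑ i, b.coord i x * θ (b i) g = τ (x * antipode k g) := fun x g => by
    conv_rhs => rw [← b.sum_repr x]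
    simp only [Finset.sum_mul, map_sum, smul_mul_assoc, map_smul, smul_eq_mul]
    rfl
  refine ⟨∑ i, toConv (b.coord i) ⊗ₜ θ (b i), ?_, fun s => convEval_ext fun h g => ?_⟩
  · apply WithConv.ext
    ext h
    simp only [map_sum, LinearMap.mul'_apply, WithConv.ofConv_sum, LinearMap.sum_apply,
      (ℛ k h).convMul_apply]
    rw [Finset.sum_comm]
    simp only [hb, ← map_sum, sum_mul_antipode_eq_algebraMap_counit]
    simp [Algebra.algebraMap_eq_smul_one, hτ1]
  · have hL : convEval h g ((s ⊗ₜ[k] (1 : WithConv (H →ₗ[k] k))) *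
        ∑ i, toConv (b.coord i) ⊗ₜ θ (b i)) =
        ∑ a ∈ (ℛ k h).index, s ((ℛ k h).left a) * τ ((ℛ k h).right a * antipode k g) := by
      have h1 : ∀ i, convEval h g ((s ⊗ₜ[k] (1 : WithConv (H →ₗ[k] k))) *
          (toConv (b.coord i) ⊗ₜ[k] θ (b i))) = (s * toConv (b.coord i)) h * θ (b i) g := fun i => by
        refine (congrArg (convEval h g) (Algebra.TensorProduct.tmul_mul_tmul _ _ _ _)).trans ?_
        rw [convEval_tmul, one_mul]
      refine (congrArg (convEval h g) (Finset.mul_sum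
        (ι := Fin (Module.finrank k H)) Finset.univ
        (fun i => toConv (b.coord i) ⊗ₜ[k] θ (b i))
        (s ⊗ₜ[k] (1 : WithConv (H →ₗ[k] k))))).trans ?_
      rw [map_sum]
      simp only [h1, (ℛ k h).convMul_apply, ← hb, Finset.sum_mul, Finset.mul_sum]
      rw [Finset.sum_comm]
      simp only [mul_assoc]
    have hR : convEval h g ((LinearMap.mulRight k s).lTensor _
        (∑ i, toConv (b.coord i) ⊗ₜ θ (b i))) =
        ∑ c ∈ (ℛ k g).index, τ (h * antipode k ((ℛ k g).left c)) * s ((ℛ k g).right c) := by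
      simp only [map_sum, LinearMap.lTensor_tmul, convEval_tmul, LinearMap.mulRight_apply,
        (ℛ k g).convMul_apply, ← hb]
      simp only [Finset.mul_sum, Finset.sum_mul]
      rw [Finset.sum_comm]
      simp only [mul_assoc]
    have := congrArg s.ofConv (sum_integral_mul_antipode hτ (ℛ k h) (ℛ k g))
    simp only [map_sum, map_smul, smul_eq_mul] at this
    rw [hL, hR, ← this]
    simp only [mul_comm]

end Integral

/-! ### Structure of the crossed product -/

section ConvolutionOnTensor

open Coalgebra

variable {k C C' B : Type*} [Field k] [Ring C] [Bialgebra k C] [Ring C'] [Bialgebra k C']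
  [Ring B] [Algebra k B]

/-- The function `c ⊗ c' ↦ ε(c) f(c')`. -/
def convSnd (C : Type*) [Ring C] [Bialgebra k C] (f : C' →ₗ[k] B) :
    WithConv (C ⊗[k] C' →ₗ[k] B) :=
  toConv (f ∘ₗ (_root_.TensorProduct.lid k C').toLinearMap ∘ₗ counit.rTensor C')

/-- The function `c ⊗ c' ↦ ε(c') f(c)`. -/
def convFst (C' : Type*) [Ring C'] [Bialgebra k C'] (f : C →ₗ[k] B) :
    WithConv (C ⊗[k] C' →ₗ[k] B) :=
  toConv (f ∘ₗ (_root_.TensorProduct.rid k C).toLinearMap ∘ₗ counit.lTensor C)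

@[simp] theorem convSnd_tmul (f : C' →ₗ[k] B) (c : C) (c' : C') :
    convSnd C f (c ⊗ₜ c') = counit (R := k) c • f c' := by
  simp [convSnd]

@[simp] theorem convFst_tmul (f : C →ₗ[k] B) (c : C) (c' : C') :
    convFst C' f (c ⊗ₜ c') = counit (R := k) c' • f c := by
  simp [convFst]

/-- A factor that depends on `c` only through `ε` absorbs the comultiplication of `c`, so only `c'`
remains split. This and its variants pass between convolution identities on `C ⊗ C'` and Sweedler
formulas. -/
theorem mul_convSnd_apply (F : WithConv (C ⊗[k] C' →ₗ[k] B)) (f : C' →ₗ[k] B) (c : C)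
    {ι : Type*} {c' : C'} (Q : Coalgebra.Repr k c' ι) :
    (F * convSnd C f) (c ⊗ₜ c') = ∑ j ∈ Q.index, F (c ⊗ₜ Q.left j) * f (Q.right j) := by
  let T : Coalgebra.Repr k (c ⊗ₜ[k] c') _ := (ℛ k c).tmul Q
  rw [T.convMul_apply]
  simp only [T, Coalgebra.Repr.tmul, Finset.sum_product]
  rw [Finset.sum_comm]
  refine Finset.sum_congr rfl fun j _ => ?_
  conv_rhs => rw [← (ℛ k c).sum_counit_right_smul]
  simp [TensorProduct.sum_tmul, Finset.sum_mul, ← TensorProduct.smul_tmul']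

theorem mul_convFst_apply (F : WithConv (C ⊗[k] C' →ₗ[k] B)) (f : C →ₗ[k] B) (c' : C')
    {ι : Type*} {c : C} (P : Coalgebra.Repr k c ι) :
    (F * convFst C' f) (c ⊗ₜ c') = ∑ i ∈ P.index, F (P.left i ⊗ₜ c') * f (P.right i) := by
  let T : Coalgebra.Repr k (c ⊗ₜ[k] c') _ := P.tmul (ℛ k c')
  rw [T.convMul_apply]
  simp only [T, Coalgebra.Repr.tmul, Finset.sum_product]
  refine Finset.sum_congr rfl fun j _ => ?_
  conv_rhs => rw [← (ℛ k c').sum_counit_right_smul]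
  simp [TensorProduct.tmul_sum, Finset.sum_mul]

theorem convFst_mul_convSnd (f : C →ₗ[k] B) (g : C' →ₗ[k] B) :
    convFst C' f * convSnd C g = toConv (LinearMap.mul' k B ∘ₗ TensorProduct.map f g) := by
  apply WithConv.ext
  ext c c'
  refine (mul_convSnd_apply _ _ _ (ℛ k c')).trans ?_
  conv_rhs => rw [← Coalgebra.sum_counit_smul (ℛ k c')]
  simp 

/-- Composition with an algebra homomorphism, as a ring homomorphism of convolution algebras. -/
def AlgHom.convMap {B' : Type*} [Ring B'] [Algebra k B'] (φ : B →ₐ[k] B') :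
    WithConv (C →ₗ[k] B) →+* WithConv (C →ₗ[k] B') where
  toFun f := toConv (φ.toLinearMap ∘ₗ f.ofConv)
  map_one' := by
    apply WithConv.ext
    ext
    simp
  map_mul' f g := WithConv.ext (LinearMap.algHom_comp_convMul_distrib φ f g)
  map_zero' := by
    apply WithConv.ext
    ext
    simp
  map_add' f g := by
    apply WithConv.ext
    ext
    simp

@[simp] theorem AlgHom.convMap_apply {B' : Type*} [Ring B'] [Algebra k B'] (φ : B →ₐ[k] B')
    (f : WithConv (C →ₗ[k] B)) (c : C) : φ.convMap f c = φ (f c) := rfl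

end ConvolutionOnTensor

namespace CrossedSystem

open Coalgebra HopfAlgebra

variable {k : Type u} {H : Type v} {R : Type w} [Field k] [Ring H] [HopfAlgebra k H]
  [Ring R] [Algebra k R] (D : CrossedSystem k H R)

/-- The identification of the vector spaces `R ⊗ H` and `R #_σ H`. -/
def ofTensor : R ⊗[k] H ≃ₗ[k] D.CrossedProduct := LinearEquiv.refl k (R ⊗[k] H)

/-- The element `r # h`. -/
def hash (r : R) (h : H) : D.CrossedProduct := D.ofTensor (r ⊗ₜ[k] h)

@[elab_as_elim]
theorem induction_on {P : D.CrossedProduct → Prop} (x : D.CrossedProduct) (zero : P 0)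
    (hash : ∀ r h, P (D.hash r h)) (add : ∀ x y, P x → P y → P (x + y)) : P x :=
  TensorProduct.induction_on x zero hash add

theorem hash_one_mul (r : R) (x : R ⊗[k] H) :
    D.hash r 1 * D.ofTensor x = D.ofTensor ((r ⊗ₜ[k] (1 : H)) * x) := by
  have := D.mulMap_mul_left r ((1 : R) ⊗ₜ[k] (1 : H)) x
  rw [one_mulMap, Algebra.TensorProduct.tmul_mul_tmul, mul_one, mul_one] at this
  exact this

theorem hash_one_mul_hash (r s : R) (h : H) : D.hash r 1 * D.hash s h = D.hash (r * s) h :=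
  (D.hash_one_mul r (s ⊗ₜ h)).trans <| by
    rw [Algebra.TensorProduct.tmul_mul_tmul, one_mul]
    rfl

/-- The embedding `r ↦ r # 1`. -/
def incl : R →ₐ[k] D.CrossedProduct :=
  AlgHom.ofLinearMap (D.ofTensor.toLinearMap ∘ₗ (TensorProduct.mk k R H).flip 1) rfl fun r s =>
    (D.hash_one_mul_hash r s 1).symm

/-- The map `h ↦ 1 # h`. -/
def gamma : H →ₗ[k] D.CrossedProduct := D.ofTensor.toLinearMap ∘ₗ TensorProduct.mk k R H 1

theorem incl_mul_hash (r s : R) (h : H) : D.incl r * D.hash s h = D.hash (r * s) h :=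
  D.hash_one_mul_hash r s h

theorem incl_mul_gamma (r : R) (h : H) : D.incl r * D.gamma h = D.hash r h :=
  (D.incl_mul_hash r 1 h).trans (by rw [mul_one])

theorem gamma_one : D.gamma 1 = 1 := rfl

theorem gamma_mul_hash (g : H) (s : R) (h : H) :
    D.gamma g * D.hash s h = D.ofTensor (D.core s (g ⊗ₜ h)) := by
  have h1 : D.mulMap (1 ⊗ₜ g) (s ⊗ₜ h) = D.core s (g ⊗ₜ h) := by
    rw [mulMap_tmul, ← Algebra.TensorProduct.one_def, one_mul]
  exact h1

theorem ofTensor_core (s : R) {ι : Type*} {x : H ⊗[k] H} (P : Coalgebra.Repr k x ι) :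
    D.ofTensor (D.core s x) =
      ∑ i ∈ P.index, D.hash (D.coeff s (P.left i)) (LinearMap.mul' k H (P.right i)) := by
  rw [D.core_apply' s P, map_sum]
  rfl

/-- `(1 # h)(s # 1) = ∑ (h₁ · s) # h₂`. -/
theorem gamma_mul_incl (s : R) {ι : Type*} {h : H} (P : Coalgebra.Repr k h ι) :
    D.gamma h * D.incl s = ∑ i ∈ P.index, D.hash (D.act (P.left i) s) (P.right i) := by
  refine (D.gamma_mul_hash h s 1).trans ?_
  rw [D.core_apply s P 1, map_sum]
  refine Finset.sum_congr rfl fun i _ => ?_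
  have e1 : ∀ h : H, D.sigmaMul (h ⊗ₜ 1) = 1 ⊗ₜ h := fun h => by
    let P := ℛ k h
    rw [sigmaMul, (P.tmul (reprOne k H)).convMul_apply]
    conv_rhs => rw [← Coalgebra.sum_counit_smul P]
    simp [reprOne, D.sigma_one_right, tmul_sum, Algebra.algebraMap_eq_smul_one]
  rw [e1, Algebra.TensorProduct.tmul_mul_tmul, mul_one, one_mul]
  rfl

/-- `σ` as a convolution invertible map to the crossed product. -/
def sigmaIncl : (WithConv (H ⊗[k] H →ₗ[k] D.CrossedProduct))ˣ :=
  Units.map D.incl.convMap.toMonoidHom D.sigma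

/-- `(1 # g)(1 # h) = ∑ σ(g₁, h₁) # g₂h₂`. -/
theorem gamma_mul_gamma : convFst H D.gamma * convSnd H D.gamma =
    D.sigmaIncl.val * toConv (D.gamma ∘ₗ LinearMap.mul' k H) := by
  rw [convFst_mul_convSnd]
  apply WithConv.ext
  ext g h
  let P := ℛ k (g ⊗ₜ[k] h)
  have h1 : D.coeff 1 = D.sigma.val := by
    have : toConv (D.act.flip 1 ∘ₗ (dropLast k H H).toLinearMap) = 1 := by
      apply WithConv.ext
      ext x y
      change D.act (counit (R := k) y • x) 1 = algebraMap k R (counit (x ⊗ₜ[k] y))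
      simp [D.act_one, Algebra.algebraMap_eq_smul_one, mul_smul]
    rw [coeff, this, one_mul]
  refine (D.gamma_mul_hash g 1 h).trans ?_
  rw [D.ofTensor_core 1 P, h1]
  refine Eq.trans ?_ (P.convMul_apply _ _).symm
  exact Finset.sum_congr rfl fun i _ => (D.incl_mul_gamma _ _).symm

/-! The coaction of `H` on the crossed product. -/

/-- The linear map `r # h ↦ ∑ (r # h₁) ⊗ h₂`. -/
def coactionMap : D.CrossedProduct →ₗ[k] D.CrossedProduct ⊗[k] H :=
  (D.ofTensor.toLinearMap.rTensor H) ∘ₗ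
    (_root_.TensorProduct.assoc k R H H).symm.toLinearMap ∘ₗ comul.lTensor R ∘ₗ
      D.ofTensor.symm.toLinearMap

theorem coactionMap_hash (r : R) {ι : Type*} {h : H} (P : Coalgebra.Repr k h ι) :
    D.coactionMap (D.hash r h) = ∑ i ∈ P.index, D.hash r (P.left i) ⊗ₜ[k] P.right i := by
  change D.ofTensor.toLinearMap.rTensor H
    ((_root_.TensorProduct.assoc k R H H).symm (comul.lTensor R (r ⊗ₜ[k] h))) = _
  rw [LinearMap.lTensor_tmul, ← P.eq]
  simp only [TensorProduct.tmul_sum, map_sum, TensorProduct.assoc_symm_tmul]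
  rfl

theorem coactionMap_incl_mul (r : R) (x : D.CrossedProduct) :
    D.coactionMap (D.incl r * x) = (D.incl r ⊗ₜ[k] (1 : H)) * D.coactionMap x := by
  induction x using induction_on with
  | zero => simp
  | add x y hx hy => simp only [mul_add, map_add, hx, hy]
  | hash s h =>
    rw [incl_mul_hash, D.coactionMap_hash _ (ℛ k h), D.coactionMap_hash _ (ℛ k h)]
    simp [Finset.mul_sum, incl_mul_hash]

/-- Multiplication of `H` is a coalgebra map, so for `x = g ⊗ h` in the coalgebra `H ⊗ H` both sides
are `∑ (coeff s x₁ # μ(x₂)) ⊗ μ(x₃)`, with the two bracketings of coassociativity. -/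
theorem coactionMap_gamma_mul (g : H) (x : D.CrossedProduct) :
    D.coactionMap (D.gamma g * x) = D.coactionMap (D.gamma g) * D.coactionMap x := by
  induction x using induction_on with
  | zero => simp
  | add x y hx hy => simp only [mul_add, map_add, hx, hy]
  | hash s h =>
    let P := ℛ k g
    let Q := ℛ k h
    let T := P.tmul Q
    have hγ : D.coactionMap (D.gamma g) = ∑ i ∈ P.index, D.gamma (P.left i) ⊗ₜ[k] P.right i :=
      D.coactionMap_hash 1 P
    have hL : D.coactionMap (D.gamma g * D.hash s h) = ∑ i ∈ T.index,
        ∑ j ∈ (ℛ k (T.right i)).index, D.hash (D.coeff s (T.left i))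
          (LinearMap.mul' k H ((ℛ k (T.right i)).left j)) ⊗ₜ[k]
            LinearMap.mul' k H ((ℛ k (T.right i)).right j) := by
      rw [gamma_mul_hash, D.ofTensor_core s T, map_sum]
      refine Finset.sum_congr rfl fun i _ => ?_
      let X := ℛ k (T.right i)
      let Y : Coalgebra.Repr k (LinearMap.mul' k H (T.right i)) _ :=
        X.induced (Bialgebra.mulCoalgHom k H)
      exact D.coactionMap_hash _ Y
    have hR : D.coactionMap (D.gamma g) * D.coactionMap (D.hash s h) = ∑ i ∈ T.index,
        ∑ j ∈ (ℛ k (T.left i)).index, D.hash (D.coeff s ((ℛ k (T.left i)).left j))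
          (LinearMap.mul' k H ((ℛ k (T.left i)).right j)) ⊗ₜ[k]
            LinearMap.mul' k H (T.right i) := by
      rw [hγ, D.coactionMap_hash s Q, Finset.sum_mul_sum, ← Finset.sum_product']
      refine Finset.sum_congr rfl fun i _ => ?_
      rw [Algebra.TensorProduct.tmul_mul_tmul, gamma_mul_hash]
      change D.ofTensor (D.core s (T.left i)) ⊗ₜ[k] LinearMap.mul' k H (T.right i) = _
      rw [D.ofTensor_core s (ℛ k (T.left i)), TensorProduct.sum_tmul]
    rw [hL, hR]
    exact (T.sum_coassoc (LinearMap.mk₂ k (fun x y => (TensorProduct.mk k D.CrossedProduct H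
      (D.ofTensor ((D.coeff s).ofConv x ⊗ₜ LinearMap.mul' k H y))) ∘ₗ LinearMap.mul' k H)
      (fun x x' y => by simp only [map_add, TensorProduct.add_tmul, LinearMap.add_comp])
      (fun c x y => by
        simp only [map_smul, ← TensorProduct.smul_tmul', LinearMap.smul_comp])
      (fun x y y' => by simp only [map_add, TensorProduct.tmul_add, LinearMap.add_comp])
      (fun c x y => by
        simp only [map_smul, TensorProduct.tmul_smul, LinearMap.smul_comp]))).symm

/-- The coaction `r # h ↦ ∑ (r # h₁) ⊗ h₂` as an algebra homomorphism. -/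
def coaction : D.CrossedProduct →ₐ[k] D.CrossedProduct ⊗[k] H :=
  AlgHom.ofLinearMap D.coactionMap
    (by
      refine (D.coactionMap_hash 1 (reprOne k H)).trans ?_
      simp [reprOne]
      rfl)
    fun x y => by
      induction x using induction_on with
      | zero => simp
      | add x x' hx hx' => simp only [add_mul, map_add, hx, hx']
      | hash r h =>
        rw [← incl_mul_gamma, mul_assoc, coactionMap_incl_mul, coactionMap_gamma_mul,
          coactionMap_incl_mul, mul_assoc]

theorem coaction_hash (r : R) {ι : Type*} {h : H} (P : Coalgebra.Repr k h ι) :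
    D.coaction (D.hash r h) = ∑ i ∈ P.index, D.hash r (P.left i) ⊗ₜ[k] P.right i :=
  D.coactionMap_hash r P

theorem coaction_incl (r : R) : D.coaction (D.incl r) = D.incl r ⊗ₜ 1 := by
  refine (D.coactionMap_hash r (reprOne k H)).trans ?_
  simp [reprOne]
  rfl

end CrossedSystem

namespace CrossedSystem

open Coalgebra HopfAlgebra

variable {k : Type u} {H : Type v} {R : Type w} [Field k] [Ring H] [HopfAlgebra k H]
  [Ring R] [Algebra k R] (D : CrossedSystem k H R)

/-! ### Functionals on `H` as maps from the crossed product to `R` -/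

/-- The map `r # h ↦ f(h) r`. -/
def contract (f : H →ₗ[k] k) : D.CrossedProduct →ₗ[k] R :=
  (_root_.TensorProduct.rid k R).toLinearMap ∘ₗ f.lTensor R ∘ₗ D.ofTensor.symm.toLinearMap

@[simp] theorem contract_hash (f : H →ₗ[k] k) (r : R) (h : H) :
    D.contract f (D.hash r h) = f h • r := rfl

theorem contract_incl (f : H →ₗ[k] k) (r : R) : D.contract f (D.incl r) = f 1 • r := rfl

theorem contract_gamma (f : H →ₗ[k] k) (h : H) : D.contract f (D.gamma h) = f h • 1 := rfl

theorem contract_incl_mul (f : H →ₗ[k] k) (r : R) (x : D.CrossedProduct) :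
    D.contract f (D.incl r * x) = r * D.contract f x := by
  induction x using induction_on with
  | zero => simp
  | add x y hx hy => simp only [mul_add, map_add, hx, hy]
  | hash s h => rw [incl_mul_hash]; simp

/-- The map `r # h ↦ τ(h) r` is right `R`-linear if `τ` is an integral. -/
theorem contract_mul_incl {τ : H →ₗ[k] k}
    (hτ : ∀ x : H, _root_.TensorProduct.rid k H (τ.lTensor H (comul x)) = algebraMap k H (τ x))
    (x : D.CrossedProduct) (r : R) :
    D.contract τ (x * D.incl r) = D.contract τ x * r := by
  induction x using induction_on with
  | zero => simp
  | add x y hx hy => simp only [add_mul, map_add, hx, hy]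
  | hash s h =>
    rw [← incl_mul_gamma, mul_assoc, contract_incl_mul, contract_incl_mul, contract_gamma,
      D.gamma_mul_incl r (ℛ k h), map_sum, mul_assoc]
    congr 1
    have h1 := congrArg (fun y => D.act y r) (hτ h)
    rw [← (ℛ k h).eq] at h1
    simp only [map_sum, LinearMap.lTensor_tmul, TensorProduct.rid_tmul, LinearMap.sum_apply,
      map_smul, LinearMap.smul_apply, Algebra.algebraMap_eq_smul_one, D.one_act] at h1
    simpa using h1

/-- `∑ (id ⊗ ε)(x₀) # x₁ = x`. -/
theorem sum_contract_counit (x : D.CrossedProduct) :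
    D.ofTensor ((D.contract counit).rTensor H (D.coaction x)) = x := by
  induction x using induction_on with
  | zero => simp
  | add x y hx hy => simp only [map_add, hx, hy]
  | hash r h =>
    rw [D.coaction_hash r (ℛ k h)]
    conv_rhs => rw [← Coalgebra.sum_counit_smul (ℛ k h)]
    simp only [map_sum, LinearMap.rTensor_tmul, contract_hash, TensorProduct.smul_tmul]
    simp only [hash, TensorProduct.tmul_sum, map_sum]

/-- Coinvariants of the coaction lie in `R`. This is how elements of the crossed product are later
recognized as elements of `R`. -/
theorem incl_contract_counit {x : D.CrossedProduct} (hx : D.coaction x = x ⊗ₜ 1) :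
    D.incl (D.contract counit x) = x := by
  conv_rhs => rw [← D.sum_contract_counit x, hx, LinearMap.rTensor_tmul]
  rfl

theorem incl_injective : Function.Injective D.incl := fun r s h => by
  have := congrArg (D.contract counit) h
  simpa [contract_incl] using this

/-! ### The convolution inverse of `h ↦ 1 # h` -/

/-- The map `g ⊗ h ↦ ∑ σ⁻¹(g₁, h) # g₂`. -/
def sigmaInvGamma : WithConv (H ⊗[k] H →ₗ[k] D.CrossedProduct) :=
  D.sigmaIncl⁻¹.val * convFst H D.gamma

/-- Cancel `σ` in `γ(g)γ(h) = ∑ σ(g₁, h₁) γ(g₂h₂)`, where `γ(h) = 1 # h`. -/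
theorem sigmaInvGamma_mul : D.sigmaInvGamma * convSnd H D.gamma =
    toConv (D.gamma ∘ₗ LinearMap.mul' k H) := by
  rw [sigmaInvGamma, mul_assoc, gamma_mul_gamma, Units.inv_mul_cancel_left]

/-- The map `h ↦ ∑ σ⁻¹(S(h₂), h₃) # S(h₁)`. -/
def gammaInv : H →ₗ[k] D.CrossedProduct :=
  D.sigmaInvGamma.ofConv ∘ₗ (antipode k).rTensor H ∘ₗ comul

theorem gammaInv_apply {ι : Type*} {h : H} (P : Coalgebra.Repr k h ι) :
    D.gammaInv h = ∑ i ∈ P.index, D.sigmaInvGamma (antipode k (P.left i) ⊗ₜ P.right i) := by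
  change D.sigmaInvGamma.ofConv ((antipode k).rTensor H (comul h)) = _
  rw [← P.eq, map_sum, map_sum]
  rfl

/-- By coassociativity the product is `∑ γ(S(h₁)h₂)`, after `sigmaInvGamma_mul` is applied at
`S(h₁)`. -/
theorem gammaInv_mul_gamma : toConv D.gammaInv * toConv D.gamma = 1 := by
  apply WithConv.ext
  ext h
  let P := ℛ k h
  refine (P.convMul_apply _ _).trans ?_
  change ∑ i ∈ P.index, D.gammaInv (P.left i) * D.gamma (P.right i) = algebraMap k _ (counit h)
  let f : H →ₗ[k] H →ₗ[k] H →ₗ[k] D.CrossedProduct := LinearMap.mk₂ k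
    (fun x y => LinearMap.mulLeft k (D.sigmaInvGamma.ofConv (antipode k x ⊗ₜ y)) ∘ₗ D.gamma)
    (fun x x' y => by ext; simp [TensorProduct.add_tmul, add_mul])
    (fun c x y => by ext; simp [← TensorProduct.smul_tmul'])
    (fun x y y' => by ext; simp [TensorProduct.tmul_add, add_mul])
    (fun c x y => by ext; simp)
  have h1 := P.sum_coassoc f
  have h2 : ∀ i, ∑ j ∈ (ℛ k (P.right i)).index, f (P.left i) ((ℛ k (P.right i)).left j)
      ((ℛ k (P.right i)).right j) = D.gamma (antipode k (P.left i) * P.right i) := fun i => by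
    refine (mul_convSnd_apply D.sigmaInvGamma D.gamma (antipode k (P.left i))
      (ℛ k (P.right i))).symm.trans ?_
    rw [sigmaInvGamma_mul]
    rfl
  simp only [h2, ← map_sum, sum_antipode_mul_eq_algebraMap_counit] at h1
  rw [Algebra.algebraMap_eq_smul_one, map_smul, gamma_one,
    ← Algebra.algebraMap_eq_smul_one] at h1
  rw [← h1]
  refine Finset.sum_congr rfl fun i _ => ?_
  rw [D.gammaInv_apply (ℛ k (P.left i)), Finset.sum_mul]
  rfl

theorem convFst_mul {B : Type*} [Ring B] [Algebra k B] (f g : WithConv (H →ₗ[k] B)) :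
    convFst H (f * g).ofConv = convFst H f.ofConv * convFst H g.ofConv := by
  apply WithConv.ext
  ext x y
  refine Eq.trans ?_ (mul_convFst_apply (convFst H f.ofConv) g.ofConv y (ℛ k x)).symm
  change convFst H (f * g).ofConv (x ⊗ₜ y) = _
  rw [convFst_tmul]
  refine (congrArg _ ((ℛ k x).convMul_apply f g)).trans ?_
  simp [Finset.smul_sum]

theorem convMap_coaction_gamma : D.coaction.convMap (toConv D.gamma) =
    (Algebra.TensorProduct.includeLeft :
      D.CrossedProduct →ₐ[k] D.CrossedProduct ⊗[k] H).convMap (toConv D.gamma) *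
      toConv (Algebra.TensorProduct.includeRight :
        H →ₐ[k] D.CrossedProduct ⊗[k] H).toLinearMap := by
  apply WithConv.ext
  ext h
  refine (D.coaction_hash 1 (ℛ k h)).trans ?_
  refine Eq.trans ?_ ((ℛ k h).convMul_apply _ _).symm
  refine Finset.sum_congr rfl fun i _ => ?_
  change _ = (D.gamma _ ⊗ₜ[k] (1 : H)) * ((1 : D.CrossedProduct) ⊗ₜ[k] _)
  rw [Algebra.TensorProduct.tmul_mul_tmul, one_mul, mul_one]
  rfl

theorem convMap_coaction_sigmaInvGamma : D.coaction.convMap D.sigmaInvGamma =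
    (Algebra.TensorProduct.includeLeft :
      D.CrossedProduct →ₐ[k] D.CrossedProduct ⊗[k] H).convMap D.sigmaInvGamma *
      convFst H (Algebra.TensorProduct.includeRight :
        H →ₐ[k] D.CrossedProduct ⊗[k] H).toLinearMap := by
  have h1 : D.coaction.convMap D.sigmaIncl⁻¹.val =
      (Algebra.TensorProduct.includeLeft :
        D.CrossedProduct →ₐ[k] D.CrossedProduct ⊗[k] H).convMap D.sigmaIncl⁻¹.val := by
    apply WithConv.ext
    refine LinearMap.ext fun z => ?_
    exact D.coaction_incl _
  have h2 := congrArg (fun f => convFst H f.ofConv) D.convMap_coaction_gamma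
  simp only [convFst_mul] at h2
  rw [sigmaInvGamma, map_mul, map_mul, h1, mul_assoc]
  exact congrArg _ h2

/-- The coaction is trivial on the values of `σ⁻¹`, so only the factor `γ(S(h))` gets split; `ΔS = ∑
S(h₂) ⊗ S(h₁)` puts `S(h₁)` on the right. -/
theorem coaction_gammaInv {ι : Type*} {h : H} (P : Coalgebra.Repr k h ι) :
    D.coaction (D.gammaInv h) =
      ∑ i ∈ P.index, D.gammaInv (P.right i) ⊗ₜ[k] antipode k (P.left i) := by
  let f : H →ₗ[k] H →ₗ[k] H →ₗ[k] D.CrossedProduct ⊗[k] H := LinearMap.mk₂ k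
    (fun x y => (TensorProduct.mk k D.CrossedProduct H).flip (antipode k x) ∘ₗ
      D.sigmaInvGamma.ofConv ∘ₗ TensorProduct.mk k H H (antipode k y))
    (fun x x' y => by ext; simp)
    (fun c x y => by ext; simp)
    (fun x y y' => by ext; simp)
    (fun c x y => by ext; simp)
  have h1 := P.sum_coassoc f
  rw [D.gammaInv_apply P, map_sum]
  refine Eq.trans (Finset.sum_congr rfl fun i _ => ?_) (h1.trans ?_)
  · let T : Coalgebra.Repr k (antipode k (P.left i)) _ :=
      ⟨(ℛ k (P.left i)).index, _, _, (comul_antipode _ (ℛ k (P.left i))).symm⟩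
    refine (congrArg (fun F : WithConv (H ⊗[k] H →ₗ[k] D.CrossedProduct ⊗[k] H) =>
      F (antipode k (P.left i) ⊗ₜ P.right i)) D.convMap_coaction_sigmaInvGamma).trans ?_
    refine (mul_convFst_apply _ _ _ T).trans ?_
    refine Finset.sum_congr rfl fun j _ => ?_
    change (D.sigmaInvGamma _ ⊗ₜ[k] (1 : H)) * ((1 : D.CrossedProduct) ⊗ₜ[k] _) = _
    rw [Algebra.TensorProduct.tmul_mul_tmul, one_mul, mul_one]
    rfl
  · refine Finset.sum_congr rfl fun i _ => ?_
    rw [D.gammaInv_apply (ℛ k (P.right i)), TensorProduct.sum_tmul]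
    rfl

theorem convMap_coaction_gammaInv : D.coaction.convMap (toConv D.gammaInv) =
    toConv ((Algebra.TensorProduct.includeRight :
        H →ₐ[k] D.CrossedProduct ⊗[k] H).toLinearMap ∘ₗ antipode k) *
      (Algebra.TensorProduct.includeLeft :
        D.CrossedProduct →ₐ[k] D.CrossedProduct ⊗[k] H).convMap (toConv D.gammaInv) := by
  apply WithConv.ext
  ext h
  refine (D.coaction_gammaInv (ℛ k h)).trans ?_
  refine Eq.trans ?_ ((ℛ k h).convMul_apply _ _).symm
  refine Finset.sum_congr rfl fun i _ => ?_
  change _ = ((1 : D.CrossedProduct) ⊗ₜ[k] _) * (D.gammaInv _ ⊗ₜ[k] (1 : H))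
  rw [Algebra.TensorProduct.tmul_mul_tmul, one_mul, mul_one]

theorem includeRight_mul_antipode :
    toConv (Algebra.TensorProduct.includeRight :
        H →ₐ[k] D.CrossedProduct ⊗[k] H).toLinearMap *
      toConv ((Algebra.TensorProduct.includeRight :
        H →ₐ[k] D.CrossedProduct ⊗[k] H).toLinearMap ∘ₗ antipode k) = 1 := by
  have := congrArg (Algebra.TensorProduct.includeRight :
        H →ₐ[k] D.CrossedProduct ⊗[k] H).convMap (LinearMap.id_mul_antipode (R := k) (C := H))
  rw [map_mul, map_one] at this
  exact this

/-- The formula defining `γ⁻¹` only makes it a left inverse visibly. For the other side, the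
coaction factors `h` and `S(h)` cancel in `p = γ * γ⁻¹`, so `p` has coinvariant values and hence
values in `R`. Applying the left `R`-linear map `id ⊗ ε` to `p * γ = γ` then gives `p = ε`. -/
theorem gamma_mul_gammaInv : toConv D.gamma * toConv D.gammaInv = 1 := by
  let j : D.CrossedProduct →ₐ[k] D.CrossedProduct ⊗[k] H := Algebra.TensorProduct.includeLeft
  have h3 : D.coaction.convMap (toConv D.gamma * toConv D.gammaInv) =
      j.convMap (toConv D.gamma * toConv D.gammaInv) := by
    rw [map_mul, map_mul, convMap_coaction_gammaInv, convMap_coaction_gamma, mul_assoc,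
      ← mul_assoc _ _ (j.convMap (toConv D.gammaInv)), includeRight_mul_antipode, one_mul]
  have h4 : ∀ h, D.incl (D.contract counit ((toConv D.gamma * toConv D.gammaInv) h)) =
      (toConv D.gamma * toConv D.gammaInv) h := fun h =>
    D.incl_contract_counit (congrArg (fun F : WithConv (H →ₗ[k] D.CrossedProduct ⊗[k] H) => F h) h3)
  have h5 : (toConv D.gamma * toConv D.gammaInv) * toConv D.gamma = toConv D.gamma := by
    rw [mul_assoc, gammaInv_mul_gamma, mul_one]
  apply WithConv.ext
  ext h
  have h6 := congrArg (fun F : WithConv (H →ₗ[k] D.CrossedProduct) => D.contract counit (F h)) h5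
  simp only [(ℛ k h).convMul_apply (toConv D.gamma * toConv D.gammaInv), map_sum] at h6
  have h7 : D.contract counit ((toConv D.gamma * toConv D.gammaInv) h) =
      algebraMap k R (counit (R := k) h) := by
    conv_lhs => rw [← (ℛ k h).sum_counit_right_smul]
    rw [Algebra.algebraMap_eq_smul_one]
    refine Eq.trans ?_ (h6.trans (D.contract_gamma _ h))
    simp only [map_sum, map_smul]
    refine Finset.sum_congr rfl fun i _ => ?_
    conv_rhs => rw [← h4]
    rw [contract_incl_mul]
    change _ = _ * D.contract counit (D.gamma _)
    rw [contract_gamma, mul_smul_comm, mul_one]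
  change (toConv D.gamma * toConv D.gammaInv) h = algebraMap k _ (counit (R := k) h)
  rw [← h4, h7, AlgHom.commutes]

end CrossedSystem

namespace CrossedSystem

open Coalgebra HopfAlgebra

variable {k : Type u} {H : Type v} {R : Type w} [Field k] [Ring H] [HopfAlgebra k H]
  [Ring R] [Algebra k R] (D : CrossedSystem k H R)

theorem gamma_mul_gamma_apply {ι κ : Type*} {g h : H} (P : Coalgebra.Repr k g ι)
    (Q : Coalgebra.Repr k h κ) : D.gamma g * D.gamma h = ∑ i ∈ P.index, ∑ j ∈ Q.index,
      D.incl (D.sigma.val.ofConv (P.left i ⊗ₜ Q.left j)) * D.gamma (P.right i * Q.right j) := by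
  have h1 := congrArg (fun F : WithConv (H ⊗[k] H →ₗ[k] D.CrossedProduct) => F (g ⊗ₜ h))
    D.gamma_mul_gamma
  rw [convFst_mul_convSnd] at h1
  refine Eq.trans h1 (((P.tmul Q).convMul_apply _ _).trans ?_)
  exact Finset.sum_product _ _ _

/-! ### Modules over the crossed product -/

section Modules

variable {D} {M : Type x} [AddCommGroup M] [Module k M] [Module R M] [IsScalarTower k R M]

/-- A module over `R #_σ H` is an `R`-`H`-module. -/
def TwistedModule.ofModule [Module D.CrossedProduct M] [IsScalarTower k D.CrossedProduct M]
    (hRM : ∀ (r : R) (m : M), r • m = D.incl r • m) : D.TwistedModule M where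
  hact := (Algebra.lsmul k k M).toLinearMap ∘ₗ D.gamma
  one_hact := one_smul D.CrossedProduct
  hact_smul h a m := by
    change D.gamma h • a • m = ∑ i ∈ (ℛ k h).index,
      D.act ((ℛ k h).left i) a • D.gamma ((ℛ k h).right i) • m
    simp only [hRM, smul_smul]
    rw [D.gamma_mul_incl a (ℛ k h), Finset.sum_smul]
    simp only [incl_mul_gamma]
  hact_hact g h m := by
    change D.gamma g • D.gamma h • m = ∑ i ∈ (ℛ k g).index, ∑ j ∈ (ℛ k h).index,
      D.sigma.val.ofConv ((ℛ k g).left i ⊗ₜ (ℛ k h).left j) •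
        D.gamma ((ℛ k g).right i * (ℛ k h).right j) • m
    simp only [hRM, smul_smul]
    rw [D.gamma_mul_gamma_apply (ℛ k g) (ℛ k h), Finset.sum_smul]
    simp only [Finset.sum_smul]

theorem TwistedModule.ofModule_isIrreducible [Module D.CrossedProduct M]
    [IsScalarTower k D.CrossedProduct M] [IsSimpleModule D.CrossedProduct M]
    (hRM : ∀ (r : R) (m : M), r • m = D.incl r • m) : (ofModule hRM).IsIrreducible := by
  refine ⟨?_, fun N hN => ?_⟩
  · have := IsSimpleModule.nontrivial D.CrossedProduct M
    obtain ⟨m, hm⟩ := exists_ne (0 : M)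
    exact ⟨1, m, by rwa [one_smul]⟩
  · let N' : Submodule D.CrossedProduct M :=
      { N.toAddSubmonoid with
        smul_mem' := fun a m hm => by
          change a • m ∈ N
          replace hm : m ∈ N := hm
          induction a using induction_on with
          | zero =>
            rw [zero_smul]
            exact N.zero_mem
          | add x y hx hy =>
            rw [add_smul]
            exact N.add_mem hx hy
          | hash r h =>
            rw [← incl_mul_gamma, mul_smul, ← hRM]
            exact N.smul_mem r (hN h m hm) }
    rcases eq_bot_or_eq_top N' with h | h
    · exact .inl (SetLike.ext fun m => (SetLike.ext_iff.1 h m : m ∈ N' ↔ _))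
    · exact .inr (SetLike.ext fun m => (SetLike.ext_iff.1 h m : m ∈ N' ↔ _))

/-- The action of `R #_σ H` on an `R`-`H`-module. -/
def TwistedModule.toEnd (T : D.TwistedModule M) : D.CrossedProduct →ₐ[k] Module.End k M :=
  let φ : D.CrossedProduct →ₗ[k] Module.End k M :=
    LinearMap.mul' k _ ∘ₗ
      TensorProduct.map (Algebra.lsmul k k M).toLinearMap T.hact ∘ₗ D.ofTensor.symm.toLinearMap
  have hφ : ∀ r h m, φ (D.hash r h) m = r • T.hact h m := fun _ _ _ => rfl
  have hφ₁ : ∀ r x m, φ (D.incl r * x) m = r • φ x m := fun r x m => by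
    induction x using induction_on with
    | zero => simp
    | add x y hx hy => simp only [mul_add, map_add, LinearMap.add_apply, hx, hy, smul_add]
    | hash s h => rw [incl_mul_hash, hφ, hφ, mul_smul]
  have hφγ : ∀ h m, φ (D.gamma h) m = T.hact h m := fun h m => one_smul R _
  have hφ₂ : ∀ g h m, φ (D.gamma g * D.gamma h) m = T.hact g (T.hact h m) := fun g h m => by
    rw [T.hact_hact, D.gamma_mul_gamma_apply (ℛ k g) (ℛ k h)]
    simp only [map_sum, LinearMap.sum_apply, hφ₁, hφγ]
  have hφ₃ : ∀ g x m, φ (D.gamma g * x) m = T.hact g (φ x m) := fun g x m => by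
    induction x using induction_on with
    | zero => simp
    | add x y hx hy => simp only [mul_add, map_add, LinearMap.add_apply, hx, hy]
    | hash s h =>
      rw [hφ, T.hact_smul, ← incl_mul_gamma, ← mul_assoc, D.gamma_mul_incl s (ℛ k g),
        Finset.sum_mul, map_sum, LinearMap.sum_apply]
      refine Finset.sum_congr rfl fun i _ => ?_
      rw [← incl_mul_gamma, mul_assoc, hφ₁, hφ₂]
  AlgHom.ofLinearMap φ
    (LinearMap.ext fun m => (hφ 1 1 m).trans (by rw [one_smul, T.one_hact]; rfl))
    fun x y => LinearMap.ext fun m => by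
      induction x using induction_on with
      | zero => simp
      | add x x' hx hx' => simp only [add_mul, map_add, LinearMap.add_apply, hx, hx']
      | hash r h => rw [← incl_mul_gamma, mul_assoc, hφ₁, hφ₃, Module.End.mul_apply, hφ₁, hφγ]

theorem TwistedModule.toEnd_incl (T : D.TwistedModule M) (r : R) (m : M) :
    T.toEnd (D.incl r) m = r • m :=
  congrArg (r • ·) (T.one_hact m)

theorem TwistedModule.toEnd_gamma (T : D.TwistedModule M) (h : H) (m : M) :
    T.toEnd (D.gamma h) m = T.hact h m := one_smul R _

/-- Through `toEnd` an irreducible `R`-`H`-module becomes a simple module over the crossed product,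
since the two kinds of submodules agree. -/
theorem TwistedModule.IsIrreducible.smul_eq_zero {T : D.TwistedModule M} (hT : T.IsIrreducible)
    {r : R} (hr : D.incl r ∈ Ring.jacobson D.CrossedProduct) (m : M) : r • m = 0 := by
  let : Module D.CrossedProduct M := Module.compHom M T.toEnd.toRingHom
  have hsmul : ∀ (a : D.CrossedProduct) (m : M), a • m = T.toEnd a m := fun _ _ => rfl
  obtain ⟨a, m₀, hm₀⟩ := hT.1
  have : Nontrivial M := ⟨⟨_, _, hm₀⟩⟩
  have : IsSimpleModule D.CrossedProduct M :=
    { eq_bot_or_eq_top := fun N => by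
        let N' : Submodule R M :=
          { N.toAddSubmonoid with
            smul_mem' := fun r m hm => by
              have := N.smul_mem (D.incl r) hm
              rwa [hsmul, T.toEnd_incl] at this }
        rcases hT.2 N' fun h n hn => by
            have := N.smul_mem (D.gamma h) hn
            rwa [hsmul, T.toEnd_gamma] at this with h | h
        · exact .inl (SetLike.ext fun m => (SetLike.ext_iff.1 h m : m ∈ N' ↔ _))
        · exact .inr (SetLike.ext fun m => (SetLike.ext_iff.1 h m : m ∈ N' ↔ _)) }
  rw [← T.toEnd_incl, ← hsmul]
  exact smul_eq_zero_of_mem_jacobson hr m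

end Modules

/-! ### The `H`-Jacobson radical and the reduction to two inclusions -/

/-- The `H`-Jacobson radical of `R` is the intersection of `R` with the Jacobson radical of
the crossed product. -/
theorem mem_hJacobson {r : R} :
    r ∈ D.hJacobson ↔ D.incl r ∈ Ring.jacobson D.CrossedProduct := by
  refine ⟨fun hr => mem_jacobson_of_forall_smul_eq_zero fun m hm x => ?_,
    fun hr M _ _ _ _ T hT => hT.smul_eq_zero hr⟩
  have : IsSimpleModule D.CrossedProduct (D.CrossedProduct ⧸ m) :=
    isSimpleModule_iff_isCoatom.2 (Ideal.isMaximal_def.1 hm)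
  let : Module R (D.CrossedProduct ⧸ m) := Module.compHom _ D.incl.toRingHom
  have : IsScalarTower k R (D.CrossedProduct ⧸ m) :=
    ⟨fun c r v => by
      change D.incl (c • r) • v = c • D.incl r • v
      rw [map_smul, smul_assoc]⟩
  exact hr _ _ (TwistedModule.ofModule_isIrreducible fun _ _ => rfl) x

/-- If `1 + sr` has a left inverse `z` in the crossed product, then `r # h ↦ τ(h) r`, being right
`R`-linear and sending `1` to `1`, maps `z` to a left inverse in `R`. -/
theorem hJacobson_le {τ : H →ₗ[k] k} (hτ1 : τ 1 = 1)
    (hτ : ∀ x : H, _root_.TensorProduct.rid k H (τ.lTensor H (comul x)) = algebraMap k H (τ x)) :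
    D.hJacobson ≤ jacobsonRadical k R := fun r hr => by
  change r ∈ Ring.jacobson R
  rw [← Ideal.jacobson_bot]
  refine Ideal.mem_jacobson_iff.2 fun s => ?_
  obtain ⟨z, hz⟩ := Ideal.mem_jacobson_iff.1
    ((Ideal.jacobson_bot (R := D.CrossedProduct)).symm ▸ D.mem_hJacobson.1 hr) (D.incl s)
  refine ⟨D.contract τ z, ?_⟩
  rw [Ideal.mem_bot] at hz ⊢
  have := congrArg (D.contract τ) hz
  rw [map_sub, map_add, map_zero, D.contract_mul_incl hτ, D.contract_mul_incl hτ,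
    show (1 : D.CrossedProduct) = D.incl 1 from rfl, contract_incl, hτ1, one_smul] at this
  exact this

theorem subspaceCrossed_hJacobson_le :
    D.subspaceCrossed D.hJacobson ≤ jacobsonRadical k D.CrossedProduct := by
  rintro _ ⟨z, rfl⟩
  induction z with
  | zero =>
    rw [map_zero]
    exact zero_mem _
  | add x y hx hy =>
    rw [map_add]
    exact add_mem hx hy
  | tmul r h =>
    change D.hash r h ∈ Ring.jacobson D.CrossedProduct
    rw [← incl_mul_gamma]
    exact Ideal.mul_mem_right _ _ (D.mem_hJacobson.1 r.2)

theorem contract_mem {I : Submodule k R} {x : D.CrossedProduct} (hx : x ∈ D.subspaceCrossed I)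
    (f : H →ₗ[k] k) : D.contract f x ∈ I := by
  obtain ⟨z, rfl⟩ := hx
  induction z with
  | zero =>
    rw [map_zero]
    exact I.zero_mem
  | add x y hx hy =>
    rw [map_add]
    exact (map_add (D.contract f) _ _).symm ▸ I.add_mem hx hy
  | tmul r h => exact I.smul_mem (f h) r.2

/-- The comparison of radicals, once the Jacobson radicals of `R` and of the crossed product are
known to be controlled by `r_{Hj}(R)`. -/
theorem radicals_eq_of_le {τ : H →ₗ[k] k} (hτ1 : τ 1 = 1)
    (hτ : ∀ x : H, _root_.TensorProduct.rid k H (τ.lTensor H (comul x)) = algebraMap k H (τ x))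
    (hR : jacobsonRadical k R ≤ D.hJacobson)
    (hA : jacobsonRadical k D.CrossedProduct ≤ D.subspaceCrossed D.hJacobson) :
    jacobsonRadical k R = D.hJacobson ∧
      D.hJacobson = D.colon (jacobsonRadical k R) ∧
      jacobsonRadical k D.CrossedProduct = D.subspaceCrossed D.hJacobson := by
  have h1 : jacobsonRadical k R = D.hJacobson := le_antisymm hR (D.hJacobson_le hτ1 hτ)
  refine ⟨h1, ?_, le_antisymm hA D.subspaceCrossed_hJacobson_le⟩
  rw [h1]
  refine le_antisymm (fun r hr => ?_) fun r hr => ?_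
  · refine (Submodule.mem_iInf _).2 fun h => ?_
    -- `∑ (h₁ · r) # h₂` lies in `J(A) ⊆ r_{Hj}(R) # H`, so its contraction with `ε`, which is `h ·
    -- r`, lies in `r_{Hj}(R)`. The reverse inclusion is the case `h = 1`.
    have h2 : D.gamma h * D.incl r ∈ jacobsonRadical k D.CrossedProduct :=
      Ideal.mul_mem_left _ _ (D.mem_hJacobson.1 hr)
    have h3 := D.contract_mem (hA h2) counit
    rw [D.gamma_mul_incl r (ℛ k h), map_sum] at h3
    simp only [contract_hash] at h3
    have h4 := congrArg (fun x => D.act x r) (ℛ k h).sum_counit_right_smul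
    simp only [map_sum, map_smul, LinearMap.sum_apply, LinearMap.smul_apply] at h4
    rw [h4] at h3
    exact h3
  · have := (Submodule.mem_iInf _).1 hr 1
    rwa [Submodule.mem_comap, D.one_act] at this

end CrossedSystem

/-! ### Descent of semisimplicity from `V ⊗ S` to `V` -/

namespace TensorModule

variable {k A S V : Type*} [Field k] [Ring A] [Algebra k A] [Ring S] [Algebra k S]
  [AddCommGroup V] [Module k V] [Module A V] [IsScalarTower k A V]

/-- The map `v ⊗ h ↦ τ(h) v`. -/
def contractModule (τ : S →ₗ[k] k) :
    TensorModule k S V →ₗ[k] V :=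
  (TensorProduct.rid k V).toLinearMap ∘ₗ τ.lTensor V

theorem contractModule_smul_one (τ : S →ₗ[k] k)
    (z : A ⊗[k] S) (v : V) :
    contractModule τ (z • tmul k v (1 : S)) =
      TensorProduct.rid k _ (τ.lTensor _ z) • v := by
  induction z with
  | zero => rw [zero_smul, map_zero, map_zero, map_zero, zero_smul]
  | add x y hx hy => simp only [map_add, add_smul, hx, hy]
  | tmul a h =>
    rw [smul_tmul, mul_one]
    change τ h • a • v = (τ h • a) • v
    rw [smul_assoc]

theorem contractModule_smul (τ : S →ₗ[k] k)
    (a : A) (z : TensorModule k S V) :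
    contractModule τ ((a ⊗ₜ[k] (1 : S)) • z) = a • contractModule τ z := by
  induction z using induction_on with
  | zero => simp
  | add x y hx hy => simp only [map_add, smul_add, hx, hy]
  | tmul v h =>
    rw [smul_tmul, one_mul]
    change τ h • a • v = a • τ h • v
    rw [← algebraMap_smul A (τ h) v, ← algebraMap_smul A (τ h),
      smul_smul, smul_smul, Algebra.commutes]

/-- Let `ρ : A → A ⊗ S` be an algebra homomorphism which is trivial on the subalgebra `R` of `A`
and let `τ` be a functional on `S` with `τ(1) = 1` and `(id ⊗ τ)ρ(A) ⊆ R`.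
If `V ⊗ S` is semisimple over `ρ(A)`, then `V` is semisimple over `R`. -/
theorem isSemisimpleModule_of_coaction {R : Type*} [Ring R] [Algebra k R]
    [Module R V] {ι : R →ₐ[k] A} (hRV : ∀ (r : R) (v : V), r • v = ι r • v)
    {ρ : A →ₐ[k] A ⊗[k] S} (hι : ∀ r, ρ (ι r) = ι r ⊗ₜ 1)
    {τ : S →ₗ[k] k} (hτ1 : τ 1 = 1) (E : A → R)
    (hE : ∀ a, TensorProduct.rid k A (τ.lTensor A (ρ a)) = ι (E a))
    [IsSemisimpleModule ρ.range (TensorModule k S V)] : IsSemisimpleModule R V := by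
  refine (isSemisimpleModule_iff R V).2 ⟨fun W => ?_⟩
  -- `W'` is the `ρ(A)`-submodule generated by `W ⊗ 1`. Since `(id ⊗ τ)ρ(A)` lies in `R`, the map
  -- `id ⊗ τ` takes `W'` back into `W`.
  let W' : Submodule ρ.range (TensorModule k S V) :=
    Submodule.span _ ((fun w => tmul k w (1 : S)) '' W)
  have hW' : ∀ z ∈ W', ∀ a : ρ.range, contractModule τ (a • z) ∈ W := fun z hz => by
    refine Submodule.span_induction ?_ ?_ ?_ ?_ hz
    · rintro _ ⟨w, hw, rfl⟩ ⟨_, a, rfl⟩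
      change contractModule τ (ρ a • tmul k w (1 : S)) ∈ W
      rw [contractModule_smul_one, hE, ← hRV]
      exact W.smul_mem _ hw
    · intro a
      rw [smul_zero, map_zero]
      exact W.zero_mem
    · intro x y _ _ hx hy a
      rw [smul_add, map_add]
      exact W.add_mem (hx a) (hy a)
    · intro b x _ hx a
      rw [smul_smul]
      exact hx _
  have := (isSemisimpleModule_iff ρ.range (TensorModule k S V)).1 inferInstance
  obtain ⟨C, hC⟩ := exists_isCompl W'
  let f : TensorModule k S V →ₗ[ρ.range] TensorModule k S V := W'.subtype ∘ₗ W'.projectionOnto C hC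
  have hfW : ∀ v, f v ∈ W' := fun v => (W'.projectionOnto C hC v).2
  have hf : ∀ w ∈ W', f w = w := fun w hw =>
    congrArg Subtype.val (Submodule.projectionOnto_apply_left hC (⟨w, hw⟩ : W'))
  -- The projection onto `W` is `v ↦ (id ⊗ τ)(f(v ⊗ 1))`. It is `R`-linear because `ρ(r) = r ⊗ 1`,
  -- and it fixes `W` because `τ(1) = 1`.
  let g : V →ₗ[R] W :=
    { toFun := fun v => ⟨contractModule τ (f (tmul k v (1 : S))), by
        have := hW' _ (hfW (tmul k v (1 : S))) 1
        rwa [one_smul] at this⟩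
      map_add' := fun v w => Subtype.ext <| by
        change contractModule τ (f (tmul k (v + w) (1 : S))) =
          contractModule τ (f (tmul k v (1 : S))) + contractModule τ (f (tmul k w (1 : S)))
        rw [add_tmul, map_add, map_add]
      map_smul' := fun r v => Subtype.ext <| by
        change contractModule τ (f (tmul k (r • v) (1 : S))) =
          r • contractModule τ (f (tmul k v (1 : S)))
        let ρr : ρ.range := ⟨ρ (ι r), _, rfl⟩
        have h1 : tmul k (r • v) (1 : S) = ρr • tmul k v (1 : S) := by
          change _ = ρ (ι r) • tmul k v (1 : S)
          rw [hι, smul_tmul, mul_one, hRV]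
        rw [h1, f.map_smul]
        change contractModule τ (ρ (ι r) • f (tmul k v (1 : S))) = _
        rw [hι, contractModule_smul, hRV] }
  refine ⟨_, LinearMap.isCompl_of_proj (f := g) fun w => Subtype.ext ?_⟩
  change contractModule τ (f (tmul k (w : V) (1 : S))) = w
  rw [hf _ (Submodule.subset_span ⟨w, w.2, rfl⟩)]
  change τ 1 • (w : V) = w
  rw [hτ1, one_smul]

end TensorModule

namespace CrossedSystem

open Coalgebra HopfAlgebra

variable {k : Type u} {H : Type v} {R : Type w} [Field k] [Ring H] [HopfAlgebra k H]
  [Ring R] [Algebra k R] (D : CrossedSystem k H R)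

/-! ### The commutative case -/

/-- `(r # g) ⊗ h = ∑ ρ(r # g₁)(1 ⊗ S(g₂)h)`, where `ρ` is the coaction. -/
theorem coaction_range_mul : Subalgebra.toSubmodule D.coaction.range *
    Subalgebra.toSubmodule (Algebra.TensorProduct.includeRight :
      H →ₐ[k] D.CrossedProduct ⊗[k] H).range = ⊤ := by
  refine eq_top_iff.2 fun z _ => ?_
  induction z with
  | zero => exact zero_mem _
  | add x y hx hy => exact add_mem (hx trivial) (hy trivial)
  | tmul a h =>
    induction a using induction_on with
    | zero =>
      rw [TensorProduct.zero_tmul]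
      exact zero_mem _
    | add x y hx hy =>
      rw [TensorProduct.add_tmul]
      exact add_mem (hx trivial) (hy trivial)
    | hash r g =>
      let P := ℛ k g
      let f : H →ₗ[k] H →ₗ[k] H →ₗ[k] D.CrossedProduct ⊗[k] H := LinearMap.mk₂ k
        (fun x y => TensorProduct.mk k D.CrossedProduct H (D.ofTensor (r ⊗ₜ x)) ∘ₗ
          LinearMap.mulRight k h ∘ₗ LinearMap.mulLeft k y ∘ₗ antipode k)
        (fun x x' y => by ext; simp [TensorProduct.tmul_add])
        (fun c x y => by ext; simp)
        (fun x y y' => by ext; simp [TensorProduct.tmul_add, add_mul])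
        (fun c x y => by ext; simp)
      have h1 : D.hash r g ⊗ₜ[k] h = ∑ i ∈ P.index, D.coaction (D.hash r (P.left i)) *
          ((1 : D.CrossedProduct) ⊗ₜ[k] (antipode k (P.right i) * h)) := by
        have h2 : ∀ i, D.coaction (D.hash r (P.left i)) *
            ((1 : D.CrossedProduct) ⊗ₜ[k] (antipode k (P.right i) * h)) =
            ∑ j ∈ (ℛ k (P.left i)).index, f ((ℛ k (P.left i)).left j)
              ((ℛ k (P.left i)).right j) (P.right i) := fun i => by
          rw [D.coaction_hash r (ℛ k (P.left i)), Finset.sum_mul]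
          refine Finset.sum_congr rfl fun j _ => ?_
          rw [Algebra.TensorProduct.tmul_mul_tmul, mul_one, ← mul_assoc]
          rfl
        have h3 : ∀ i, ∑ j ∈ (ℛ k (P.right i)).index, f (P.left i) ((ℛ k (P.right i)).left j)
            ((ℛ k (P.right i)).right j) =
            counit (R := k) (P.right i) • D.hash r (P.left i) ⊗ₜ[k] h := fun i => by
          change ∑ j ∈ (ℛ k (P.right i)).index, D.hash r (P.left i) ⊗ₜ[k]
            (((ℛ k (P.right i)).left j * antipode k ((ℛ k (P.right i)).right j)) * h) = _
          rw [← TensorProduct.tmul_sum, ← Finset.sum_mul, sum_mul_antipode_eq_algebraMap_counit,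
            ← Algebra.smul_def, TensorProduct.tmul_smul, TensorProduct.smul_tmul']
        rw [Finset.sum_congr rfl fun i _ => h2 i, P.sum_coassoc f,
          Finset.sum_congr rfl fun i _ => h3 i]
        conv_lhs => rw [← P.sum_counit_right_smul]
        simp only [hash, TensorProduct.tmul_sum, map_sum, TensorProduct.sum_tmul,
          TensorProduct.tmul_smul, map_smul, ← TensorProduct.smul_tmul']
      rw [h1]
      exact sum_mem fun i _ => Submodule.mul_mem_mul ⟨_, rfl⟩ ⟨_, rfl⟩

/-- `∑ x₀ γ⁻¹(x₁) = (id ⊗ ε)(x)`. -/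
theorem sum_mul_gammaInv (x : D.CrossedProduct) :
    LinearMap.mul' k _ (D.gammaInv.lTensor _ (D.coaction x)) =
      D.incl (D.contract counit x) := by
  induction x using induction_on with
  | zero => simp
  | add x y hx hy => simp only [map_add, hx, hy]
  | hash r h =>
    have h1 := congrArg (fun F : WithConv (H →ₗ[k] D.CrossedProduct) => F h) D.gamma_mul_gammaInv
    simp only [(ℛ k h).convMul_apply] at h1
    rw [D.coaction_hash r (ℛ k h), contract_hash]
    simp only [map_sum, LinearMap.lTensor_tmul, LinearMap.mul'_apply, ← incl_mul_gamma, mul_assoc]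
    rw [← Finset.mul_sum]
    refine (congrArg _ h1).trans ?_
    change _ * algebraMap k _ (counit h) = _
    rw [map_smul, Algebra.smul_def, Algebra.commutes]

/-- `∑ τ(x₁) x₀ = (id ⊗ τ)(x)` for an integral `τ`. -/
theorem sum_integral_smul {τ : H →ₗ[k] k}
    (hτ : ∀ x : H, _root_.TensorProduct.rid k H (τ.lTensor H (comul x)) = algebraMap k H (τ x))
    (x : D.CrossedProduct) :
    _root_.TensorProduct.rid k _ (τ.lTensor _ (D.coaction x)) = D.incl (D.contract τ x) := by
  induction x using induction_on with
  | zero => simp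
  | add x y hx hy => simp only [map_add, hx, hy]
  | hash r h =>
    have h1 := congrArg (fun y => D.hash r y) (hτ h)
    rw [← (ℛ k h).eq] at h1
    rw [D.coaction_hash r (ℛ k h), contract_hash]
    simp only [map_sum, LinearMap.lTensor_tmul, TensorProduct.rid_tmul, hash,
      TensorProduct.tmul_sum, TensorProduct.tmul_smul, map_smul, Algebra.algebraMap_eq_smul_one]
      at h1 ⊢
    exact h1

/-- If `J(A)` is a subcomodule, then `(id ⊗ ε)(x) = ∑ x₀γ⁻¹(x₁)` lies in `J(A) ∩ R` for `x ∈ J(A)`.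
Applying this to the first factors in `x = ∑ (id ⊗ ε)(x₀) # x₁` puts `x` in `(J(A) ∩ R) # H`. -/
theorem jacobsonRadical_le_of_coaction
    (hJ : ∀ x ∈ jacobsonRadical k D.CrossedProduct,
      D.coaction x ∈ subspaceTensor (jacobsonRadical k D.CrossedProduct) H) :
    jacobsonRadical k D.CrossedProduct ≤ D.subspaceCrossed D.hJacobson := by
  have h1 : ∀ x ∈ jacobsonRadical k D.CrossedProduct, D.contract counit x ∈ D.hJacobson :=
    fun x hx => by
      rw [mem_hJacobson, ← sum_mul_gammaInv]
      obtain ⟨z, hz⟩ := hJ x hx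
      rw [← hz]
      clear hz
      induction z with
      | zero => simp
      | add x y hx hy =>
        simp only [map_add]
        exact add_mem hx hy
      | tmul a h => exact Ideal.mul_mem_right _ _ a.2
  intro x hx
  obtain ⟨z, hz⟩ := hJ x hx
  rw [← D.sum_contract_counit x, ← hz]
  refine ⟨(LinearMap.restrict (D.contract counit) h1).rTensor H z, ?_⟩
  clear hz
  induction z with
  | zero =>
    simp only [map_zero]
    rfl
  | add x y hx hy =>
    simp only [map_add, hx, hy]
    rfl
  | tmul a h => rfl

theorem jacobsonRadical_le_hJacobson
    (h : ∀ m : Ideal D.CrossedProduct, m.IsMaximal →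
      ∀ r ∈ jacobsonRadical k R, ∀ x : D.CrossedProduct ⧸ m, D.incl r • x = 0) :
    jacobsonRadical k R ≤ D.hJacobson := fun r hr =>
  D.mem_hJacobson.2 (mem_jacobson_of_forall_smul_eq_zero fun m hm x => h m hm r hr x)

/-- The coaction makes `V ⊗ H` semisimple over `ρ(A)` for simple `V`. This yields both that `J(A)`
is a subcomodule and, after descent along `τ`, that `V` is semisimple over `R`. -/
theorem radicals_eq_of_commutative (hH : ∀ a b : H, a * b = b * a) [FiniteDimensional k H]
    (e : H ⊗[k] H) (he : LinearMap.mul' k H e = 1)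
    (hes : ∀ s : H, (s ⊗ₜ[k] (1 : H)) * e = (LinearMap.mulRight k s).lTensor H e)
    {τ : H →ₗ[k] k} (hτ1 : τ 1 = 1)
    (hτ : ∀ x : H, _root_.TensorProduct.rid k H (τ.lTensor H (comul x)) = algebraMap k H (τ x)) :
    jacobsonRadical k R = D.hJacobson ∧
      D.hJacobson = D.colon (jacobsonRadical k R) ∧
      jacobsonRadical k D.CrossedProduct = D.subspaceCrossed D.hJacobson := by
  refine D.radicals_eq_of_le hτ1 hτ (D.jacobsonRadical_le_hJacobson fun m hm r hr x => ?_)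
    (D.jacobsonRadical_le_of_coaction fun x hx =>
      map_jacobsonRadical_mem hH e he hes D.coaction D.coaction_range_mul hx)
  have : IsSimpleModule D.CrossedProduct (D.CrossedProduct ⧸ m) :=
    isSimpleModule_iff_isCoatom.2 (Ideal.isMaximal_def.1 hm)
  have := TensorModule.isSemisimpleModule_range (V := D.CrossedProduct ⧸ m) hH e he hes D.coaction
    D.coaction_range_mul
  let : Module R (D.CrossedProduct ⧸ m) := Module.compHom _ D.incl.toRingHom
  have := TensorModule.isSemisimpleModule_of_coaction (V := D.CrossedProduct ⧸ m)
    (fun _ _ => rfl) D.coaction_incl hτ1 (D.contract τ) (D.sum_integral_smul hτ)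
  exact smul_eq_zero_of_mem_jacobson hr x

end CrossedSystem

/-! ### Cocommutative Hopf algebras -/

/-- The function `c ↦ ε(c) b`. -/
def convConst (k C : Type*) {B : Type*} [Field k] [AddCommGroup C] [Module k C] [Coalgebra k C]
    [Ring B] [Algebra k B] (b : B) : WithConv (C →ₗ[k] B) :=
  toConv (LinearMap.toSpanSingleton k B b ∘ₗ Coalgebra.counit)

section Convolution

open Coalgebra

variable {k C B : Type*} [Field k] [AddCommGroup C] [Module k C] [Coalgebra k C]
  [Ring B] [Algebra k B]

theorem WithConv.mul_comm_of_forall_commute [Coalgebra.IsCocomm k C] {f g : WithConv (C →ₗ[k] B)}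
    (h : ∀ x y, Commute (f x) (g y)) : f * g = g * f := by
  apply WithConv.ext
  ext c
  let Q : Coalgebra.Repr k c _ := ⟨(ℛ k c).index, (ℛ k c).right, (ℛ k c).left, by
    have := congrArg (TensorProduct.comm k C C) (ℛ k c).eq
    rw [Coalgebra.comm_comul, map_sum] at this
    exact this⟩
  refine ((ℛ k c).convMul_apply f g).trans (Eq.trans ?_ (Q.convMul_apply g f).symm)
  exact Finset.sum_congr rfl fun i _ => h _ _

theorem convConst_apply (b : B) (c : C) : convConst k C b c = counit (R := k) c • b := rfl

theorem mul_convConst_apply (f : WithConv (C →ₗ[k] B)) (b : B) (c : C) :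
    (f * convConst k C b) c = f c * b := by
  refine ((ℛ k c).convMul_apply _ _).trans ?_
  conv_rhs => rw [← (ℛ k c).sum_counit_right_smul]
  simp [convConst_apply, Finset.sum_mul]

theorem convConst_mul_apply (b : B) (f : WithConv (C →ₗ[k] B)) (c : C) :
    (convConst k C b * f) c = b * f c := by
  refine ((ℛ k c).convMul_apply _ _).trans ?_
  conv_rhs => rw [← Coalgebra.sum_counit_smul (ℛ k c)]
  simp [convConst_apply, Finset.mul_sum]

variable (k C B) in
/-- The map `b ⊗ s ↦ (c ↦ s(c) b)`. -/
def tensorToConv : B ⊗[k] WithConv (C →ₗ[k] k) →ₐ[k] WithConv (C →ₗ[k] B) :=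
  Algebra.TensorProduct.algHomOfLinearMapTensorProduct
    (TensorProduct.lift (LinearMap.mk₂ k
      (fun b s => toConv (LinearMap.toSpanSingleton k B b ∘ₗ s.ofConv))
      (fun b b' s => WithConv.ext <| by ext; simp)
      (fun c b s => WithConv.ext <| LinearMap.ext fun x => smul_comm (s x) c b)
      (fun b s s' => WithConv.ext <| by ext; simp [add_smul])
      (fun c b s => WithConv.ext <| by ext; simp [mul_smul])))
    (fun b b' s s' => WithConv.ext <| by
      ext c
      refine Eq.trans ?_ ((ℛ k c).convMul_apply _ _).symm
      change (s * s') c • (b * b') = _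
      rw [(ℛ k c).convMul_apply, Finset.sum_smul]
      refine Finset.sum_congr rfl fun i _ => ?_
      change _ = (s _ • b) * (s' _ • b')
      rw [smul_mul_smul_comm])
    (WithConv.ext <| by
      ext c
      change counit (R := k) c • (1 : B) = algebraMap k B (counit (R := k) c)
      rw [Algebra.algebraMap_eq_smul_one])

theorem tensorToConv_tmul (b : B) (s : WithConv (C →ₗ[k] k)) (c : C) :
    tensorToConv k C B (b ⊗ₜ s) c = s c • b := rfl

theorem tensorToConv_bijective [FiniteDimensional k C] :
    Function.Bijective (tensorToConv k C B) := by
  let b := Module.finBasis k C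
  let g : WithConv (C →ₗ[k] B) → B ⊗[k] WithConv (C →ₗ[k] k) := fun f =>
    ∑ i, f (b i) ⊗ₜ toConv (b.coord i)
  refine Function.bijective_iff_has_inverse.2 ⟨g, fun z => ?_, fun f => ?_⟩
  · have hg : ∀ f f', g (f + f') = g f + g f' := fun f f' => by
      simp only [g, ← Finset.sum_add_distrib, ← TensorProduct.add_tmul]
      rfl
    induction z with
    | zero =>
      rw [map_zero]
      simp only [g]
      exact Finset.sum_eq_zero fun i _ => TensorProduct.zero_tmul _ _
    | add x y hx hy => rw [map_add, hg, hx, hy]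
    | tmul a s =>
      simp only [g, tensorToConv_tmul, TensorProduct.smul_tmul, ← TensorProduct.tmul_sum]
      congr 1
      apply WithConv.ext
      refine b.ext fun j => ?_
      simp only [WithConv.ofConv_sum, WithConv.ofConv_smul, LinearMap.sum_apply,
        LinearMap.smul_apply, Module.Basis.coord_apply, Module.Basis.repr_self]
      rw [Finset.sum_eq_single j (fun i _ hi => by simp [hi.symm])
        (by simp)]
      simp
  · apply WithConv.ext
    refine b.ext fun j => ?_
    simp only [g, map_sum, WithConv.ofConv_sum, LinearMap.sum_apply]
    refine (Finset.sum_eq_single j (fun i _ hi => ?_) (by simp)).trans ?_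
    · change b.coord i (b j) • f (b i) = 0
      simp [hi.symm]
    · change b.coord j (b j) • f (b j) = f (b j)
      simp

variable (k C B) in
/-- For a finite dimensional coalgebra `C`, the algebra `B ⊗ C*` is the convolution algebra of
functions from `C` to `B`. -/
def tensorEquivConv [FiniteDimensional k C] :
    B ⊗[k] WithConv (C →ₗ[k] k) ≃ₐ[k] WithConv (C →ₗ[k] B) :=
  AlgEquiv.ofBijective (tensorToConv k C B) tensorToConv_bijective

end Convolution

namespace CrossedSystem

open Coalgebra HopfAlgebra

variable {k : Type u} {H : Type v} {R : Type w} [Field k] [Ring H] [HopfAlgebra k H]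
  [Ring R] [Algebra k R] (D : CrossedSystem k H R)

/-- The map `r ↦ (h ↦ h · r)`. -/
def actConv : R →ₐ[k] WithConv (H →ₗ[k] R) :=
  AlgHom.ofLinearMap ((WithConv.linearEquiv k (H →ₗ[k] R)).symm.toLinearMap ∘ₗ D.act.flip)
    (WithConv.ext <| LinearMap.ext fun h => D.act_one h) D.act_mul

theorem actConv_apply (r : R) (h : H) : D.actConv r h = D.act h r := rfl

/-- In the convolution algebra `Hom(H, A)`, conjugation by `γ` turns the constant function `r` into
`h ↦ h · r`: the weak action becomes inner. -/
theorem gamma_mul_convConst (r : R) : toConv D.gamma * convConst k H (D.incl r) =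
    D.incl.convMap (D.actConv r) * toConv D.gamma := by
  apply WithConv.ext
  ext h
  refine (mul_convConst_apply _ _ h).trans ?_
  refine (D.gamma_mul_incl r (ℛ k h)).trans (Eq.trans ?_ ((ℛ k h).convMul_apply _ _).symm)
  exact Finset.sum_congr rfl fun i _ => (D.incl_mul_gamma _ _).symm

theorem convConst_mul_gammaInv (r : R) : convConst k H (D.incl r) * toConv D.gammaInv =
    toConv D.gammaInv * D.incl.convMap (D.actConv r) := by
  rw [← one_mul (convConst k H (D.incl r)), ← gammaInv_mul_gamma, mul_assoc (toConv D.gammaInv),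
    gamma_mul_convConst, mul_assoc, mul_assoc, gamma_mul_gammaInv, mul_one]

theorem antipode_mul_includeRight :
    toConv ((Algebra.TensorProduct.includeRight :
        H →ₐ[k] D.CrossedProduct ⊗[k] H).toLinearMap ∘ₗ antipode k) *
      toConv (Algebra.TensorProduct.includeRight :
        H →ₐ[k] D.CrossedProduct ⊗[k] H).toLinearMap = 1 := by
  have := congrArg (Algebra.TensorProduct.includeRight :
        H →ₐ[k] D.CrossedProduct ⊗[k] H).convMap (LinearMap.antipode_mul_id (R := k) (C := H))
  rw [map_mul, map_one] at this
  exact this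

/-- For cocommutative `H`, conjugation by `h ↦ 1 # h` preserves the functions with values
in `R`. -/
theorem exists_convMap_incl_eq [Coalgebra.IsCocomm k H] (F : WithConv (H →ₗ[k] R)) :
    ∃ G : WithConv (H →ₗ[k] R),
      D.incl.convMap G = toConv D.gammaInv * D.incl.convMap F * toConv D.gamma := by
  let j : D.CrossedProduct →ₐ[k] D.CrossedProduct ⊗[k] H := Algebra.TensorProduct.includeLeft
  let i₂ : H →ₐ[k] D.CrossedProduct ⊗[k] H := Algebra.TensorProduct.includeRight
  let G := toConv D.gammaInv * D.incl.convMap F * toConv D.gamma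
  have h1 : D.coaction.convMap (D.incl.convMap F) = j.convMap (D.incl.convMap F) := by
    apply WithConv.ext
    ext h
    exact D.coaction_incl _
  -- The coaction contributes `S(h₁)` from `γ⁻¹` and the last component of `h` from `γ`. By
  -- cocommutativity `S` can be moved past `G`, and the two cancel; so `G` has coinvariant values.
  have h2 : D.coaction.convMap G = j.convMap G := by
    have hc : toConv (i₂.toLinearMap ∘ₗ antipode k) * j.convMap G =
        j.convMap G * toConv (i₂.toLinearMap ∘ₗ antipode k) := by
      refine WithConv.mul_comm_of_forall_commute fun x y => ?_
      change ((1 : D.CrossedProduct) ⊗ₜ[k] _) * (_ ⊗ₜ[k] (1 : H)) =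
        (_ ⊗ₜ[k] (1 : H)) * ((1 : D.CrossedProduct) ⊗ₜ[k] _)
      simp
    calc D.coaction.convMap G
        = toConv (i₂.toLinearMap ∘ₗ antipode k) * j.convMap G * toConv i₂.toLinearMap := by
          simp only [G, map_mul, h1, convMap_coaction_gammaInv, convMap_coaction_gamma, mul_assoc,
            j, i₂]
      _ = j.convMap G := by
          rw [hc, mul_assoc]
          exact (congrArg _ D.antipode_mul_includeRight).trans (mul_one _)
  refine ⟨toConv (D.contract counit ∘ₗ G.ofConv), ?_⟩
  apply WithConv.ext
  ext h
  exact D.incl_contract_counit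
    (congrArg (fun F : WithConv (H →ₗ[k] D.CrossedProduct ⊗[k] H) => F h) h2)

theorem convMap_incl_injective : Function.Injective
    (D.incl.convMap : WithConv (H →ₗ[k] R) →+* WithConv (H →ₗ[k] D.CrossedProduct)) :=
  fun F G h => by
    apply WithConv.ext
    ext x
    exact D.incl_injective
      (congrArg (fun F : WithConv (H →ₗ[k] D.CrossedProduct) => F x) h)

/-- The weak action as a coaction of `H*`. -/
def dualCoaction [FiniteDimensional k H] : R →ₐ[k] R ⊗[k] WithConv (H →ₗ[k] k) :=
  (tensorEquivConv k H R).symm.toAlgHom.comp D.actConv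

theorem tensorToConv_dualCoaction [FiniteDimensional k H] (r : R) :
    tensorToConv k H R (D.dualCoaction r) = D.actConv r :=
  (tensorEquivConv k H R).apply_symm_apply (D.actConv r)

/-- Identify `R ⊗ H*` with `Hom(H, R)`. Scalar-valued functions commute with `γ` by cocommutativity,
so conjugation by `γ` sends `r ⊗ s` to `ρ(r)(1 ⊗ s)`, where `ρ` is the dual coaction. The span of
such products is everything because conjugation by `γ⁻¹` also preserves `R`-valued functions. -/
theorem dualCoaction_range_mul [FiniteDimensional k H] [Coalgebra.IsCocomm k H] :
    Subalgebra.toSubmodule D.dualCoaction.range *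
      Subalgebra.toSubmodule (Algebra.TensorProduct.includeRight :
        WithConv (H →ₗ[k] k) →ₐ[k] R ⊗[k] WithConv (H →ₗ[k] k)).range = ⊤ := by
  have h1 : ∀ z : R ⊗[k] WithConv (H →ₗ[k] k),
      ∃ y ∈ Subalgebra.toSubmodule D.dualCoaction.range *
        Subalgebra.toSubmodule (Algebra.TensorProduct.includeRight :
          WithConv (H →ₗ[k] k) →ₐ[k] R ⊗[k] WithConv (H →ₗ[k] k)).range,
        D.incl.convMap (tensorToConv k H R y) =
          toConv D.gamma * D.incl.convMap (tensorToConv k H R z) * toConv D.gammaInv := fun z => by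
    induction z with
    | zero => exact ⟨0, zero_mem _, by simp only [map_zero, mul_zero, zero_mul]⟩
    | add z z' hz hz' =>
      obtain ⟨y, hy, h⟩ := hz
      obtain ⟨y', hy', h'⟩ := hz'
      exact ⟨y + y', add_mem hy hy', by simp only [map_add, mul_add, add_mul, h, h']⟩
    | tmul r s =>
      refine ⟨D.dualCoaction r * (1 ⊗ₜ s), Submodule.mul_mem_mul ⟨_, rfl⟩ ⟨_, rfl⟩, ?_⟩
      have h2 : toConv D.gamma * D.incl.convMap (tensorToConv k H R (1 ⊗ₜ s)) =
          D.incl.convMap (tensorToConv k H R (1 ⊗ₜ s)) * toConv D.gamma :=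
        WithConv.mul_comm_of_forall_commute fun x y => by
          change _ * D.incl (s y • (1 : R)) = D.incl (s y • (1 : R)) * _
          simp
      have h3 : D.incl.convMap (tensorToConv k H R (r ⊗ₜ s)) =
          convConst k H (D.incl r) * D.incl.convMap (tensorToConv k H R (1 ⊗ₜ s)) := by
        apply WithConv.ext
        ext h
        refine Eq.trans ?_ (convConst_mul_apply _ _ h).symm
        change D.incl (s h • r) = D.incl r * D.incl (s h • (1 : R))
        simp
      have h4 : D.incl.convMap (tensorToConv k H R (1 ⊗ₜ s)) * toConv D.gammaInv =
          toConv D.gammaInv * D.incl.convMap (tensorToConv k H R (1 ⊗ₜ s)) :=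
        WithConv.mul_comm_of_forall_commute fun x y => by
          change D.incl (s x • (1 : R)) * _ = _ * D.incl (s x • (1 : R))
          simp
      rw [map_mul, map_mul, tensorToConv_dualCoaction, h3, mul_assoc, mul_assoc, h4,
        ← mul_assoc (convConst k H (D.incl r)), convConst_mul_gammaInv, ← mul_assoc, ← mul_assoc,
        gamma_mul_gammaInv, one_mul]
  refine eq_top_iff.2 fun y _ => ?_
  obtain ⟨G, hG⟩ := D.exists_convMap_incl_eq (tensorToConv k H R y)
  obtain ⟨z, rfl⟩ := tensorToConv_bijective.surjective G
  obtain ⟨y', hy', h⟩ := h1 z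
  have h5 : y' = y := tensorToConv_bijective.injective (D.convMap_incl_injective (by
    rw [h, hG, ← mul_assoc, ← mul_assoc, gamma_mul_gammaInv, one_mul, mul_assoc,
      gamma_mul_gammaInv, mul_one]))
  exact h5 ▸ hy'

end CrossedSystem

section Convolution

open Coalgebra

variable {k C C' B B' : Type*} [Field k] [Ring C] [Bialgebra k C] [Ring C'] [Bialgebra k C']
  [Ring B] [Algebra k B] [Ring B'] [Algebra k B']

theorem convSnd_mul_apply (f : C' →ₗ[k] B) (F : WithConv (C ⊗[k] C' →ₗ[k] B)) (c : C)
    {ι : Type*} {c' : C'} (Q : Coalgebra.Repr k c' ι) :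
    (convSnd C f * F) (c ⊗ₜ c') = ∑ j ∈ Q.index, f (Q.left j) * F (c ⊗ₜ Q.right j) := by
  let T : Coalgebra.Repr k (c ⊗ₜ[k] c') _ := (ℛ k c).tmul Q
  rw [T.convMul_apply]
  simp only [T, Coalgebra.Repr.tmul, Finset.sum_product]
  rw [Finset.sum_comm]
  refine Finset.sum_congr rfl fun j _ => ?_
  conv_rhs => rw [← Coalgebra.sum_counit_smul (ℛ k c)]
  simp [TensorProduct.sum_tmul, Finset.mul_sum, ← TensorProduct.smul_tmul']

theorem AlgHom.convMap_convConst (φ : B →ₐ[k] B') (b : B) :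
    φ.convMap (convConst k C b) = convConst k C (φ b) := by
  apply WithConv.ext
  ext c
  exact map_smul φ _ _

theorem convFst_convConst (b : B) :
    convFst C' (convConst k C b).ofConv = convConst k (C ⊗[k] C') b := by
  apply WithConv.ext
  ext c c'
  change counit (R := k) (counit (R := k) c' • c) • b = counit (R := k) (c ⊗ₜ[k] c') • b
  simp

theorem convFst_one : convFst C' (1 : WithConv (C →ₗ[k] B)).ofConv = 1 := by
  apply WithConv.ext
  ext c c'
  refine (convFst_tmul (1 : WithConv (C →ₗ[k] B)).ofConv c c').trans ?_
  change counit (R := k) c' • algebraMap k B (counit (R := k) c) =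
    algebraMap k B (counit (R := k) (c ⊗ₜ[k] c'))
  simp [Algebra.smul_def]

end Convolution

theorem TensorModule.map_smul_tmul {k A S V M : Type*} [Field k] [Ring A]
    [Algebra k A] [Ring S] [Algebra k S] [AddCommGroup V] [Module k V] [Module A V]
    [IsScalarTower k A V] [AddCommGroup M] [Module k M] (Φ : TensorModule k S V →ₗ[k] M)
    (Ψ : A ⊗[k] S →ₗ[k] M) (v : V) (s : S)
    (h : ∀ a s', Φ (TensorModule.tmul k (a • v) (s' * s)) = Ψ (a ⊗ₜ s')) (y : A ⊗[k] S) :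
    Φ (y • TensorModule.tmul k v s) = Ψ y := by
  induction y with
  | zero => rw [zero_smul, map_zero, map_zero]
  | add y y' hy hy' => rw [add_smul, map_add, map_add, hy, hy']
  | tmul a s' => rw [TensorModule.smul_tmul, h]

/-- A quotient of `V ⊗ S` on which `a` acts through `ρ(a)` is semisimple over `A` if `V ⊗ S` is
semisimple over `ρ(A)`. -/
theorem TensorModule.isSemisimpleModule_of_surjective {k A S V X : Type*} [Field k] [Ring A]
    [Algebra k A] [Ring S] [Algebra k S] [AddCommGroup V] [Module k V] [Module A V]
    [IsScalarTower k A V] [AddCommGroup X] [Module A X] (ρ : A →ₐ[k] A ⊗[k] S)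
    (Φ : TensorModule k S V →+ X) (hΦ : ∀ a z, Φ (ρ a • z) = a • Φ z)
    (hs : Function.Surjective Φ) [h : IsSemisimpleModule ρ.range (TensorModule k S V)] :
    IsSemisimpleModule A X := by
  let σ : A →+* ρ.range := ρ.rangeRestrict.toRingHom
  let : Module A (TensorModule k S V) := Module.compHom _ σ
  have : RingHomSurjective σ := ⟨ρ.rangeRestrict_surjective⟩
  let i : TensorModule k S V →ₛₗ[σ] TensorModule k S V :=
    { AddMonoidHom.id _ with map_smul' := fun _ _ => rfl }
  have := (i.isSemisimpleModule_iff_of_bijective Function.bijective_id).2 h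
  exact IsSemisimpleModule.of_surjective { Φ with map_smul' := hΦ } hs

namespace CrossedSystem

open Coalgebra HopfAlgebra

variable {k : Type u} {H : Type v} {R : Type w} [Field k] [Ring H] [HopfAlgebra k H]
  [Ring R] [Algebra k R] (D : CrossedSystem k H R)

/-! ### Maschke's theorem for crossed products -/

section Maschke

variable {D} {X : Type*} [AddCommGroup X] [Module k X] [Module D.CrossedProduct X]
  [IsScalarTower k D.CrossedProduct X]

variable (D X) in
/-- The action of the crossed product on a module. -/
def action : D.CrossedProduct →ₐ[k] Module.End k X := Algebra.lsmul k k X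

/-- The function `h ↦ ∑ γ⁻¹(h₁) f γ(h₂)` with values in the endomorphisms of `X`. -/
def average (f : Module.End k X) : WithConv (H →ₗ[k] Module.End k X) :=
  (D.action X).convMap (toConv D.gammaInv) * convConst k H f *
    (D.action X).convMap (toConv D.gamma)

theorem average_apply (f : Module.End k X) {ι : Type*} {h : H} (P : Coalgebra.Repr k h ι) (v : X) :
    average (D := D) f h v =
      ∑ i ∈ P.index, D.gammaInv (P.left i) • f (D.gamma (P.right i) • v) := by
  rw [average, P.convMul_apply, LinearMap.sum_apply]
  refine Finset.sum_congr rfl fun i _ => ?_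
  rw [mul_convConst_apply]
  rfl

/-- Passing through `γ`, the constant `r` becomes `h ↦ h · r`, which commutes with `f` pointwise;
passing through `γ⁻¹` turns it back into `r`. -/
theorem average_commute_incl {f : Module.End k X}
    (hf : ∀ r, Commute f (D.action X (D.incl r))) (h : H) (r : R) :
    Commute (average (D := D) f h) (D.action X (D.incl r)) := by
  have h1 := congrArg (D.action X).convMap (D.gamma_mul_convConst r)
  have h2 := congrArg (D.action X).convMap (D.convConst_mul_gammaInv r)
  rw [map_mul, map_mul, AlgHom.convMap_convConst] at h1 h2
  have h3 : convConst k H f * (D.action X).convMap (D.incl.convMap (D.actConv r)) =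
      (D.action X).convMap (D.incl.convMap (D.actConv r)) * convConst k H f := by
    apply WithConv.ext
    ext1 x
    exact (convConst_mul_apply _ _ x).trans ((hf _).eq.trans
      (mul_convConst_apply ((D.action X).convMap (D.incl.convMap (D.actConv r))) f x).symm)
  have h4 : average (D := D) f * convConst k H (D.action X (D.incl r)) =
      convConst k H (D.action X (D.incl r)) * average (D := D) f := by
    rw [average, mul_assoc, h1, mul_assoc, ← mul_assoc (convConst k H f), h3, ← mul_assoc,
      ← mul_assoc, ← mul_assoc, ← h2, ← mul_assoc]
  have h5 := congrArg (fun F : WithConv (H →ₗ[k] Module.End k X) => F h) h4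
  exact (mul_convConst_apply _ _ h).symm.trans (h5.trans (convConst_mul_apply _ _ h))

/-- In Sweedler notation, with `F` the average of `f`, this is `F(h)γ(g) = ∑ γ(g₁)F(hg₂)`. Replace
`γ(h)γ(g)` by `σ` times `γ(hg)`, move `σ` past `f`, and use `γ⁻¹(h)σ(h, g) = γ(g)γ⁻¹(hg)` in the
convolution sense (`h4`). -/
theorem convFst_average_mul {f : Module.End k X}
    (hf : ∀ r, Commute f (D.action X (D.incl r))) :
    convFst H (average (D := D) f).ofConv *
        convSnd H ((D.action X).convMap (toConv D.gamma)).ofConv =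
      convSnd H ((D.action X).convMap (toConv D.gamma)).ofConv *
        toConv ((average (D := D) f).ofConv ∘ₗ LinearMap.mul' k H) := by
  let μ := Bialgebra.mulCoalgHom k H
  let g := (D.action X).convMap (toConv D.gamma)
  let g' := (D.action X).convMap (toConv D.gammaInv)
  let s := (D.action X).convMap D.sigmaIncl.val
  let c := convConst k (H ⊗[k] H) f
  let gm : WithConv (H ⊗[k] H →ₗ[k] Module.End k X) := toConv (g.ofConv ∘ₗ μ.toLinearMap)
  let gm' : WithConv (H ⊗[k] H →ₗ[k] Module.End k X) := toConv (g'.ofConv ∘ₗ μ.toLinearMap)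
  have hg : g' * g = 1 := by
    rw [← map_mul, gammaInv_mul_gamma, map_one]
  have hg' : g * g' = 1 := by
    rw [← map_mul, gamma_mul_gammaInv, map_one]
  have h1 : convFst H g.ofConv * convSnd H g.ofConv = s * gm := by
    have := congrArg (D.action X).convMap D.gamma_mul_gamma
    rw [map_mul, map_mul] at this
    exact this
  have h2 : gm * gm' = 1 := by
    have := conv_comp g g' μ
    rw [hg'] at this
    rw [← this]
    apply WithConv.ext
    refine LinearMap.ext fun x => ?_
    change algebraMap k _ (counit (μ x)) = algebraMap k _ (counit x)
    rw [CoalgHomClass.counit_comp_apply]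
  have h3 : convFst H g'.ofConv * convFst H g.ofConv = 1 := by
    rw [← convFst_mul, hg, convFst_one]
  have h4 : convFst H g'.ofConv * s = convSnd H g.ofConv * gm' := by
    rw [← mul_one (convFst H g'.ofConv * s), ← h2, ← mul_assoc, mul_assoc _ s, ← h1, ← mul_assoc,
      h3, one_mul]
  have h5 : c * s = s * c := by
    apply WithConv.ext
    refine LinearMap.ext fun x => ?_
    exact (convConst_mul_apply _ _ x).trans ((hf _).eq.trans (mul_convConst_apply s f x).symm)
  have h6 : toConv ((average (D := D) f).ofConv ∘ₗ μ.toLinearMap) = gm' * c * gm := by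
    rw [average, conv_comp, conv_comp]
    congr 2
    apply WithConv.ext
    refine LinearMap.ext fun x => ?_
    change counit (R := k) (μ x) • f = counit (R := k) x • f
    rw [CoalgHomClass.counit_comp_apply]
  change _ = convSnd H g.ofConv * toConv ((average (D := D) f).ofConv ∘ₗ μ.toLinearMap)
  rw [h6, average, convFst_mul, convFst_mul, convFst_convConst]
  change convFst H g'.ofConv * c * convFst H g.ofConv * convSnd H g.ofConv = _
  rw [mul_assoc, h1, mul_assoc, ← mul_assoc c, h5, ← mul_assoc, ← mul_assoc, h4, mul_assoc,
    mul_assoc, mul_assoc]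

/-- At a right integral, `t g₂ = ε(g₂) t` collapses `∑ γ(g₁)F(tg₂)` to `γ(g)F(t)`, where `F` is the
average of `f`. -/
theorem average_commute {f : Module.End k X} (hf : ∀ r, Commute f (D.action X (D.incl r)))
    {t : H} (ht : ∀ h, t * h = counit (R := k) h • t) (a : D.CrossedProduct) :
    Commute (average (D := D) f t) (D.action X a) := by
  have hγ : ∀ h, Commute (average (D := D) f t) (D.action X (D.gamma h)) := fun h => by
    have h1 := congrArg (fun F : WithConv (H ⊗[k] H →ₗ[k] Module.End k X) => F (t ⊗ₜ h))
      (convFst_average_mul hf)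
    rw [convFst_mul_convSnd] at h1
    refine Eq.trans h1 ((convSnd_mul_apply _ _ t (ℛ k h)).trans ?_)
    conv_rhs => rw [← (ℛ k h).sum_counit_right_smul]
    simp only [map_sum, Finset.sum_mul]
    refine Finset.sum_congr rfl fun i _ => ?_
    change D.action X (D.gamma _) * (average (D := D) f) (t * _) = _
    rw [ht]
    simp only [map_smul, smul_mul_assoc, mul_smul_comm]
  induction a using induction_on with
  | zero =>
    rw [map_zero]
    exact Commute.zero_right _
  | add x y hx hy =>
    rw [map_add]
    exact hx.add_right hy
  | hash r h =>
    rw [← incl_mul_gamma, map_mul]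
    exact (average_commute_incl hf t r).mul_right (hγ h)

/-- A module over the crossed product which is semisimple over `R` is semisimple. -/
theorem isSemisimpleModule_of_restrict [Module R X] (hRX : ∀ (r : R) (v : X), r • v = D.incl r • v)
    {t : H} (ht1 : counit (R := k) t = 1) (ht : ∀ h, t * h = counit (R := k) h • t)
    [IsSemisimpleModule R X] : IsSemisimpleModule D.CrossedProduct X := by
  have : IsScalarTower k R X := ⟨fun c r v => by
    rw [hRX, hRX, map_smul, smul_assoc]⟩
  refine IsSemisimpleModule.of_average (B := R) (fun r => ⟨D.incl r, hRX r⟩) (ℛ k t).index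
    (fun i => D.gammaInv ((ℛ k t).left i)) (fun i => D.gamma ((ℛ k t).right i)) (fun v => ?_)
    fun f a v => ?_
  · have h1 := congrArg (fun F : WithConv (H →ₗ[k] D.CrossedProduct) => F t) D.gammaInv_mul_gamma
    simp only [(ℛ k t).convMul_apply] at h1
    simp only [smul_smul]
    rw [← Finset.sum_smul]
    refine (congrArg (· • v) h1).trans ?_
    change algebraMap k D.CrossedProduct (counit t) • v = v
    rw [ht1, map_one, one_smul]
  · let f' : Module.End k X := f.restrictScalars k
    have hf : ∀ r, Commute f' (D.action X (D.incl r)) := fun r => by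
      ext v
      change f (D.incl r • v) = D.incl r • f v
      rw [← hRX, map_smul, hRX]
    have h1 := LinearMap.congr_fun (average_commute hf ht a).eq v
    have h2 := average_apply (D := D) f' (ℛ k t)
    refine (h2 (a • v)).symm.trans (Eq.trans h1 ?_)
    exact congrArg (a • ·) (h2 v)

end Maschke

/-! ### Coinduced modules -/

section Coind

variable (Q : Type*) [AddCommGroup Q] [Module k Q] [Module R Q] [IsScalarTower k R Q]

/-- The `R`-linear maps from the crossed product to `Q`. -/
def coindSubmodule : Submodule k (D.CrossedProduct →ₗ[k] Q) where
  carrier := {f | ∀ (r : R) (b : D.CrossedProduct), f (D.incl r * b) = r • f b}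
  zero_mem' _ _ := (smul_zero _).symm
  add_mem' hf hg r b := by
    rw [LinearMap.add_apply, hf, hg, ← smul_add]
    rfl
  smul_mem' c f hf r b := by
    rw [LinearMap.smul_apply, hf, smul_comm]
    rfl

/-- The coinduced module of an `R`-module `Q`. -/
def Coind : Type _ := D.coindSubmodule Q

namespace Coind

variable {D Q}

instance : AddCommGroup (D.Coind Q) := inferInstanceAs (AddCommGroup (D.coindSubmodule Q))

instance : Module k (D.Coind Q) := inferInstanceAs (Module k (D.coindSubmodule Q))

instance : FunLike (D.Coind Q) D.CrossedProduct Q where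
  coe f := f.1
  coe_injective _ _ h := Subtype.ext (DFunLike.coe_injective h)

theorem map_incl_mul (f : D.Coind Q) (r : R) (b : D.CrossedProduct) :
    f (D.incl r * b) = r • f b := f.2 r b

@[simp] theorem add_apply (f g : D.Coind Q) (b : D.CrossedProduct) : (f + g) b = f b + g b := rfl

theorem scalar_smul_apply (c : k) (f : D.Coind Q) (b : D.CrossedProduct) :
    (c • f) b = c • f b := rfl

@[simp] theorem zero_apply (b : D.CrossedProduct) : (0 : D.Coind Q) b = 0 := rfl

instance : AddMonoidHomClass (D.Coind Q) D.CrossedProduct Q where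
  map_add f := map_add f.1
  map_zero f := map_zero f.1

theorem ext_gamma {f g : D.Coind Q} (h : ∀ x, f (D.gamma x) = g (D.gamma x)) : f = g := by
  refine DFunLike.ext _ _ fun b => ?_
  induction b using induction_on with
  | zero => rw [map_zero, map_zero]
  | add x y hx hy => rw [map_add, map_add, hx, hy]
  | hash r x => rw [← incl_mul_gamma, map_incl_mul, map_incl_mul, h]

/-- `(a f)(b) = f(ba)`. -/
instance : SMul D.CrossedProduct (D.Coind Q) where
  smul a f := ⟨f.1 ∘ₗ LinearMap.mulRight k a, fun r b => by
    change f.1 (D.incl r * b * a) = r • f.1 (b * a)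
    rw [mul_assoc]
    exact f.2 r _⟩

theorem smul_apply (a : D.CrossedProduct) (f : D.Coind Q) (b : D.CrossedProduct) :
    (a • f) b = f (b * a) := rfl

instance : Module D.CrossedProduct (D.Coind Q) where
  one_smul f := DFunLike.ext _ _ fun b => by rw [smul_apply, mul_one]
  mul_smul a a' f := DFunLike.ext _ _ fun b => by
    rw [smul_apply, smul_apply, smul_apply, mul_assoc]
  smul_zero a := rfl
  smul_add a f g := rfl
  add_smul a a' f := DFunLike.ext _ _ fun b => by
    rw [add_apply, smul_apply, smul_apply, smul_apply, mul_add, map_add]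
  zero_smul f := DFunLike.ext _ _ fun b => by rw [smul_apply, mul_zero, map_zero, zero_apply]

instance : IsScalarTower k D.CrossedProduct (D.Coind Q) where
  smul_assoc c a f := DFunLike.ext _ _ fun b => by
    rw [smul_apply, mul_smul_comm]
    exact map_smul f.1 c _

instance : Module R (D.Coind Q) := Module.compHom _ D.incl.toRingHom

theorem incl_smul (r : R) (f : D.Coind Q) : r • f = D.incl r • f := rfl

/-- The function `x ↦ (id ⊗ s)(x) q`. -/
def ofContract (q : Q) (s : H →ₗ[k] k) : D.Coind Q :=
  ⟨(LinearMap.toSpanSingleton R Q q).restrictScalars k ∘ₗ D.contract s, fun r b => by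
    change D.contract s (D.incl r * b) • q = r • D.contract s b • q
    rw [contract_incl_mul, mul_smul]⟩

theorem ofContract_apply (q : Q) (s : H →ₗ[k] k) (x : D.CrossedProduct) :
    ofContract q s x = D.contract s x • q := rfl

variable (D Q) in
/-- The map from `Q ⊗ H*` to the coinduced module. -/
def ofTensorDual : TensorModule k (WithConv (H →ₗ[k] k)) Q →ₗ[k] D.Coind Q :=
  TensorProduct.lift (LinearMap.mk₂ k (fun q s => ofContract q s.ofConv)
    (fun q q' s => ext_gamma fun x => by
      simp only [add_apply, ofContract_apply, smul_add])
    (fun c q s => ext_gamma fun x => smul_comm _ c q)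
    (fun q s s' => ext_gamma fun x => by
      simp only [add_apply, ofContract_apply, contract_gamma, WithConv.ofConv_add,
        LinearMap.add_apply, add_smul])
    (fun c q s => ext_gamma fun x => by
      simp only [scalar_smul_apply, ofContract_apply, contract_gamma, WithConv.ofConv_smul,
        LinearMap.smul_apply, smul_assoc]))

theorem ofTensorDual_tmul_gamma (q : Q) (s : WithConv (H →ₗ[k] k)) (h : H) :
    ofTensorDual D Q (TensorModule.tmul k q s) (D.gamma h) = s h • q := by
  change (s h • (1 : R)) • q = _
  rw [smul_assoc, one_smul]

theorem ofTensorDual_smul_gamma (y : R ⊗[k] WithConv (H →ₗ[k] k)) (q : Q)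
    (s : WithConv (H →ₗ[k] k)) {ι : Type*} {h : H} (P : Coalgebra.Repr k h ι) :
    ofTensorDual D Q (y • TensorModule.tmul k q s) (D.gamma h) =
      ∑ i ∈ P.index, tensorToConv k H R y (P.left i) • s (P.right i) • q := by
  let ev : D.Coind Q →ₗ[k] Q :=
    { toFun := fun f => f (D.gamma h), map_add' := fun _ _ => rfl, map_smul' := fun _ _ => rfl }
  let Ψ : WithConv (H →ₗ[k] R) →ₗ[k] Q :=
    { toFun := fun F => ∑ i ∈ P.index, F (P.left i) • s (P.right i) • q
      map_add' := fun F G => by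
        rw [← Finset.sum_add_distrib]
        exact Finset.sum_congr rfl fun i _ => add_smul _ _ _
      map_smul' := fun c F => by
        rw [Finset.smul_sum]
        exact Finset.sum_congr rfl fun i _ => smul_assoc c _ _ }
  refine TensorModule.map_smul_tmul (ev ∘ₗ ofTensorDual D Q)
    (Ψ ∘ₗ (tensorToConv k H R).toLinearMap) q s (fun r s' => ?_) y
  refine (ofTensorDual_tmul_gamma (r • q) (s' * s) h).trans ?_
  rw [P.convMul_apply, Finset.sum_smul]
  refine Finset.sum_congr rfl fun i _ => ?_
  change _ = (s' (P.left i) • r) • s (P.right i) • q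
  rw [smul_assoc, smul_comm r, smul_smul]

/-- `R` acts on the coinduced module by right multiplication in the argument, and `γ(h) r = ∑ (h₁ ·
r) γ(h₂)` shows that on `Q ⊗ H*` this is the action through the dual coaction. -/
theorem ofTensorDual_dualCoaction_smul [FiniteDimensional k H] (r : R)
    (z : TensorModule k (WithConv (H →ₗ[k] k)) Q) :
    ofTensorDual D Q (D.dualCoaction r • z) = r • ofTensorDual D Q z := by
  induction z using TensorModule.induction_on with
  | zero => rw [smul_zero, map_zero, smul_zero]
  | add x y hx hy => rw [smul_add, map_add, map_add, smul_add, hx, hy]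
  | tmul q s =>
    refine ext_gamma fun h => ?_
    rw [ofTensorDual_smul_gamma _ _ _ (ℛ k h), tensorToConv_dualCoaction, incl_smul, smul_apply,
      D.gamma_mul_incl r (ℛ k h), map_sum]
    refine Finset.sum_congr rfl fun i _ => ?_
    rw [← incl_mul_gamma, map_incl_mul, ofTensorDual_tmul_gamma, actConv_apply]

theorem ofTensorDual_surjective [FiniteDimensional k H] :
    Function.Surjective (ofTensorDual D Q) := fun f => by
  let b := Module.finBasis k H
  -- An element of the coinduced module is determined by its values on the `1 # b i`, which a dual
  -- basis of `H*` realizes.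
  refine ⟨∑ i, TensorModule.tmul k (f (D.gamma (b i))) (toConv (b.coord i)), ext_gamma fun h => ?_⟩
  have h1 : f (D.gamma h) = ∑ i, b.repr h i • f (D.gamma (b i)) := by
    conv_lhs => rw [← b.sum_repr h, map_sum, map_sum]
    refine Finset.sum_congr rfl fun i _ => ?_
    rw [map_smul]
    exact map_smul f.1 _ _
  have h2 : ∀ (ι : Type) (σ : Finset ι) (F : ι → D.Coind Q) (x : D.CrossedProduct),
      (∑ i ∈ σ, F i) x = ∑ i ∈ σ, F i x := fun ι σ F x => by
    classical
    induction σ using Finset.induction_on with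
    | empty => simp
    | insert a σ ha ih => rw [Finset.sum_insert ha, Finset.sum_insert ha, add_apply, ih]
  rw [h1, map_sum, h2]
  exact Finset.sum_congr rfl fun i _ => ofTensorDual_tmul_gamma _ _ _

/-- The coinduced module of a semisimple `R`-module is semisimple over `R` for cocommutative
cosemisimple `H`. -/
theorem isSemisimpleModule [FiniteDimensional k H] [Coalgebra.IsCocomm k H]
    (e : WithConv (H →ₗ[k] k) ⊗[k] WithConv (H →ₗ[k] k)) (he : LinearMap.mul' k _ e = 1)
    (hes : ∀ s : WithConv (H →ₗ[k] k),
      (s ⊗ₜ[k] (1 : WithConv (H →ₗ[k] k))) * e = (LinearMap.mulRight k s).lTensor _ e)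
    [IsSemisimpleModule R Q] : IsSemisimpleModule R (D.Coind Q) := by
  have : FiniteDimensional k (WithConv (H →ₗ[k] k)) :=
    (WithConv.linearEquiv k (H →ₗ[k] k)).symm.finiteDimensional
  have h1 := TensorModule.isSemisimpleModule_range (V := Q) mul_comm e he hes D.dualCoaction
    D.dualCoaction_range_mul
  exact TensorModule.isSemisimpleModule_of_surjective D.dualCoaction
    (ofTensorDual D Q).toAddMonoidHom ofTensorDual_dualCoaction_smul ofTensorDual_surjective

end Coind

end Coind

end CrossedSystem

/-! ### Comparison of radicals in the cocommutative case -/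

namespace CrossedSystem

open Coalgebra HopfAlgebra

variable {k : Type u} {H : Type v} {R : Type w} [Field k] [Ring H] [HopfAlgebra k H]
  [Ring R] [Algebra k R] (D : CrossedSystem k H R)

/-- A cyclic module over the crossed product is finitely generated over `R`. -/
theorem module_finite [FiniteDimensional k H] {V : Type*} [AddCommGroup V]
    [Module D.CrossedProduct V] [IsSimpleModule D.CrossedProduct V] [Module R V]
    (hRV : ∀ (r : R) (v : V), r • v = D.incl r • v) : Module.Finite R V := by
  have := IsSimpleModule.nontrivial D.CrossedProduct V
  obtain ⟨v₀, hv₀⟩ := exists_ne (0 : V)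
  let b := Module.finBasis k H
  refine Module.Finite.of_surjective (Fintype.linearCombination R fun i => D.gamma (b i) • v₀)
    fun v => ?_
  obtain ⟨a, rfl⟩ := IsSimpleModule.toSpanSingleton_surjective D.CrossedProduct hv₀ v
  rw [← LinearMap.mem_range, LinearMap.toSpanSingleton_apply]
  induction a using induction_on with
  | zero =>
    rw [zero_smul]
    exact zero_mem _
  | add x y hx hy =>
    rw [add_smul]
    exact add_mem hx hy
  | hash r h =>
    rw [← incl_mul_gamma, mul_smul, ← hRV, ← b.sum_repr h, map_sum, Finset.sum_smul]
    refine Submodule.smul_mem _ r (sum_mem fun i _ => ?_)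
    rw [map_smul, Algebra.smul_def, mul_smul, ← AlgHom.commutes D.incl, ← hRV]
    refine Submodule.smul_mem _ _ ⟨Pi.single i 1, ?_⟩
    rw [Fintype.linearCombination_apply_single, one_smul]

/-- If coinduced modules of simple modules are semisimple over `R`, then the Jacobson radical of
`R` annihilates the simple modules over the crossed product. -/
theorem incl_smul_eq_zero_of_coind [FiniteDimensional k H] {V : Type*} [AddCommGroup V]
    [Module k V] [Module D.CrossedProduct V] [IsScalarTower k D.CrossedProduct V]
    [IsSimpleModule D.CrossedProduct V] [Module R V] [IsScalarTower k R V]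
    (hRV : ∀ (r : R) (v : V), r • v = D.incl r • v)
    (hs : ∀ N : Submodule R V, IsCoatom N → IsSemisimpleModule R (D.Coind (V ⧸ N)))
    {r : R} (hr : r ∈ Ring.jacobson R) (v : V) : D.incl r • v = 0 := by
  have := IsSimpleModule.nontrivial D.CrossedProduct V
  have := D.module_finite hRV
  obtain ⟨N, hN⟩ := IsCoatomic.exists_coatom (Submodule R V)
  have := hs N hN
  -- This is the image of `v` under `V → Hom_R(A, V ⧸ N)`, `v ↦ (a ↦ av + N)`.
  let f : D.Coind (V ⧸ N) :=
    ⟨N.mkQ.restrictScalars k ∘ₗ (LinearMap.toSpanSingleton D.CrossedProduct V v).restrictScalars k,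
      fun r b => by
        change N.mkQ ((D.incl r * b) • v) = r • N.mkQ (b • v)
        rw [mul_smul, ← hRV, map_smul]⟩
  -- The kernel of that map is the largest `A`-submodule inside the proper submodule `N`, so it is
  -- `0`.
  let K : Submodule D.CrossedProduct V :=
    { carrier := {v | ∀ a : D.CrossedProduct, a • v ∈ N}
      zero_mem' := fun a => by
        rw [smul_zero]
        exact N.zero_mem
      add_mem' := fun hv hw a => by
        rw [smul_add]
        exact N.add_mem (hv a) (hw a)
      smul_mem' := fun b v hv a => by
        rw [smul_smul]
        exact hv _ }
  have hK : K = ⊥ := (eq_bot_or_eq_top K).resolve_right fun h => hN.1 (eq_top_iff.2 fun w _ => by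
    have : w ∈ K := h ▸ Submodule.mem_top
    simpa using this 1)
  have hv : D.incl r • v ∈ K := fun a => by
    have h1 : (r • f) a = 0 := by
      rw [smul_eq_zero_of_mem_jacobson hr f, Coind.zero_apply]
    rw [smul_smul, ← Submodule.Quotient.mk_eq_zero]
    exact h1
  rwa [hK, Submodule.mem_bot] at hv

theorem mem_subspaceCrossed [FiniteDimensional k H] {I : Submodule k R} {x : D.CrossedProduct}
    (hx : ∀ f : H →ₗ[k] k, D.contract f x ∈ I) : x ∈ D.subspaceCrossed I := by
  let b := Module.finBasis k H
  have h1 : ∀ x, x = ∑ i, D.hash (D.contract (b.coord i) x) (b i) := fun x => by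
    induction x using induction_on with
    | zero => simp [hash]
    | add x y hx hy =>
      conv_lhs => rw [hx, hy]
      simp only [hash, map_add, TensorProduct.add_tmul, Finset.sum_add_distrib]
    | hash r h =>
      conv_lhs => rw [← b.sum_repr h]
      simp only [contract_hash, Module.Basis.coord_apply]
      simp only [hash, TensorProduct.tmul_sum, map_sum, TensorProduct.smul_tmul]
  rw [h1 x]
  exact sum_mem fun i _ => ⟨⟨_, hx (b.coord i)⟩ ⊗ₜ b i, rfl⟩

/-- Coinduction is used twice: from `V ⧸ N` to bound `J(R)`, and from `R ⧸ m` to bound `J(A)`. Only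
the second needs the integral `t`, to pass from semisimplicity over `R` to semisimplicity over `A`.
-/
theorem radicals_eq_of_cocommutative [FiniteDimensional k H] [Coalgebra.IsCocomm k H]
    {t : H} (ht1 : counit (R := k) t = 1) (ht : ∀ h, t * h = counit (R := k) h • t)
    {τ : H →ₗ[k] k} (hτ1 : τ 1 = 1)
    (hτ : ∀ x : H, _root_.TensorProduct.rid k H (τ.lTensor H (comul x)) = algebraMap k H (τ x)) :
    jacobsonRadical k R = D.hJacobson ∧
      D.hJacobson = D.colon (jacobsonRadical k R) ∧
      jacobsonRadical k D.CrossedProduct = D.subspaceCrossed D.hJacobson := by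
  obtain ⟨e, he, hes⟩ := exists_separability_dual hτ1 hτ
  have hR : jacobsonRadical k R ≤ D.hJacobson :=
    D.jacobsonRadical_le_hJacobson fun m hm r hr x => by
      have : IsSimpleModule D.CrossedProduct (D.CrossedProduct ⧸ m) :=
        isSimpleModule_iff_isCoatom.2 (Ideal.isMaximal_def.1 hm)
      let : Module R (D.CrossedProduct ⧸ m) := Module.compHom _ D.incl.toRingHom
      have : IsScalarTower k R (D.CrossedProduct ⧸ m) :=
        ⟨fun c r v => by
          change D.incl (c • r) • v = c • D.incl r • v
          rw [map_smul, smul_assoc]⟩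
      refine D.incl_smul_eq_zero_of_coind (fun _ _ => rfl) (fun N hN => ?_) hr x
      have : IsSimpleModule R ((D.CrossedProduct ⧸ m) ⧸ N) := isSimpleModule_iff_isCoatom.2 hN
      exact Coind.isSemisimpleModule e he hes
  refine D.radicals_eq_of_le hτ1 hτ hR fun x hx => D.mem_subspaceCrossed fun f => hR ?_
  refine mem_jacobson_of_forall_smul_eq_zero fun m hm y => ?_
  have : IsSimpleModule R (R ⧸ m) := isSimpleModule_iff_isCoatom.2 (Ideal.isMaximal_def.1 hm)
  have : IsSemisimpleModule R (D.Coind (R ⧸ m)) := Coind.isSemisimpleModule e he hes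
  have : IsSemisimpleModule D.CrossedProduct (D.Coind (R ⧸ m)) :=
    isSemisimpleModule_of_restrict Coind.incl_smul ht1 ht
  -- Evaluating at `1` the translate by `x` of `b ↦ (id ⊗ f)(b) y` gives `(id ⊗ f)(x) y`, so this
  -- coefficient of `x` kills `R ⧸ m`.
  have h1 : (x • Coind.ofContract y f : D.Coind (R ⧸ m)) 1 = 0 := by
    rw [smul_eq_zero_of_mem_jacobson hx, Coind.zero_apply]
  rwa [Coind.smul_apply, one_mul, Coind.ofContract_apply] at h1

end CrossedSystem

/-- A semisimple Hopf algebra has a right integral of augmentation `1`. -/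
theorem exists_right_integral {k H : Type*} [Field k] [Ring H] [HopfAlgebra k H]
    [IsSemisimpleRing H] : ∃ t : H, Coalgebra.counit (R := k) t = 1 ∧
      ∀ h, t * h = Coalgebra.counit (R := k) h • t := by
  -- The opposite ring is again semisimple, and its left integrals are the right integrals of `H`.
  obtain ⟨t, ht1, ht⟩ := exists_integral_of_isSemisimpleRing
    ((Bialgebra.counitAlgHom k H).fromOpposite fun _ _ => mul_comm _ _)
  exact ⟨t.unop, ht1, fun h => congrArg MulOpposite.unop (ht (MulOpposite.op h))⟩

end

/-! ### The theorem -/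

theorem theorem2p12 {k : Type u} [Field k] {H : Type v} [Ring H] [HopfAlgebra k H]
    {R : Type w} [Ring R] [Algebra k R] (D : CrossedSystem k H R)
    (hss : IsSemisimpleRing H) (hcoss : IsCosemisimple k H)
    (hcc : (∀ a b : H, a * b = b * a) ∨ Coalgebra.IsCocomm k H)
    (hF : ∃ (F : Type x) (_ : Field F) (_ : Algebra k F), IsAlgClosure k F ∧
      jacobsonRadical k (R ⊗[k] F) = subspaceTensor (jacobsonRadical k R) F ∧
      jacobsonRadical k (D.CrossedProduct ⊗[k] F) =
        subspaceTensor (jacobsonRadical k D.CrossedProduct) F) :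
    jacobsonRadical k R = D.hJacobson ∧
      D.hJacobson = D.colon (jacobsonRadical k R) ∧
      jacobsonRadical k D.CrossedProduct = D.subspaceCrossed D.hJacobson := by
  obtain ⟨t, ht1, ht⟩ := exists_integral_of_isSemisimpleRing (Bialgebra.counitAlgHom k H)
  obtain ⟨e, he, hes⟩ := exists_separability_of_integral ht1 ht
  -- Finite dimension comes from semisimplicity alone; it is needed before cosemisimplicity can
  -- supply `τ`.
  have := finiteDimensional_of_separability e he hes
  obtain ⟨τ, hτ1, hτ⟩ := hcoss.exists_integral
  rcases hcc with hH | hH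
  · exact D.radicals_eq_of_commutative hH e he hes hτ1 hτ
  · obtain ⟨t', ht1', ht'⟩ := exists_right_integral (k := k) (H := H)
    exact D.radicals_eq_of_cocommutative ht1' ht' hτ1 hτ
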